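/- Let $F:\mathbb R\to\mathbb R$ be a smooth, negative, even, $1$-periodic function with $F'(0)=F'(\pm\tfrac12)=0$. Put $$\Pi=\{\xi\in\mathbb R^2: -\tfrac12<\xi_1<\tfrac12,\ \xi_2>F(\xi_1)\},\qquad \Gamma=\{\xi\in\mathbb R^2: -\tfrac12<\xi_1<\tfrac12,\ \xi_2=F(\xi_1)\}.$$ For a function $f$ on $\Pi$, a solution $u$ of the problem $$\Delta u=f\ \text{ in }\Pi,\qquad u=0\ \text{ on }\Gamma,\qquad \frac{\partial u}{\partial\xi_1}=0\ \text{ at }\xi_1=\pm\tfrac12 \tag{$P_f$}$$ means a function $u\in C^\infty(\Pi)$ that satisfies $\Delta u=f$ pointwise in $\Pi$, belongs to $H^1(\Pi\cap\{\xi_2<R\})$ for every $R$, has zero trace on $\Gamma$, and satisfies the Neumann condition in the weak sense, i.e. $\int_\Pi\nabla u\cdot\nabla\varphi\,d\xi=-\int_\Pi f\varphi\,d\xi$ for all $\varphi\in C_c^\infty(\mathbb R^2)$ supported in $\{\xi_2>F(\xi_1)\}$. We say that $u=p$ as $\xi_2\to+\infty$ up to exponentially small terms if there is $\varsigma>0$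 such that for every $\delta>0$ and every multi-index $\alpha$ there is a constant $C_{\delta,\alpha}$ with $|\partial^\alpha(u-p)(\xi)|\le C_{\delta,\alpha}e^{-\varsigma\xi_2}$ for all $\xi\in\Pi$ with $\xi_2>\delta$. Then there are constants $C(F)$ and $C_{(II)}(F)$, depending only on $F$, such that the following holds. The problem $(P_0)$ has a solution $X$ with $X\sim\xi_2$ as $\xi_2\to+\infty$ (uniformly in $\xi_1$). For every such $X$, up to exponentially small terms, $$X(\xi)=\xi_2+C(F)\quad\text{as }\xi_2\to+\infty,$$ and the problem $(P_X)$, that is, $\Delta Y=X$ in $\Pi$, $Y=0$ on $\Gamma$, $\partial Y/\partial\xi_1=0$ at $\xi_1=\pm\tfrac12$, has a solution $Y$ with $$Y(\xi)=\tfrac16\xi_2^3+\tfrac12C(F)\,\xi_2^2+C_{(II)}(F)\quad\text{as }\xi_2\to+\infty,$$ up to exponentially small terms. -/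

import Mathlib

open Filter MeasureTheory Asymptotics
open scoped Topology ContDiff Gradient InnerProductSpace Laplacian

/-- The Euclidean plane with coordinates `ξ 0 = ξ₁` and `ξ 1 = ξ₂`. -/
abbrev Plane : Type := EuclideanSpace ℝ (Fin 2)

/-- Admissible profiles: smooth, negative, even, `1`-periodic functions with vanishing derivative
at `0` and `±1/2`. -/
structure IsProfile (F : ℝ → ℝ) : Prop where
  smooth : ContDiff ℝ ∞ F
  neg : ∀ t, F t < 0
  even : ∀ t, F (-t) = F t
  periodic : Function.Periodic F 1
  deriv_zero : deriv F 0 = 0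
  deriv_half : deriv F (1 / 2) = 0
  deriv_neg_half : deriv F (-(1 / 2)) = 0

/-- The semi-infinite strip `Π = {-1/2 < ξ₁ < 1/2, ξ₂ > F(ξ₁)}`. -/
def halfStrip (F : ℝ → ℝ) : Set Plane :=
  {ξ | -(1 / 2) < ξ 0 ∧ ξ 0 < 1 / 2 ∧ F (ξ 0) < ξ 1}

/-- The function `u` has locally finite energy up to the boundary: `u` and `∇u` are square
integrable on every truncation `Π ∩ {ξ₂ < R}`. -/
def HasLocalEnergy (F : ℝ → ℝ) (u : Plane → ℝ) : Prop :=
  ∀ R : ℝ,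
    MemLp u 2 (volume.restrict (halfStrip F ∩ {ξ | ξ 1 < R})) ∧
    MemLp (fun ξ => ∇ u ξ) 2 (volume.restrict (halfStrip F ∩ {ξ | ξ 1 < R}))

/-- `u = 0` on the bottom `Γ = {ξ₂ = F(ξ₁)}` in the sense of traces of `H¹` functions: the
extension of `u` by zero across `Γ` to the whole strip `-1/2 < ξ₁ < 1/2` has the extension of
`∇u` by zero as its weak gradient. -/
def VanishesOnBottom (F : ℝ → ℝ) (u : Plane → ℝ) : Prop :=
  ∀ ψ : Plane → ℝ, ContDiff ℝ ∞ ψ → HasCompactSupport ψ →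
    tsupport ψ ⊆ {ξ | -(1 / 2) < ξ 0 ∧ ξ 0 < 1 / 2} →
    ∀ v : Plane,
      ∫ ξ in halfStrip F, u ξ * fderiv ℝ ψ ξ v = -∫ ξ in halfStrip F, fderiv ℝ u ξ v * ψ ξ

/-- Weak form of `Δu = f` in `Π` together with the Neumann condition `∂u/∂ξ₁ = 0` on the lateral
sides `ξ₁ = ±1/2`: the test functions vanish near `Γ`, but are free on the lateral sides. -/
def WeakNeumannEq (F : ℝ → ℝ) (f u : Plane → ℝ) : Prop :=
  ∀ φ : Plane → ℝ, ContDiff ℝ ∞ φ → HasCompactSupport φ →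
    tsupport φ ⊆ {ξ | F (ξ 0) < ξ 1} →
    ∫ ξ in halfStrip F, ⟪∇ u ξ, ∇ φ ξ⟫_ℝ = -∫ ξ in halfStrip F, f ξ * φ ξ

/-- `u` solves `Δu = f` in `Π`, `u = 0` on `Γ`, `∂u/∂ξ₁ = 0` at `ξ₁ = ±1/2`. The solution is
smooth in the open strip, where it satisfies the equation pointwise; it has finite energy on
truncations, and the boundary conditions hold in the usual weak sense. Only the values of `u` and
`f` in `Π` matter. -/
structure IsStripSolution (F : ℝ → ℝ) (f u : Plane → ℝ) : Prop where
  smooth : ContDiffOn ℝ ∞ u (halfStrip F)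
  equation : ∀ ξ ∈ halfStrip F, Laplacian.laplacian u ξ = f ξ
  energy : HasLocalEnergy F u
  dirichlet : VanishesOnBottom F u
  neumann : WeakNeumannEq F f u

/-- The filter `ξ₂ → +∞` in `Π`, uniformly in `ξ₁`. -/
def stripInfinity (F : ℝ → ℝ) : Filter Plane :=
  comap (fun ξ : Plane => ξ 1) atTop ⊓ 𝓟 (halfStrip F)

/-- `X` solves `ΔX = 0` in `Π`, `X = 0` on `Γ`, `∂X/∂ξ₁ = 0` at `ξ₁ = ±1/2`, and `X ∼ ξ₂` as
`ξ₂ → +∞`. -/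
def IsCellSolution (F : ℝ → ℝ) (X : Plane → ℝ) : Prop :=
  IsStripSolution F (fun _ => 0) X ∧ X ~[stripInfinity F] fun ξ => ξ 1

/-- `u` equals `p` up to exponentially small terms as `ξ₂ → +∞`: there is a rate `ς > 0` such that
on every part `ξ₂ > δ > 0` of `Π` the derivatives of `u - p` of each order are bounded by a
constant (depending on `δ` and the order) times `exp (-ς ξ₂)`. -/
def EqUpToExpSmall (F : ℝ → ℝ) (u p : Plane → ℝ) : Prop :=
  ∃ ς : ℝ, 0 < ς ∧ ∀ δ : ℝ, 0 < δ → ∀ k : ℕ, ∃ K : ℝ, ∀ ξ ∈ halfStrip F, δ < ξ 1 →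
    ‖iteratedFDeriv ℝ k (fun η => u η - p η) ξ‖ ≤ K * Real.exp (-ς * ξ 1)

/-! The source is always harmonic: it is 0 for `X` and `X` itself for `Y`. Hence every solution is
biharmonic, and one Weyl lemma for biharmonic distributions gives smooth representatives together
with interior bounds of all derivatives by L¹ norms (`WeaklyBiharmonicOn.ae_eq`,
`norm_iteratedFDeriv_weylRep_le`).

Existence is variational. Let p be the expected growth, with p'' equal to the source up to
exponentially small terms. Multiplied by a cutoff that vanishes for ξ₂ ≤ 0, it vanishes on Γ because
F < 0, and after subtracting it the remaining source decays exponentially. A weighted Poincaré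
inequality and Riesz representation then give a solution whose correction has gradient in L²
(`exists_weak_solution`, `exists_strip_solution`).

Asymptotics come from sections ξ₂ = t. The lateral Neumann condition allows an even reflection to a
smooth function on a strip three times as wide. If the source is exponentially small with zero
section means, the section mean of the solution is affine in t. Once this mean is subtracted, the
section integral N of the square satisfies N'' ≥ N - K e^{-ct} by the Poincaré–Wirtinger inequality.
Such an N grows at least like e^t or decays exponentially (`exp_growth_or_decay`). Integrability
excludes growth, the interior bounds upgrade decay of N to decay of all derivatives
(`IsNeumannSolution.growth_or_expSmall`), and square integrability of the vertical derivative forces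
slope zero (`IsNeumannSolution.slope_eq_zero`). The outcome is p + constant up to exponentially
small terms (`exists_solution_with_asymptotics`). Taking p = t gives `X` and C. Since the section
means of X - ξ₂ equal C exactly, X - (ξ₂ + C) is an admissible remainder, and p = t³/6 + C t²/2
gives `Y` and the second constant, with no linear term.

For uniqueness, the difference of two cell solutions is o(ξ₂), hence tends exponentially fast to a
constant. Its energy vanishes in the limit of a cut off energy identity, so it is constant, and zero
trace makes it 0 (`eq_zero_of_tendsto_const`). This requires using the zero-trace function itself as
a test function, which is justified by squeezing it off the boundary and mollifying
(`VanishesOnBottom.integral_eq_zero_of_tests`). -/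

open scoped Convolution

/-! ### Coordinate derivatives, test functions and integration by parts -/

/-- The partial derivative of `u` in the `i`-th coordinate direction. -/
noncomputable def pd (i : Fin 2) (u : Plane → ℝ) (x : Plane) : ℝ :=
  fderiv ℝ u x (EuclideanSpace.single i 1)

/-- Smooth functions with compact support contained in `U`. -/
structure IsTest (U : Set Plane) (φ : Plane → ℝ) : Prop where
  smooth : ContDiff ℝ ∞ φ
  compact : HasCompactSupport φ
  supp : tsupport φ ⊆ U

theorem ContDiffOn.pd {i : Fin 2} {u : Plane → ℝ} {U : Set Plane} (hU : IsOpen U)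
    (h : ContDiffOn ℝ ∞ u U) : ContDiffOn ℝ ∞ (pd i u) U :=
  (h.fderiv_of_isOpen hU (by simp)).clm_apply contDiffOn_const

theorem ContDiff.pd {i : Fin 2} {u : Plane → ℝ} (h : ContDiff ℝ ∞ u) : ContDiff ℝ ∞ (pd i u) :=
  contDiffOn_univ.1 (ContDiffOn.pd isOpen_univ h.contDiffOn)

theorem tsupport_pd_subset (i : Fin 2) (φ : Plane → ℝ) : tsupport (pd i φ) ⊆ tsupport φ :=
  tsupport_fderiv_apply_subset ℝ _

theorem IsTest.pd {U : Set Plane} {φ : Plane → ℝ} (h : IsTest U φ) (i : Fin 2) :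
    IsTest U (pd i φ) :=
  ⟨ContDiff.pd h.smooth, h.compact.mono' ((subset_tsupport _).trans (tsupport_pd_subset i φ)),
    (tsupport_pd_subset i φ).trans h.supp⟩

theorem IsTest.mono {U V : Set Plane} {φ : Plane → ℝ} (h : IsTest U φ) (hUV : U ⊆ V) :
    IsTest V φ := ⟨h.smooth, h.compact, h.supp.trans hUV⟩

theorem IsTest.add {U : Set Plane} {φ ψ : Plane → ℝ} (h : IsTest U φ) (h' : IsTest U ψ) :
    IsTest U (fun x => φ x + ψ x) :=
  ⟨h.smooth.add h'.smooth, h.compact.add h'.compact,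
    (tsupport_add φ ψ).trans (Set.union_subset h.supp h'.supp)⟩

theorem IsTest.mul_left {U : Set Plane} {φ g : Plane → ℝ} (h : IsTest U φ) (hg : ContDiff ℝ ∞ g) :
    IsTest U (fun x => g x * φ x) :=
  ⟨hg.mul h.smooth, h.compact.mul_left, (tsupport_mul_subset_right).trans h.supp⟩

theorem IsTest.eq_zero {U : Set Plane} {φ : Plane → ℝ} (h : IsTest U φ) {x : Plane} (hx : x ∉ U) :
    φ x = 0 := image_eq_zero_of_notMem_tsupport fun hh => hx (h.supp hh)

theorem laplacian_eq_pd {u : Plane → ℝ} {x : Plane} (h : ContDiffAt ℝ 2 u x) :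
    Δ u x = pd 0 (pd 0 u) x + pd 1 (pd 1 u) x := by
  have hd : DifferentiableAt ℝ (fderiv ℝ u) x :=
    (h.fderiv_right (m := 1) (by norm_num)).differentiableAt (by norm_num)
  have hk : ∀ i : Fin 2, pd i (pd i u) x
      = fderiv ℝ (fderiv ℝ u) x (EuclideanSpace.single i 1) (EuclideanSpace.single i 1) := by
    intro i
    have : pd i u = fun y => fderiv ℝ u y (EuclideanSpace.single i 1) := rfl
    rw [this, pd, fderiv_clm_apply hd (by fun_prop)]
    simp
  rw [InnerProductSpace.laplacian_eq_iteratedFDeriv_orthonormalBasis u (EuclideanSpace.basisFun (Fin 2) ℝ)]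
  simp [iteratedFDeriv_two_apply, hk]

theorem laplacian_fun_eq_pd {u : Plane → ℝ} (h : ContDiff ℝ ∞ u) :
    Δ u = fun x => pd 0 (pd 0 u) x + pd 1 (pd 1 u) x :=
  funext fun _ => laplacian_eq_pd (h.contDiffAt.of_le (by norm_cast))

theorem IsTest.laplacian {U : Set Plane} {φ : Plane → ℝ} (h : IsTest U φ) : IsTest U (Δ φ) := by
  rw [laplacian_fun_eq_pd h.smooth]
  exact ((h.pd 0).pd 0).add ((h.pd 1).pd 1)

theorem fderiv_eq_pd (u : Plane → ℝ) (x v : Plane) :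
    fderiv ℝ u x v = v 0 * pd 0 u x + v 1 * pd 1 u x := by
  have : v = v 0 • EuclideanSpace.single 0 (1:ℝ) + v 1 • EuclideanSpace.single 1 (1:ℝ) := by
    ext i; fin_cases i <;> simp
  conv_lhs => rw [this]
  simp [pd]

theorem gradient_apply (u : Plane → ℝ) (x : Plane) (i : Fin 2) : (∇ u x) i = pd i u x := by
  have := inner_gradient_left (𝕜 := ℝ) (f := u) (x := x) (y := EuclideanSpace.single i (1:ℝ))
  rw [pd, ← this, EuclideanSpace.inner_single_right]
  simp

theorem inner_gradient (u φ : Plane → ℝ) (x : Plane) :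
    ⟪∇ u x, ∇ φ x⟫_ℝ = pd 0 u x * pd 0 φ x + pd 1 u x * pd 1 φ x := by
  rw [inner_gradient_left, fderiv_eq_pd, gradient_apply, gradient_apply]; ring

theorem MeasureTheory.LocallyIntegrableOn.integrable_mul_test {u ψ : Plane → ℝ} {U : Set Plane}
    (hu : LocallyIntegrableOn u U) (hψ : Continuous ψ) (hc : HasCompactSupport ψ)
    (hs : tsupport ψ ⊆ U) : Integrable (fun x => u x * ψ x) := by
  have hK : IntegrableOn u (tsupport ψ) := hu.integrableOn_compact_subset hs hc
  have h1 : IntegrableOn (fun x => u x * ψ x) (tsupport ψ) :=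
    hK.mul_continuousOn hψ.continuousOn hc
  refine (integrableOn_iff_integrable_of_support_subset ?_).1 h1
  exact (Function.support_mul_subset_right u ψ).trans (subset_tsupport ψ)

theorem ContinuousOn.integrable_mul_test {u ψ : Plane → ℝ} {U : Set Plane} (hU : IsOpen U)
    (hu : ContinuousOn u U) (hψ : Continuous ψ) (hc : HasCompactSupport ψ)
    (hs : tsupport ψ ⊆ U) : Integrable (fun x => u x * ψ x) :=
  (hu.locallyIntegrableOn hU.measurableSet).integrable_mul_test hψ hc hs

/-- Integration by parts against a test function. -/
theorem integral_mul_pd {u φ : Plane → ℝ} {U : Set Plane} (hU : IsOpen U)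
    (hu : ContDiffOn ℝ ∞ u U) (hφ : IsTest U φ) (i : Fin 2) :
    ∫ x, u x * pd i φ x = -∫ x, pd i u x * φ x := by
  have h1 := hu.continuousOn.integrable_mul_test hU (hφ.pd i).smooth.continuous (hφ.pd i).compact
    (hφ.pd i).supp
  have h2 := (ContDiffOn.pd (i := i) hU hu).continuousOn.integrable_mul_test hU
    hφ.smooth.continuous hφ.compact hφ.supp
  have h3 := hu.continuousOn.integrable_mul_test hU hφ.smooth.continuous hφ.compact hφ.supp
  exact integral_mul_fderiv_eq_neg_fderiv_mul_of_integrable h2 h1 h3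
    (fun x hx => (hu.contDiffAt (hU.mem_nhds (hφ.supp hx))).differentiableAt (by simp))
    (fun x _ => hφ.smooth.differentiable (by simp) x)

/-- Green's second identity against a test function. -/
theorem integral_mul_laplacian {u φ : Plane → ℝ} {U : Set Plane} (hU : IsOpen U)
    (hu : ContDiffOn ℝ ∞ u U) (hφ : IsTest U φ) :
    ∫ x, u x * Δ φ x = ∫ x, Δ u x * φ x := by
  have key : ∀ i, ∫ x, u x * pd i (pd i φ) x = ∫ x, pd i (pd i u) x * φ x := by
    intro i
    rw [integral_mul_pd hU hu (hφ.pd i), integral_mul_pd hU (ContDiffOn.pd hU hu) hφ, neg_neg]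
  -- Outside `U` nothing is known about `u`, but `φ` vanishes there.
  have e2 : ∀ x, Δ u x * φ x = pd 0 (pd 0 u) x * φ x + pd 1 (pd 1 u) x * φ x := by
    intro x
    by_cases hx : x ∈ U
    · rw [laplacian_eq_pd ((hu.contDiffAt (hU.mem_nhds hx)).of_le (by norm_cast))]
      ring
    · simp [hφ.eq_zero hx]
  simp_rw [e2, laplacian_fun_eq_pd hφ.smooth, mul_add]
  have a : ∀ i, Integrable fun x => u x * pd i (pd i φ) x := fun i =>
    hu.continuousOn.integrable_mul_test hU ((hφ.pd i).pd i).smooth.continuous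
      ((hφ.pd i).pd i).compact ((hφ.pd i).pd i).supp
  have b : ∀ i, Integrable fun x => pd i (pd i u) x * φ x := fun i =>
    (ContDiffOn.pd hU (ContDiffOn.pd hU hu)).continuousOn.integrable_mul_test hU
      hφ.smooth.continuous hφ.compact hφ.supp
  rw [integral_add (a 0) (a 1), integral_add (b 0) (b 1), key, key]

theorem measurePreserving_plane :
    MeasurePreserving (fun p : ℝ × ℝ => (!₂[p.1, p.2] : Plane)) :=
  (PiLp.volume_preserving_toLp (Fin 2)).comp
    (volume_preserving_finTwoArrow ℝ).symm

theorem measurableEmbedding_plane :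
    MeasurableEmbedding (fun p : ℝ × ℝ => (!₂[p.1, p.2] : Plane)) :=
  ((MeasurableEquiv.finTwoArrow (α := ℝ)).symm.trans
    (MeasurableEquiv.toLp 2 (Fin 2 → ℝ))).measurableEmbedding

theorem isOpen_halfStrip {F : ℝ → ℝ} (hF : Continuous F) : IsOpen (halfStrip F) := by
  have h0 : Continuous fun ξ : Plane => ξ 0 := by fun_prop
  have h1 : Continuous fun ξ : Plane => ξ 1 := by fun_prop
  exact (isOpen_lt continuous_const h0).inter
    ((isOpen_lt h0 continuous_const).inter (isOpen_lt (hF.comp h0) h1))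

theorem setIntegral_mul_test {u φ : Plane → ℝ} {U V : Set Plane} (hφ : IsTest U φ) (h : U ⊆ V) :
    ∫ x in V, u x * φ x = ∫ x, u x * φ x :=
  setIntegral_eq_integral_of_forall_compl_eq_zero fun x hx => by
    simp [hφ.eq_zero fun hh => hx (h hh)]

/-! ### Weyl's lemma for biharmonic functions: the radial kernel -/

/-- All derivatives fall on the kernel, so only the L¹ norm of `f` enters. The target space `E'`
varies because differentiating `K` in the induction produces a kernel with values in linear maps. -/
theorem norm_iteratedFDeriv_convolution_le (k : ℕ) : ∀ {E' : Type} [NormedAddCommGroup E']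
    [NormedSpace ℝ E'] (K : Plane → E'), ContDiff ℝ ∞ K → HasCompactSupport K →
    ∃ C : ℝ, 0 ≤ C ∧ ∀ f : Plane → ℝ, Integrable f → ∀ x,
      ‖iteratedFDeriv ℝ k (f ⋆[ContinuousLinearMap.lsmul ℝ ℝ, volume] K) x‖ ≤ C * ∫ y, ‖f y‖ := by
  induction k with
  | zero =>
    intro E' _ _ K hK hc
    obtain ⟨C, hC⟩ := hc.exists_bound_of_continuous hK.continuous
    refine ⟨C, (norm_nonneg _).trans (hC 0), fun f hf x => ?_⟩
    rw [norm_iteratedFDeriv_zero, ← integral_const_mul]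
    refine norm_integral_le_of_norm_le (hf.norm.const_mul C) (Eventually.of_forall fun y => ?_)
    simp only [ContinuousLinearMap.lsmul_apply, norm_smul]
    rw [mul_comm]
    exact mul_le_mul_of_nonneg_right (hC _) (norm_nonneg _)
  | succ k ih =>
    intro E' _ _ K hK hc
    obtain ⟨C, hC0, hC⟩ := ih (fderiv ℝ K) (hK.fderiv_right (by simp)) (hc.fderiv ℝ)
    refine ⟨C, hC0, fun f hf x => ?_⟩
    have : fderiv ℝ (f ⋆[ContinuousLinearMap.lsmul ℝ ℝ, volume] K)
        = f ⋆[ContinuousLinearMap.lsmul ℝ ℝ, volume] (fderiv ℝ K) := by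
      funext z
      rw [(hc.hasFDerivAt_convolution_right (ContinuousLinearMap.lsmul ℝ ℝ) hf.locallyIntegrable
        (hK.of_le (by simp)) z).fderiv]
      rfl
    rw [← norm_iteratedFDeriv_fderiv, this]
    exact hC f hf x

theorem hasCompactSupport_comp_norm_sq {g : ℝ → ℝ} (hg : ∀ s, 1 ≤ s → g s = 0) {m : ℝ} (hm : 0 < m)
    (x : Plane) :
    tsupport (fun y : Plane => g (m ^ 2 * ‖y - x‖ ^ 2)) ⊆ Metric.closedBall x (1 / m) := by
  refine closure_minimal ?_ Metric.isClosed_closedBall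
  intro y hy
  by_contra hn
  apply hy
  apply hg
  rw [Metric.mem_closedBall, dist_eq_norm, not_le, div_lt_iff₀ hm] at hn
  nlinarith [norm_nonneg (y - x)]

/-- The radial part of the planar Laplacian in the variable `s = |z|²`. -/
noncomputable def radialLaplacian (g : ℝ → ℝ) (s : ℝ) : ℝ :=
  4 * (s * deriv (deriv g) s + deriv g s)

theorem ContDiff.deriv_real {g : ℝ → ℝ} (hg : ContDiff ℝ ∞ g) : ContDiff ℝ ∞ (deriv g) :=
  ((contDiff_infty_iff_deriv).1 hg).2

theorem ContDiff.radialLaplacian {g : ℝ → ℝ} (hg : ContDiff ℝ ∞ g) :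
    ContDiff ℝ ∞ (radialLaplacian g) :=
  contDiff_const.mul ((contDiff_id.mul hg.deriv_real.deriv_real).add hg.deriv_real)

theorem norm_sq_sub_eq (x y : Plane) : ‖y - x‖ ^ 2 = (y 0 - x 0) ^ 2 + (y 1 - x 1) ^ 2 := by
  rw [EuclideanSpace.norm_sq_eq]; simp

theorem hasFDerivAt_coord (i : Fin 2) (y : Plane) :
    HasFDerivAt (fun y : Plane => y i) (EuclideanSpace.proj i : Plane →L[ℝ] ℝ) y :=
  (EuclideanSpace.proj i : Plane →L[ℝ] ℝ).hasFDerivAt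

theorem pd_radial {g : ℝ → ℝ} (hg : ContDiff ℝ ∞ g) (l : ℝ) (x : Plane) (i : Fin 2) :
    pd i (fun y => g (l * ‖y - x‖ ^ 2)) = fun y => deriv g (l * ‖y - x‖ ^ 2) * (2 * l * (y i - x i)) := by
  funext y
  have h : HasFDerivAt (fun y : Plane => l * ‖y - x‖ ^ 2)
      (l • ((2 * (y 0 - x 0)) • (EuclideanSpace.proj 0 : Plane →L[ℝ] ℝ)
        + (2 * (y 1 - x 1)) • (EuclideanSpace.proj 1 : Plane →L[ℝ] ℝ))) y := by
    simp_rw [norm_sq_sub_eq]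
    have h0 := ((hasFDerivAt_coord 0 y).sub_const (x 0)).pow 2
    have h1 := ((hasFDerivAt_coord 1 y).sub_const (x 1)).pow 2
    have h2 := (h0.add h1).const_mul l
    refine HasFDerivAt.congr_fderiv h2 ?_
    ext v; simp
  have hg' := (hg.differentiable (by simp) (l * ‖y - x‖ ^ 2)).hasDerivAt.comp_hasFDerivAt y h
  rw [pd]
  have e : (fun y => g (l * ‖y - x‖ ^ 2)) = g ∘ fun y => l * ‖y - x‖ ^ 2 := rfl
  rw [e, hg'.fderiv]
  fin_cases i <;> simp <;> ring_nf <;> simp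

theorem contDiff_radial {g : ℝ → ℝ} (hg : ContDiff ℝ ∞ g) (l : ℝ) (x : Plane) :
    ContDiff ℝ ∞ fun y : Plane => g (l * ‖y - x‖ ^ 2) :=
  hg.comp (contDiff_const.mul ((contDiff_id.sub contDiff_const).norm_sq ℝ))

theorem laplacian_radial {g : ℝ → ℝ} (hg : ContDiff ℝ ∞ g) (l : ℝ) (x : Plane) :
    Δ (fun y => g (l * ‖y - x‖ ^ 2)) = fun y => l * radialLaplacian g (l * ‖y - x‖ ^ 2) := by
  rw [laplacian_fun_eq_pd (contDiff_radial hg l x)]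
  have key : ∀ i, pd i (pd i (fun y => g (l * ‖y - x‖ ^ 2))) = fun y =>
      deriv (deriv g) (l * ‖y - x‖ ^ 2) * (2 * l * (y i - x i)) ^ 2
        + deriv g (l * ‖y - x‖ ^ 2) * (2 * l) := by
    intro i
    rw [pd_radial hg]
    funext y
    have h1 : HasFDerivAt (fun y => deriv g (l * ‖y - x‖ ^ 2))
        (fderiv ℝ (fun y => deriv g (l * ‖y - x‖ ^ 2)) y) y :=
      ((contDiff_radial hg.deriv_real l x).differentiable (by simp) y).hasFDerivAt
    have h2 : HasFDerivAt (fun y : Plane => 2 * l * (y i - x i))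
        ((2 * l) • (EuclideanSpace.proj i : Plane →L[ℝ] ℝ)) y :=
      ((hasFDerivAt_coord i y).sub_const (x i)).const_mul _
    have h4 : HasFDerivAt (fun y => deriv g (l * ‖y - x‖ ^ 2) * (2 * l * (y i - x i))) _ y :=
      h1.mul h2
    rw [pd, h4.fderiv]
    have h3 := congrFun (pd_radial hg.deriv_real l x i) y
    rw [pd] at h3
    simp [h3]
    ring
  rw [key, key]
  funext y
  rw [radialLaplacian]
  conv_rhs => rw [norm_sq_sub_eq]
  simp only [norm_sq_sub_eq]
  ring

/-- The profile `s θ(s)`, where `θ` is a smooth cutoff. -/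
noncomputable def weylProfile (s : ℝ) : ℝ := s * Real.smoothTransition (2 - 2 * s)

theorem contDiff_weylProfile : ContDiff ℝ ∞ weylProfile :=
  contDiff_id.mul (Real.smoothTransition.contDiff.comp (contDiff_const.sub (contDiff_const.mul contDiff_id)))

/-- Slope 1 at the origin is what matters: it makes `radialLaplacian weylProfile 0` equal to 4, and
hence the kernel has nonzero mass. -/
theorem weylProfile_eventuallyEq_zero : weylProfile =ᶠ[𝓝 0] id := by
  filter_upwards [Iio_mem_nhds (show (0:ℝ) < 1 / 2 by norm_num)] with s hs
  have : (1:ℝ) ≤ 2 - 2 * s := by have := Set.mem_Iio.1 hs; linarith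
  simp [weylProfile, Real.smoothTransition.one_of_one_le this]

theorem weylProfile_eq_zero {s : ℝ} (hs : 1 ≤ s) : weylProfile s = 0 := by
  simp [weylProfile, Real.smoothTransition.zero_of_nonpos (show 2 - 2 * s ≤ 0 by linarith)]

theorem deriv_eq_zero_of_eq_zero {g : ℝ → ℝ} (hg : ContDiff ℝ ∞ g) (h : ∀ s, 1 ≤ s → g s = 0) :
    ∀ s, 1 ≤ s → deriv g s = 0 := by
  have h1 : ∀ s, 1 < s → deriv g s = 0 := by
    intro s hs
    have : g =ᶠ[𝓝 s] fun _ => 0 := by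
      filter_upwards [Ioi_mem_nhds hs] with t ht using h t (le_of_lt ht)
    rw [this.deriv_eq]; simp
  intro s hs
  have hcl : s ∈ closure (Set.Ioi (1:ℝ)) := by rw [closure_Ioi]; exact hs
  exact (isClosed_eq hg.deriv_real.continuous continuous_const).closure_subset_iff.2 (fun t ht => h1 t ht) hcl

theorem radialLaplacian_eq_zero_of_eq_zero {g : ℝ → ℝ} (hg : ContDiff ℝ ∞ g)
    (h : ∀ s, 1 ≤ s → g s = 0) : ∀ s, 1 ≤ s → radialLaplacian g s = 0 := by
  intro s hs
  have h1 := deriv_eq_zero_of_eq_zero hg h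
  rw [radialLaplacian, h1 s hs, deriv_eq_zero_of_eq_zero hg.deriv_real h1 s hs]; ring

/-- Unnormalised profile of the kernel reproducing biharmonic functions. -/
noncomputable def weylKernel (s : ℝ) : ℝ := 4 * deriv (radialLaplacian weylProfile) s

theorem contDiff_weylKernel : ContDiff ℝ ∞ weylKernel :=
  contDiff_const.mul contDiff_weylProfile.radialLaplacian.deriv_real

theorem weylKernel_eq_zero : ∀ s, 1 ≤ s → weylKernel s = 0 := fun s hs => by
  rw [weylKernel, deriv_eq_zero_of_eq_zero contDiff_weylProfile.radialLaplacian
    (radialLaplacian_eq_zero_of_eq_zero contDiff_weylProfile fun s => weylProfile_eq_zero) s hs, mul_zero]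

/-- With k the kernel and s = m²r², the derivative of m² k(m²r²) in m is 2m (s k'(s) + k(s)). The
kernel is chosen so that this expression is a bilaplacian. -/
theorem radialLaplacian_radialLaplacian_weylProfile (s : ℝ) :
    radialLaplacian (radialLaplacian weylProfile) s = s * deriv weylKernel s + weylKernel s := by
  have : deriv weylKernel s = 4 * deriv (deriv (radialLaplacian weylProfile)) s := by
    unfold weylKernel
    rw [deriv_const_mul_field]
  rw [this, weylKernel, radialLaplacian]; ring

/-- In polar coordinates r k(r²) is the derivative of `2 * radialLaplacian weylProfile (r ^ 2)`,
which falls from 8 at r = 0 to 0 at r = 1. -/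
theorem integral_weylKernel_ne_zero : ∫ z : Plane, weylKernel (‖z‖ ^ 2) ≠ 0 := by
  rw [integral_fun_norm_addHaar volume (fun r => weylKernel (r ^ 2))]
  have hd : ∀ r : ℝ, HasDerivAt (fun r => 2 * radialLaplacian weylProfile (r ^ 2))
      (r * weylKernel (r ^ 2)) r := by
    intro r
    have h1 := (contDiff_weylProfile.radialLaplacian.differentiable (by simp) (r ^ 2)).hasDerivAt
    have h3 : HasDerivAt (fun r : ℝ => r ^ 2) (2 * r) r := by simpa using hasDerivAt_pow 2 r
    have h2 : HasDerivAt (fun r => 2 * radialLaplacian weylProfile (r ^ 2)) _ r :=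
      (HasDerivAt.comp (h := fun r : ℝ => r ^ 2) r h1 h3).const_mul 2
    refine h2.congr_deriv ?_
    rw [weylKernel]; ring
  have hz : ∀ r, 1 ≤ r → r * weylKernel (r ^ 2) = 0 := fun r hr => by
    rw [weylKernel_eq_zero _ (by nlinarith), mul_zero]
  have hint : IntegrableOn (fun r : ℝ => r * weylKernel (r ^ 2)) (Set.Ioi 0) := by
    have hc : Continuous fun r : ℝ => r * weylKernel (r ^ 2) :=
      continuous_id.mul (contDiff_weylKernel.continuous.comp (continuous_pow 2))
    have h1 : IntegrableOn (fun r : ℝ => r * weylKernel (r ^ 2)) (Set.Icc 0 1) :=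
      hc.continuousOn.integrableOn_compact isCompact_Icc
    refine IntegrableOn.of_forall_sdiff_eq_zero h1 measurableSet_Ioi ?_
    intro r hr
    refine hz r ?_
    by_contra hlt
    exact hr.2 ⟨(Set.mem_Ioi.1 hr.1).le, (not_le.1 hlt).le⟩
  have key : ∫ r in Set.Ioi (0:ℝ), r * weylKernel (r ^ 2) = 0 - 2 * radialLaplacian weylProfile (0 ^ 2) := by
    refine integral_Ioi_of_hasDerivAt_of_tendsto' (fun r _ => hd r) hint ?_
    refine tendsto_const_nhds.congr' ?_
    filter_upwards [eventually_ge_atTop 1] with r hr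
    rw [radialLaplacian_eq_zero_of_eq_zero contDiff_weylProfile (fun s => weylProfile_eq_zero) _
      (by nlinarith), mul_zero]
  have h0 : radialLaplacian weylProfile 0 = 4 := by
    rw [radialLaplacian, weylProfile_eventuallyEq_zero.deriv_eq]; simp
  have h2 : Module.finrank ℝ Plane = 2 := by simp
  simp only [h2, smul_eq_mul, pow_one, Nat.add_one_sub_one, nsmul_eq_mul]
  rw [key]
  have hv : 0 < volume.real (Metric.ball (0 : Plane) 1) := by
    rw [measureReal_def]
    exact ENNReal.toReal_pos (Metric.measure_ball_pos _ _ one_pos).ne' measure_ball_lt_top.ne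
  have : (0:ℝ) ^ 2 = 0 := by norm_num
  rw [this, h0]
  have := hv.ne'
  simp only [ne_eq, mul_eq_zero]
  push Not
  refine ⟨by norm_num, this, by norm_num⟩

/-! ### Scale-independent means and the smooth representative -/

/-- The average of `u` around `x` at scale `1 / m` with the kernel reproducing biharmonic
functions. -/
noncomputable def weylMean (u : Plane → ℝ) (m : ℝ) (x : Plane) : ℝ :=
  (∫ z : Plane, weylKernel (‖z‖ ^ 2))⁻¹ * ∫ y, u y * (m ^ 2 * weylKernel (m ^ 2 * ‖y - x‖ ^ 2))

/-- `u` is biharmonic on `U` in the sense of distributions. -/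
structure WeaklyBiharmonicOn (U : Set Plane) (u : Plane → ℝ) : Prop where
  locInt : LocallyIntegrableOn u U
  eq : ∀ φ, IsTest U φ → ∫ x, u x * Δ (Δ φ) x = 0

theorem isTest_radial {g : ℝ → ℝ} (hg : ContDiff ℝ ∞ g) (h1 : ∀ s, 1 ≤ s → g s = 0) {U : Set Plane}
    {x : Plane} {r m : ℝ} (hr : 0 < r) (hU : Metric.closedBall x r ⊆ U) (hm : 1 / r < m) :
    IsTest U fun y : Plane => g (m ^ 2 * ‖y - x‖ ^ 2) := by
  have hm0 : 0 < m := (by positivity : (0:ℝ) < 1 / r).trans hm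
  have hs := hasCompactSupport_comp_norm_sq h1 hm0 x
  have hle : 1 / m ≤ r := by
    rw [div_le_iff₀ hm0]; rw [div_lt_iff₀ hr] at hm; linarith
  exact ⟨contDiff_radial hg _ x, (isCompact_closedBall x (1 / m)).of_isClosed_subset (isClosed_tsupport _) hs,
    hs.trans ((Metric.closedBall_subset_closedBall hle).trans hU)⟩

theorem laplacian_laplacian_weylProfile (m : ℝ) (x : Plane) :
    Δ (Δ fun y => weylProfile (m ^ 2 * ‖y - x‖ ^ 2)) = fun y => m ^ 2 * (m ^ 2 *
      radialLaplacian (radialLaplacian weylProfile) (m ^ 2 * ‖y - x‖ ^ 2)) := by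
  rw [laplacian_radial contDiff_weylProfile]
  have := laplacian_radial (g := fun s => m ^ 2 * radialLaplacian weylProfile s)
    (contDiff_const.mul contDiff_weylProfile.radialLaplacian) (m ^ 2) x
  rw [this]
  funext y
  rw [radialLaplacian, radialLaplacian]
  have e : deriv (fun s => m ^ 2 * radialLaplacian weylProfile s)
      = fun s => m ^ 2 * deriv (radialLaplacian weylProfile) s := by
    funext s; rw [deriv_const_mul_field]
  rw [e, deriv_const_mul_field]
  ring

/-- Differentiating the kernel in the scale gives 2/m³ times the bilaplacian of a test function, and
`u` integrates to zero against that. -/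
theorem WeaklyBiharmonicOn.hasDerivAt_weylMean {U : Set Plane} {u : Plane → ℝ}
    (h : WeaklyBiharmonicOn U u) {x : Plane} {r m : ℝ} (hr : 0 < r)
    (hU : Metric.closedBall x r ⊆ U) (hm : 1 / r < m) :
    HasDerivAt (fun m => weylMean u m x) 0 m := by
  have hm0 : 0 < m := (by positivity : (0:ℝ) < 1 / r).trans hm
  set B := Metric.closedBall x r
  have hB : IntegrableOn u B := h.locInt.integrableOn_compact_subset hU (isCompact_closedBall x r)
  set L2 := radialLaplacian (radialLaplacian weylProfile) with hL2
  have hL2s : ContDiff ℝ ∞ L2 := contDiff_weylProfile.radialLaplacian.radialLaplacian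
  have hL20 : ∀ s, 1 ≤ s → L2 s = 0 := radialLaplacian_eq_zero_of_eq_zero
    contDiff_weylProfile.radialLaplacian
    (radialLaplacian_eq_zero_of_eq_zero contDiff_weylProfile fun s => weylProfile_eq_zero)
  obtain ⟨C, hC⟩ : ∃ C, ∀ s, 0 ≤ s → |L2 s| ≤ C := by
    obtain ⟨C, hC⟩ := isCompact_Icc.exists_bound_of_continuousOn (s := Set.Icc (0:ℝ) 1)
      hL2s.continuous.continuousOn
    refine ⟨C, fun s hs => ?_⟩
    by_cases h1 : s ≤ 1
    · exact hC s ⟨hs, h1⟩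
    · rw [hL20 s (not_le.1 h1).le, abs_zero]
      exact (norm_nonneg _).trans (hC 0 ⟨le_rfl, zero_le_one⟩)
  have hcont : ∀ g : ℝ → ℝ, ContDiff ℝ ∞ g → ∀ a l : ℝ, Continuous fun y : Plane => a * g (l * ‖y - x‖ ^ 2) :=
    fun g hg a l => continuous_const.mul (contDiff_radial hg l x).continuous
  -- The integral is taken over the fixed ball `B`, where `u` is integrable and a dominating
  -- function exists; kernels of scale above `1 / r` live inside `B`.
  have hder : HasDerivAt (fun m => ∫ y in B, u y * (m ^ 2 * weylKernel (m ^ 2 * ‖y - x‖ ^ 2)))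
      (∫ y in B, u y * (2 * m * L2 (m ^ 2 * ‖y - x‖ ^ 2))) m := by
    refine (hasDerivAt_integral_of_dominated_loc_of_deriv_le (s := Metric.ball m 1)
      (bound := fun y => ‖u y‖ * (2 * (|m| + 1) * C)) (Metric.ball_mem_nhds m one_pos)
      (F' := fun m y => u y * (2 * m * L2 (m ^ 2 * ‖y - x‖ ^ 2))) ?_ ?_ ?_ ?_ ?_ ?_).2
    · exact Eventually.of_forall fun m' => hB.aestronglyMeasurable.mul
        (hcont _ contDiff_weylKernel _ _).aestronglyMeasurable
    · exact hB.mul_continuousOn (hcont _ contDiff_weylKernel _ _).continuousOn (isCompact_closedBall x r)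
    · exact hB.aestronglyMeasurable.mul (hcont _ hL2s _ _).aestronglyMeasurable
    · refine Eventually.of_forall fun y m' hm' => ?_
      rw [norm_mul, norm_mul, Real.norm_eq_abs (L2 _), norm_mul, Real.norm_two, Real.norm_eq_abs m']
      have h1 : |m'| ≤ |m| + 1 := by
        rw [Metric.mem_ball, dist_eq_norm, Real.norm_eq_abs] at hm'
        have := abs_sub_abs_le_abs_sub m' m
        linarith
      have h2 := hC (m' ^ 2 * ‖y - x‖ ^ 2) (by positivity)
      gcongr
    · exact hB.norm.mul_const _
    · refine Eventually.of_forall fun y m' _ => ?_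
      have h3 : HasDerivAt (fun m : ℝ => m ^ 2 * ‖y - x‖ ^ 2) (2 * m' * ‖y - x‖ ^ 2) m' := by
        simpa using (hasDerivAt_pow 2 m').mul_const (‖y - x‖ ^ 2)
      have h4 : HasDerivAt (fun m : ℝ => m ^ 2) (2 * m') m' := by simpa using hasDerivAt_pow 2 m'
      have h5 := (contDiff_weylKernel.differentiable (by simp) (m' ^ 2 * ‖y - x‖ ^ 2)).hasDerivAt
      have h6 : HasDerivAt (fun m : ℝ => weylKernel (m ^ 2 * ‖y - x‖ ^ 2)) _ m' :=
        HasDerivAt.comp (h := fun m : ℝ => m ^ 2 * ‖y - x‖ ^ 2) m' h5 h3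
      have h7 := (h4.mul h6).const_mul (u y)
      refine HasDerivAt.congr_deriv h7 ?_
      rw [hL2, radialLaplacian_radialLaplacian_weylProfile]
      ring
  have hz : ∫ y in B, u y * (2 * m * L2 (m ^ 2 * ‖y - x‖ ^ 2)) = 0 := by
    have h1 := h.eq _ (isTest_radial contDiff_weylProfile (fun s => weylProfile_eq_zero) hr hU hm)
    rw [laplacian_laplacian_weylProfile] at h1
    have h2 : ∀ y, u y * (2 * m * L2 (m ^ 2 * ‖y - x‖ ^ 2)) =
        (2 * m / m ^ 4) * (u y * (m ^ 2 * (m ^ 2 * L2 (m ^ 2 * ‖y - x‖ ^ 2)))) := by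
      intro y; field_simp
    simp_rw [h2]
    rw [integral_const_mul, setIntegral_eq_integral_of_forall_compl_eq_zero, h1, mul_zero]
    intro y hy
    have := (isTest_radial hL2s hL20 hr subset_rfl hm).eq_zero hy
    rw [this]; ring
  rw [hz] at hder
  have h8 := hder.const_mul (∫ z : Plane, weylKernel (‖z‖ ^ 2))⁻¹
  rw [mul_zero] at h8
  refine h8.congr_of_eventuallyEq ?_
  filter_upwards [Ioi_mem_nhds hm] with m' hm'
  rw [weylMean, setIntegral_eq_integral_of_forall_compl_eq_zero]
  intro y hy
  have := (isTest_radial contDiff_weylKernel weylKernel_eq_zero hr subset_rfl hm').eq_zero hy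
  rw [this]; ring

theorem WeaklyBiharmonicOn.weylMean_eq {U : Set Plane} {u : Plane → ℝ}
    (h : WeaklyBiharmonicOn U u) {x : Plane} {r m m' : ℝ} (hr : 0 < r)
    (hU : Metric.closedBall x r ⊆ U) (hm : 1 / r < m) (hm' : 1 / r < m') :
    weylMean u m x = weylMean u m' x := by
  refine IsOpen.is_const_of_deriv_eq_zero isOpen_Ioi isPreconnected_Ioi
    (f := fun m => weylMean u m x) (s := Set.Ioi (1 / r)) ?_ ?_ hm hm'
  · exact fun m hm => (h.hasDerivAt_weylMean hr hU hm).differentiableAt.differentiableWithinAt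
  · exact fun m hm => (h.hasDerivAt_weylMean hr hU hm).deriv

/-- The smooth representative of a weakly biharmonic function. -/
noncomputable def weylRep (u : Plane → ℝ) (x : Plane) : ℝ := limUnder atTop fun m => weylMean u m x

theorem WeaklyBiharmonicOn.weylRep_eq {U : Set Plane} {u : Plane → ℝ}
    (h : WeaklyBiharmonicOn U u) {x : Plane} {r m : ℝ} (hr : 0 < r)
    (hU : Metric.closedBall x r ⊆ U) (hm : 1 / r < m) : weylRep u x = weylMean u m x := by
  refine Tendsto.limUnder_eq (tendsto_const_nhds.congr' ?_)
  filter_upwards [eventually_gt_atTop (1 / r)] with m' hm'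
  exact h.weylMean_eq hr hU hm hm'

/-- For all x near `x₀` the limit is already attained at the scale 3/r, whose kernel has radius r/3
< r/2 and stays inside the large ball. One kernel, depending only on r, thus serves all `U`, `u` and
`x₀`, which makes the derivative bounds uniform. -/
theorem weylRep_convolution (r : ℝ) (hr : 0 < r) : ∃ K : Plane → ℝ, ContDiff ℝ ∞ K ∧
    HasCompactSupport K ∧ ∀ (U : Set Plane) (u : Plane → ℝ), WeaklyBiharmonicOn U u → ∀ x₀,
      Metric.closedBall x₀ r ⊆ U → ∀ x ∈ Metric.ball x₀ (r / 2),
      weylRep u x = ((Metric.closedBall x₀ r).indicator u ⋆[ContinuousLinearMap.lsmul ℝ ℝ, volume] K) x := by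
  set c := (∫ z : Plane, weylKernel (‖z‖ ^ 2))⁻¹
  have hm : 1 / (r / 2) < 3 / r := by rw [div_lt_div_iff₀ (by positivity) hr]; nlinarith
  have ht := isTest_radial contDiff_weylKernel weylKernel_eq_zero (x := 0) (half_pos hr) subset_rfl hm
  refine ⟨fun z => c * (3 / r) ^ 2 * weylKernel ((3 / r) ^ 2 * ‖z - 0‖ ^ 2), contDiff_const.mul ht.smooth,
    ht.compact.mul_left, ?_⟩
  intro U u h x₀ hU x hx
  have hsub : Metric.closedBall x (r / 2) ⊆ Metric.closedBall x₀ r :=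
    Metric.closedBall_subset_closedBall' (by have := Metric.mem_ball.1 hx; linarith)
  rw [h.weylRep_eq (half_pos hr) (hsub.trans hU) hm, weylMean, convolution_def, ← integral_const_mul]
  congr 1
  funext y
  simp only [ContinuousLinearMap.lsmul_apply, smul_eq_mul, sub_zero]
  rw [norm_sub_rev x y]
  by_cases hy : y ∈ Metric.closedBall x₀ r
  · rw [Set.indicator_of_mem hy]; ring
  · have := (isTest_radial contDiff_weylKernel weylKernel_eq_zero (half_pos hr) hsub hm).eq_zero hy
    rw [this]; ring

theorem WeaklyBiharmonicOn.contDiffOn {U : Set Plane} {u : Plane → ℝ} (hU : IsOpen U)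
    (h : WeaklyBiharmonicOn U u) : ContDiffOn ℝ ∞ (weylRep u) U := by
  intro x hx
  obtain ⟨r, hr, hrU⟩ := Metric.nhds_basis_closedBall.mem_iff.1 (hU.mem_nhds hx)
  obtain ⟨K, hK, hc, he⟩ := weylRep_convolution r hr
  have hB : IntegrableOn u (Metric.closedBall x r) :=
    h.locInt.integrableOn_compact_subset hrU (isCompact_closedBall x r)
  have hi : Integrable ((Metric.closedBall x r).indicator u) :=
    hB.integrable_indicator Metric.isClosed_closedBall.measurableSet
  have := hc.contDiff_convolution_right (ContinuousLinearMap.lsmul ℝ ℝ) hi.locallyIntegrable (n := ⊤) hK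
  refine (this.contDiffAt.congr_of_eventuallyEq ?_).contDiffWithinAt
  filter_upwards [Metric.ball_mem_nhds x (half_pos hr)] with y hy using he U u h x hrU y hy

/-- Interior derivative estimates for weakly biharmonic functions. -/
theorem norm_iteratedFDeriv_weylRep_le (k : ℕ) {r : ℝ} (hr : 0 < r) : ∃ C : ℝ, 0 ≤ C ∧
    ∀ (U : Set Plane) (u : Plane → ℝ), WeaklyBiharmonicOn U u → ∀ x,
      Metric.closedBall x r ⊆ U →
      ‖iteratedFDeriv ℝ k (weylRep u) x‖ ≤ C * ∫ y in Metric.closedBall x r, ‖u y‖ := by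
  obtain ⟨K, hK, hc, he⟩ := weylRep_convolution r hr
  obtain ⟨C, hC0, hC⟩ := norm_iteratedFDeriv_convolution_le k K hK hc
  refine ⟨C, hC0, fun U u h x hrU => ?_⟩
  have hB : IntegrableOn u (Metric.closedBall x r) :=
    h.locInt.integrableOn_compact_subset hrU (isCompact_closedBall x r)
  have hi : Integrable ((Metric.closedBall x r).indicator u) :=
    hB.integrable_indicator Metric.isClosed_closedBall.measurableSet
  have e : weylRep u =ᶠ[𝓝 x]
      (Metric.closedBall x r).indicator u ⋆[ContinuousLinearMap.lsmul ℝ ℝ, volume] K := by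
    filter_upwards [Metric.ball_mem_nhds x (half_pos hr)] with y hy using he U u h x hrU y hy
  rw [(e.iteratedFDeriv ℝ k).eq_of_nhds]
  refine (hC _ hi x).trans_eq ?_
  congr 1
  simp_rw [norm_indicator_eq_indicator_norm]
  rw [integral_indicator Metric.isClosed_closedBall.measurableSet]

/-! ### The smooth representative agrees with the function almost everywhere -/

theorem integrable_weylKernel_norm_sq : Integrable fun z : Plane => weylKernel (‖z‖ ^ 2) := by
  have ht := isTest_radial contDiff_weylKernel weylKernel_eq_zero (x := 0) (r := 2) (m := 1) two_pos
    subset_rfl (by norm_num)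
  have := ht.smooth.continuous.integrable_of_hasCompactSupport (μ := volume) ht.compact
  simpa using this

/-- Substitution x = y + w/m, with the radial symmetry of the kernel; the factor m² is the Jacobian
in dimension two. -/
theorem integral_weylKernel_mul (φ : Plane → ℝ) {m : ℝ} (hm : 0 < m) (y : Plane) :
    ∫ x, m ^ 2 * weylKernel (m ^ 2 * ‖y - x‖ ^ 2) * φ x
      = ∫ w : Plane, weylKernel (‖w‖ ^ 2) * φ (y + m⁻¹ • w) := by
  have h1 := Measure.integral_comp_smul (volume : Measure Plane)
    (fun w => weylKernel (‖w‖ ^ 2) * φ (y + m⁻¹ • w)) m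
  have h2 : ∀ w : Plane, weylKernel (‖m • w‖ ^ 2) * φ (y + m⁻¹ • m • w)
      = weylKernel (m ^ 2 * ‖w‖ ^ 2) * φ (y + w) := by
    intro w
    rw [norm_smul, mul_pow, Real.norm_eq_abs, sq_abs, smul_smul, inv_mul_cancel₀ hm.ne', one_smul]
  simp_rw [h2] at h1
  have h3 : ∫ x, m ^ 2 * weylKernel (m ^ 2 * ‖y - x‖ ^ 2) * φ x
      = ∫ w, m ^ 2 * weylKernel (m ^ 2 * ‖w‖ ^ 2) * φ (y + w) := by
    rw [← integral_add_left_eq_self _ y]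
    congr 1; funext w
    simp
  rw [h3]
  simp_rw [mul_assoc]
  rw [integral_const_mul, h1]
  have : Module.finrank ℝ Plane = 2 := by simp
  rw [this, abs_of_pos (by positivity), smul_eq_mul, ← mul_assoc, mul_inv_cancel₀ (by positivity), one_mul]

/-- The kernels form an approximate identity. Fubini moves the average from `u` onto the continuous
test function, so no pointwise information on `u` is needed. -/
theorem tendsto_integral_weylMean {U : Set Plane} {u φ : Plane → ℝ} (hU : IsOpen U)
    (hu : LocallyIntegrableOn u U) (hφ : IsTest U φ) :
    Tendsto (fun m => ∫ x, φ x * weylMean u m x) atTop (𝓝 (∫ x, φ x * u x)) := by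
  obtain ⟨δ, hδ, hδU⟩ := hφ.compact.exists_cthickening_subset_open hU hφ.supp
  set c := (∫ z : Plane, weylKernel (‖z‖ ^ 2))⁻¹ with hc
  -- At scales above `1 / δ`, means at points of the support of `φ` see only `K`, so `u` may be cut
  -- off to an integrable function.
  set K := Metric.cthickening δ (tsupport φ) with hK
  have hKc : IsCompact K := hφ.compact.isCompact.cthickening
  set v := K.indicator u with hv
  have hvi : Integrable v := (hu.integrableOn_compact_subset hδU hKc).integrable_indicator hKc.measurableSet
  have hφc := hφ.smooth.continuous
  have hφi : Integrable φ := hφc.integrable_of_hasCompactSupport hφ.compact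
  obtain ⟨M, hM⟩ := hφ.compact.exists_bound_of_continuous hφc
  have hM0 : 0 ≤ M := (norm_nonneg _).trans (hM 0)
  have step : ∀ m, 1 / δ < m → ∫ x, φ x * weylMean u m x
      = ∫ y, v y * (c * ∫ w : Plane, weylKernel (‖w‖ ^ 2) * φ (y + m⁻¹ • w)) := by
    intro m hm
    have hm0 : 0 < m := (by positivity : (0:ℝ) < 1 / δ).trans hm
    have e1 : ∀ x, φ x * weylMean u m x
        = ∫ y, c * (φ x * (v y * (m ^ 2 * weylKernel (m ^ 2 * ‖y - x‖ ^ 2)))) := by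
      intro x
      rw [integral_const_mul, integral_const_mul, weylMean, ← hc]
      by_cases hx : x ∈ tsupport φ
      · rw [mul_left_comm]
        congr 3; funext y
        by_cases hy : y ∈ K
        · rw [hv, Set.indicator_of_mem hy]
        · have := (isTest_radial contDiff_weylKernel weylKernel_eq_zero hδ
            (Metric.closedBall_subset_cthickening hx δ) hm).eq_zero hy
          rw [this]; ring
      · rw [image_eq_zero_of_notMem_tsupport hx]; ring
    simp_rw [e1]
    rw [integral_integral_swap]
    · congr 1; funext y
      rw [← integral_weylKernel_mul φ hm0 y, mul_left_comm, ← integral_const_mul (v y),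
        ← integral_const_mul c]
      congr 1; funext x; ring
    · have i1 : Integrable (fun p : Plane × Plane => φ p.1 * v p.2) (volume.prod volume) := hφi.mul_prod hvi
      obtain ⟨C, hC⟩ : ∃ C, ∀ z : Plane, ‖weylKernel (m ^ 2 * ‖z - 0‖ ^ 2)‖ ≤ C := by
        have ht := isTest_radial contDiff_weylKernel weylKernel_eq_zero (x := 0) hδ subset_rfl hm
        exact ht.compact.exists_bound_of_continuous ht.smooth.continuous
      have hkc : Continuous fun p : Plane × Plane => c * m ^ 2 * weylKernel (m ^ 2 * ‖p.2 - p.1‖ ^ 2) :=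
        continuous_const.mul (contDiff_weylKernel.continuous.comp (by fun_prop))
      have := i1.mul_bdd (c := ‖c * m ^ 2‖ * C) hkc.aestronglyMeasurable (Eventually.of_forall fun p => by
        rw [norm_mul]
        have := hC (p.2 - p.1)
        rw [sub_zero] at this
        gcongr)
      refine this.congr (Eventually.of_forall fun p => ?_)
      simp only [Function.uncurry]
      ring
  have inner : ∀ y, Tendsto (fun m : ℝ => ∫ w : Plane, weylKernel (‖w‖ ^ 2) * φ (y + m⁻¹ • w)) atTop
      (𝓝 (∫ w : Plane, weylKernel (‖w‖ ^ 2) * φ y)) := by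
    intro y
    refine tendsto_integral_filter_of_dominated_convergence (fun w => ‖weylKernel (‖w‖ ^ 2)‖ * M) ?_ ?_ ?_ ?_
    · exact Eventually.of_forall fun m => integrable_weylKernel_norm_sq.aestronglyMeasurable.mul
        (hφc.comp (by fun_prop)).aestronglyMeasurable
    · refine Eventually.of_forall fun m => Eventually.of_forall fun w => ?_
      rw [norm_mul]
      exact mul_le_mul_of_nonneg_left (hM _) (norm_nonneg _)
    · exact integrable_weylKernel_norm_sq.norm.mul_const _
    · refine Eventually.of_forall fun w => Tendsto.const_mul _ ?_
      have h1 : Tendsto (fun m : ℝ => y + m⁻¹ • w) atTop (𝓝 (y + (0:ℝ) • w)) :=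
        tendsto_const_nhds.add (tendsto_inv_atTop_zero.smul_const w)
      rw [zero_smul, add_zero] at h1
      exact (hφc.tendsto y).comp h1
  have lim : Tendsto (fun m : ℝ => ∫ y, v y * (c * ∫ w : Plane, weylKernel (‖w‖ ^ 2) * φ (y + m⁻¹ • w)))
      atTop (𝓝 (∫ y, v y * (c * ∫ w : Plane, weylKernel (‖w‖ ^ 2) * φ y))) := by
    refine tendsto_integral_filter_of_dominated_convergence
      (fun y => ‖v y‖ * (‖c‖ * ∫ w : Plane, ‖weylKernel (‖w‖ ^ 2)‖ * M)) ?_ ?_ ?_ ?_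
    · refine Eventually.of_forall fun m => hvi.aestronglyMeasurable.mul (aestronglyMeasurable_const.mul ?_)
      have : StronglyMeasurable (Function.uncurry fun (y w : Plane) => weylKernel (‖w‖ ^ 2) * φ (y + m⁻¹ • w)) := by
        refine Continuous.stronglyMeasurable ?_
        exact (contDiff_weylKernel.continuous.comp (by fun_prop)).mul (hφc.comp (by fun_prop))
      exact this.integral_prod_right.aestronglyMeasurable
    · refine Eventually.of_forall fun m => Eventually.of_forall fun y => ?_
      rw [norm_mul, norm_mul]
      gcongr
      refine norm_integral_le_of_norm_le (integrable_weylKernel_norm_sq.norm.mul_const _)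
        (Eventually.of_forall fun w => ?_)
      rw [norm_mul]
      exact mul_le_mul_of_nonneg_left (hM _) (norm_nonneg _)
    · exact hvi.norm.mul_const _
    · exact Eventually.of_forall fun y => ((inner y).const_mul _).const_mul _
  have fin : ∫ y, v y * (c * ∫ w : Plane, weylKernel (‖w‖ ^ 2) * φ y) = ∫ x, φ x * u x := by
    congr 1; funext y
    rw [integral_mul_const, ← mul_assoc c, hc, inv_mul_cancel₀ integral_weylKernel_ne_zero, one_mul, mul_comm]
    by_cases hy : y ∈ tsupport φ
    · rw [hv, Set.indicator_of_mem (Metric.self_subset_cthickening _ hy)]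
    · rw [image_eq_zero_of_notMem_tsupport hy, zero_mul, zero_mul]
  rw [← fin]
  refine lim.congr' ?_
  filter_upwards [eventually_gt_atTop (1 / δ)] with m hm using (step m hm).symm

/-- For large `m` the mean equals the representative on the whole support of a test function, while
its integrals tend to those of `u`. The two functions therefore have the same integrals against test
functions. -/
theorem WeaklyBiharmonicOn.ae_eq {U : Set Plane} {u : Plane → ℝ} (hU : IsOpen U)
    (h : WeaklyBiharmonicOn U u) : ∀ᵐ x, x ∈ U → weylRep u x = u x := by
  have hs := (h.contDiffOn hU).continuousOn.locallyIntegrableOn (μ := volume) hU.measurableSet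
  have := hU.ae_eq_zero_of_integral_contDiff_smul_eq_zero (μ := volume) (f := weylRep u - u)
    (hs.sub h.locInt) ?_
  · filter_upwards [this] with x hx hxU
    exact sub_eq_zero.1 (hx hxU)
  intro φ h1 h2 h3
  have i1 := hs.integrable_mul_test h1.continuous h2 h3
  have i2 := h.locInt.integrable_mul_test h1.continuous h2 h3
  simp only [Pi.sub_apply, smul_eq_mul, mul_sub]
  simp_rw [mul_comm (φ _)]
  rw [integral_sub i1 i2, sub_eq_zero]
  simp_rw [mul_comm _ (φ _)]
  refine tendsto_nhds_unique ?_ (tendsto_integral_weylMean hU h.locInt ⟨h1, h2, h3⟩)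
  obtain ⟨δ, hδ, hδU⟩ := h2.exists_cthickening_subset_open hU h3
  refine tendsto_const_nhds.congr' ?_
  filter_upwards [eventually_gt_atTop (1 / δ)] with m hm
  congr 1; funext x
  by_cases hx : x ∈ tsupport φ
  · rw [h.weylRep_eq hδ ((Metric.closedBall_subset_cthickening hx δ).trans hδU) hm]
  · rw [image_eq_zero_of_notMem_tsupport hx]; ring

/-! ### The variational problem in a weighted space -/

/-- Abstract variational problem: if `j` dominates `i` and the functional `ℓ`, then `ℓ` is
represented by a point of the closure of the range of `(i, j)`. -/
theorem exists_variational_solution {E H₁ H₂ : Type*} [AddCommGroup E] [Module ℝ E]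
    [NormedAddCommGroup H₁] [InnerProductSpace ℝ H₁] [CompleteSpace H₁]
    [NormedAddCommGroup H₂] [InnerProductSpace ℝ H₂] [CompleteSpace H₂]
    (i : E →ₗ[ℝ] H₁) (j : E →ₗ[ℝ] H₂) (l : E →ₗ[ℝ] ℝ) (c c' : ℝ)
    (hi : ∀ e, ‖i e‖ ≤ c * ‖j e‖) (hl : ∀ e, ‖l e‖ ≤ c' * ‖j e‖) :
    ∃ (v₁ : H₁) (v₂ : H₂), (∀ e, ⟪v₂, j e⟫_ℝ = l e) ∧
      ∀ (a : H₁) (b : H₂), (∀ e, ⟪i e, a⟫_ℝ + ⟪j e, b⟫_ℝ = 0) → ⟪v₁, a⟫_ℝ + ⟪v₂, b⟫_ℝ = 0 := by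
  -- Riesz representation takes place in the closure of the range of `j`; domination by `j` lets
  -- both `i` and `l` extend continuously to it.
  set S := (LinearMap.range j).topologicalClosure with hS
  have : CompleteSpace S := (Submodule.isClosed_topologicalClosure _).completeSpace_coe
  let e : E →ₗ[ℝ] S := j.codRestrict S fun x => Submodule.le_topologicalClosure _ ⟨x, rfl⟩
  have he : DenseRange e := by
    rw [DenseRange, Subtype.dense_iff]
    intro x hx
    rw [← Set.range_comp]
    exact hx
  have hne : ∀ x, ‖e x‖ = ‖j x‖ := fun x => rfl
  set I := i.extendOfNorm e
  have hI : ∀ x, I (e x) = i x := fun x => i.extendOfNorm_eq he ⟨c, fun x => by rw [hne]; exact hi x⟩ x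
  set Lc := l.extendOfNorm e
  have hL : ∀ x, Lc (e x) = l x := fun x => l.extendOfNorm_eq he ⟨c', fun x => by rw [hne]; exact hl x⟩ x
  set v := (InnerProductSpace.toDual ℝ S).symm Lc
  refine ⟨I v, v, fun x => ?_, fun a b hab => ?_⟩
  · rw [← hL x, ← InnerProductSpace.toDual_symm_apply (𝕜 := ℝ) (y := Lc)]
    rfl
  · have hcl : IsClosed {s : S | ⟪I s, a⟫_ℝ + ⟪(s : H₂), b⟫_ℝ = 0} :=
      isClosed_eq (by fun_prop) continuous_const
    have hsub : Set.range e ⊆ {s : S | ⟪I s, a⟫_ℝ + ⟪(s : H₂), b⟫_ℝ = 0} := by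
      rintro _ ⟨x, rfl⟩
      rw [Set.mem_ofPred_eq, hI]
      exact hab x
    exact hcl.closure_subset_iff.2 hsub (he v)

/-- The straight infinite strip. -/
def strip : Set Plane := {ξ | -(1 / 2) < ξ 0 ∧ ξ 0 < 1 / 2}

/-- The region above the graph of `F`. -/
def aboveGraph (F : ℝ → ℝ) : Set Plane := {ξ | F (ξ 0) < ξ 1}

theorem isOpen_strip : IsOpen strip := by
  have h0 : Continuous fun ξ : Plane => ξ 0 := by fun_prop
  exact (isOpen_lt continuous_const h0).inter (isOpen_lt h0 continuous_const)

theorem halfStrip_subset_strip (F : ℝ → ℝ) : halfStrip F ⊆ strip := fun _ h => ⟨h.1, h.2.1⟩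

theorem halfStrip_subset_aboveGraph (F : ℝ → ℝ) : halfStrip F ⊆ aboveGraph F := fun _ h => h.2.2

theorem setIntegral_halfStrip_eq_strip {F : ℝ → ℝ} {h : Plane → ℝ}
    (hh : ∀ x, x ∉ aboveGraph F → h x = 0) : ∫ x in halfStrip F, h x = ∫ x in strip, h x := by
  refine (setIntegral_eq_of_subset_of_forall_sdiff_eq_zero isOpen_strip.measurableSet
    (halfStrip_subset_strip F) fun x hx => hh x fun hF => hx.2 ⟨hx.1.1, hx.1.2, hF⟩).symm

theorem setIntegral_strip_eq (f : Plane → ℝ) : ∫ ξ in strip, f ξ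
    = ∫ p in Set.Ioo (-(1 / 2) : ℝ) (1 / 2) ×ˢ Set.univ, f !₂[p.1, p.2] := by
  rw [← measurePreserving_plane.setIntegral_preimage_emb measurableEmbedding_plane]
  congr 2
  ext p; simp [strip]

theorem hasDerivAt_vertical {f : Plane → ℝ} {x t : ℝ} (hf : DifferentiableAt ℝ f !₂[x, t]) :
    HasDerivAt (fun t => f !₂[x, t]) (pd 1 f !₂[x, t]) t := by
  have h1 : HasDerivAt (fun t => (!₂[x, t] : Plane)) (EuclideanSpace.single 1 1) t := by
    have e : (fun t : ℝ => (!₂[x, t] : Plane)) = fun t => !₂[x, 0] + t • EuclideanSpace.single 1 1 := by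
      funext t; ext i; fin_cases i <;> simp
    rw [e]
    simpa using ((hasDerivAt_id t).smul_const (EuclideanSpace.single (1 : Fin 2) (1 : ℝ))).const_add
      (!₂[x, 0] : Plane)
  exact hf.hasFDerivAt.comp_hasDerivAt (f := fun t => (!₂[x, t] : Plane)) t h1

theorem hasDerivAt_horizontal {f : Plane → ℝ} {x t : ℝ} (hf : DifferentiableAt ℝ f !₂[x, t]) :
    HasDerivAt (fun x => f !₂[x, t]) (pd 0 f !₂[x, t]) x := by
  have h1 : HasDerivAt (fun x => (!₂[x, t] : Plane)) (EuclideanSpace.single 0 1) x := by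
    have e : (fun x : ℝ => (!₂[x, t] : Plane)) = fun x => !₂[0, t] + x • EuclideanSpace.single 0 1 := by
      funext t; ext i; fin_cases i <;> simp
    rw [e]
    simpa using ((hasDerivAt_id x).smul_const (EuclideanSpace.single (0 : Fin 2) (1 : ℝ))).const_add
      (!₂[0, t] : Plane)
  exact hf.hasFDerivAt.comp_hasDerivAt (f := fun x => (!₂[x, t] : Plane)) x h1

theorem continuous_plane : Continuous fun p : ℝ × ℝ => (!₂[p.1, p.2] : Plane) := by
  have : Continuous fun p : ℝ × ℝ => (WithLp.toLp 2 ![p.1, p.2] : Plane) := by fun_prop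
  exact this

theorem isClosedEmbedding_plane :
    Topology.IsClosedEmbedding fun p : ℝ × ℝ => (!₂[p.1, p.2] : Plane) := by
  let h : ℝ × ℝ ≃ₜ Plane :=
    { toFun := fun p => !₂[p.1, p.2]
      invFun := fun ξ => (ξ 0, ξ 1)
      left_inv := fun p => by simp
      right_inv := fun ξ => by ext i; fin_cases i <;> simp
      continuous_toFun := continuous_plane
      continuous_invFun := by fun_prop }
  exact h.isClosedEmbedding

theorem setIntegral_strip_pd_one {U : Set Plane} {f : Plane → ℝ} (hf : IsTest U f) :
    ∫ ξ in strip, pd 1 f ξ = 0 := by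
  have hcs : ∀ {g : Plane → ℝ}, HasCompactSupport g → ∀ x : ℝ, HasCompactSupport fun t => g !₂[x, t] := by
    intro g hg x
    refine hg.comp_isClosedEmbedding (g := fun t : ℝ => (!₂[x, t] : Plane)) ?_
    refine isClosedEmbedding_plane.comp (g := fun p : ℝ × ℝ => (!₂[p.1, p.2] : Plane))
      (f := fun t : ℝ => (x, t)) ⟨isEmbedding_prodMkRight x, ?_⟩
    have : Set.range (fun t : ℝ => (x, t)) = Prod.fst ⁻¹' {x} := by
      ext ⟨a, b⟩; simp [eq_comm]
    rw [this]
    exact isClosed_singleton.preimage continuous_fst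
  have hcx : ∀ x : ℝ, Continuous fun t : ℝ => (!₂[x, t] : Plane) := fun x =>
    continuous_plane.comp (f := fun t : ℝ => (x, t)) (by fun_prop)
  rw [setIntegral_strip_eq, Measure.volume_eq_prod, setIntegral_prod]
  · refine integral_eq_zero_of_ae (Eventually.of_forall fun x => ?_)
    simp only [Measure.restrict_univ]
    exact integral_eq_zero_of_hasDerivAt_of_integrable
      (f := fun t => f !₂[x, t])
      (fun t => hasDerivAt_vertical (hf.smooth.differentiable (by simp) _))
      (((hf.pd 1).smooth.continuous.comp (hcx x)).integrable_of_hasCompactSupport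
        (hcs (hf.pd 1).compact x))
      ((hf.smooth.continuous.comp (hcx x)).integrable_of_hasCompactSupport (hcs hf.compact x))
  · refine Integrable.integrableOn ?_
    exact ((hf.pd 1).smooth.continuous.comp continuous_plane).integrable_of_hasCompactSupport
      ((hf.pd 1).compact.comp_isClosedEmbedding isClosedEmbedding_plane)

theorem norm_gradient_sq (u : Plane → ℝ) (x : Plane) :
    ‖∇ u x‖ ^ 2 = pd 0 u x ^ 2 + pd 1 u x ^ 2 := by
  rw [← real_inner_self_eq_norm_sq, inner_gradient]; ring

theorem contDiff_coord (i : Fin 2) : ContDiff ℝ ∞ fun ξ : Plane => ξ i :=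
  (EuclideanSpace.proj i : Plane →L[ℝ] ℝ).contDiff

theorem contDiff_expWeight (a : ℝ) : ContDiff ℝ ∞ fun ξ : Plane => Real.exp (a * ξ 1) :=
  (contDiff_const.mul (contDiff_coord 1)).exp

theorem hasFDerivAt_fun_coord {q : ℝ → ℝ} {q' : ℝ} {x : Plane} (h : HasDerivAt q q' (x 1)) :
    HasFDerivAt (fun ξ : Plane => q (ξ 1)) (q' • (EuclideanSpace.proj 1 : Plane →L[ℝ] ℝ)) x :=
  h.comp_hasFDerivAt x (hasFDerivAt_coord 1 x)

theorem pd_fun_coord {q : ℝ → ℝ} {q' : ℝ} {x : Plane} (h : HasDerivAt q q' (x 1)) :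
    pd 0 (fun ξ : Plane => q (ξ 1)) x = 0 ∧ pd 1 (fun ξ : Plane => q (ξ 1)) x = q' := by
  simp [pd, (hasFDerivAt_fun_coord h).fderiv]

theorem pd_mul {f g : Plane → ℝ} {x : Plane} (hf : DifferentiableAt ℝ f x)
    (hg : DifferentiableAt ℝ g x) (i : Fin 2) :
    pd i (fun ξ => f ξ * g ξ) x = pd i f x * g x + f x * pd i g x := by
  have h : HasFDerivAt (fun ξ => f ξ * g ξ) _ x := hf.hasFDerivAt.mul hg.hasFDerivAt
  simp [pd, h.fderiv]; ring

theorem pd_expWeight (a : ℝ) (x : Plane) : pd 0 (fun ξ : Plane => Real.exp (a * ξ 1)) x = 0 ∧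
    pd 1 (fun ξ : Plane => Real.exp (a * ξ 1)) x = a * Real.exp (a * x 1) := by
  refine pd_fun_coord (q := fun t => Real.exp (a * t)) ?_
  have := ((hasDerivAt_id (x 1)).const_mul a).exp
  simpa [mul_comm] using this

theorem IsTest.integrable {U : Set Plane} {φ : Plane → ℝ} (h : IsTest U φ) : Integrable φ :=
  h.smooth.continuous.integrable_of_hasCompactSupport h.compact

theorem IsTest.memLp {U : Set Plane} {φ : Plane → ℝ} (h : IsTest U φ) : MemLp φ 2 :=
  h.smooth.continuous.memLp_of_hasCompactSupport h.compact

/-- The integral of ∂₂(e^{-ηξ₂}φ²) over the strip vanishes, so Young's inequality bounds the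
weighted mass of `φ` by that of ∂₂φ. On the region where `φ` lives the weight is at most e^{ηM}. A
weight is unavoidable: a gradient in L² does not make the function square integrable at infinity. -/
theorem weighted_poincare {F : ℝ → ℝ} {M : ℝ} (hM : ∀ t, -M ≤ F t) {η : ℝ} (hη : 0 < η)
    {φ : Plane → ℝ} (hφ : IsTest (aboveGraph F) φ) :
    ∫ ξ in halfStrip F, (φ ξ * Real.exp (-η / 2 * ξ 1)) ^ 2
      ≤ 4 / η ^ 2 * Real.exp (η * M) * ∫ ξ in halfStrip F, ‖∇ φ ξ‖ ^ 2 := by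
  have tφφ : IsTest (aboveGraph F) fun ξ => φ ξ * φ ξ := hφ.mul_left hφ.smooth
  have t1 : IsTest (aboveGraph F) fun ξ => Real.exp (-η * ξ 1) * (φ ξ * φ ξ) :=
    tφφ.mul_left (contDiff_expWeight _)
  have t2 : IsTest (aboveGraph F) fun ξ => Real.exp (-η * ξ 1) * (pd 1 φ ξ * pd 1 φ ξ) :=
    ((hφ.pd 1).mul_left (hφ.pd 1).smooth).mul_left (contDiff_expWeight _)
  have t0 : IsTest (aboveGraph F) fun ξ => pd 0 φ ξ * pd 0 φ ξ :=
    (hφ.pd 0).mul_left (hφ.pd 0).smooth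
  have t3 : IsTest (aboveGraph F) fun ξ => pd 1 φ ξ * pd 1 φ ξ :=
    (hφ.pd 1).mul_left (hφ.pd 1).smooth
  have e1 : ∀ ξ : Plane, (φ ξ * Real.exp (-η / 2 * ξ 1)) ^ 2 = Real.exp (-η * ξ 1) * (φ ξ * φ ξ) := by
    intro ξ
    have : Real.exp (-η * ξ 1) = Real.exp (-η / 2 * ξ 1) ^ 2 := by
      rw [← Real.exp_nat_mul]; congr 1; push_cast; ring
    rw [this]; ring
  simp_rw [e1, norm_gradient_sq]
  rw [setIntegral_halfStrip_eq_strip (fun x hx => t1.eq_zero hx),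
    setIntegral_halfStrip_eq_strip (F := F) (h := fun x => pd 0 φ x ^ 2 + pd 1 φ x ^ 2) (fun x hx => by
      rw [(hφ.pd 0).eq_zero hx, (hφ.pd 1).eq_zero hx]; ring)]
  have hz := setIntegral_strip_pd_one t1
  -- Young's inequality in the form of the square (η/2 φ - ∂₂φ)² ≥ 0 times the weight.
  have e2 : ∀ ξ, pd 1 (fun ξ => Real.exp (-η * ξ 1) * (φ ξ * φ ξ)) ξ ≤
      -(η / 2) * (Real.exp (-η * ξ 1) * (φ ξ * φ ξ)) + 2 / η * (Real.exp (-η * ξ 1) * (pd 1 φ ξ * pd 1 φ ξ)) := by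
    intro ξ
    have hd : DifferentiableAt ℝ φ ξ := hφ.smooth.differentiable (by simp) ξ
    rw [pd_mul ((contDiff_expWeight _).differentiable (by simp) ξ) (tφφ.smooth.differentiable (by simp) ξ), pd_mul hd hd, (pd_expWeight _ ξ).2]
    have hp := Real.exp_pos (-η * ξ 1)
    have : 0 ≤ Real.exp (-η * ξ 1) * (2 / η) * (η / 2 * φ ξ - pd 1 φ ξ) ^ 2 := by positivity
    have e : Real.exp (-η * ξ 1) * (2 / η) * (η / 2 * φ ξ - pd 1 φ ξ) ^ 2
      = Real.exp (-η * ξ 1) * (η / 2 * φ ξ ^ 2 - 2 * φ ξ * pd 1 φ ξ + 2 / η * pd 1 φ ξ ^ 2) := by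
      field_simp; ring
    nlinarith
  have h3 : 0 ≤ -(η / 2) * (∫ ξ in strip, Real.exp (-η * ξ 1) * (φ ξ * φ ξ))
      + 2 / η * ∫ ξ in strip, Real.exp (-η * ξ 1) * (pd 1 φ ξ * pd 1 φ ξ) := by
    rw [← hz, ← integral_const_mul, ← integral_const_mul, ← integral_add
      (t1.integrable.integrableOn.const_mul _) (t2.integrable.integrableOn.const_mul _)]
    exact integral_mono ((t1.pd 1).integrable.integrableOn)
      ((t1.integrable.integrableOn.const_mul _).add (t2.integrable.integrableOn.const_mul _)) e2
  have h4 : ∫ ξ in strip, Real.exp (-η * ξ 1) * (pd 1 φ ξ * pd 1 φ ξ)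
      ≤ Real.exp (η * M) * ∫ ξ in strip, pd 0 φ ξ ^ 2 + pd 1 φ ξ ^ 2 := by
    rw [← integral_const_mul]
    refine integral_mono t2.integrable.integrableOn (Integrable.integrableOn ?_) fun ξ => ?_
    · have := (t0.integrable.add t3.integrable).const_mul (Real.exp (η * M))
      simpa [sq] using this
    · by_cases hx : ξ ∈ aboveGraph F
      · have h1 : -M < ξ 1 := (hM _).trans_lt hx
        have h5 : Real.exp (-η * ξ 1) ≤ Real.exp (η * M) := Real.exp_le_exp.2 (by nlinarith)
        simp only
        gcongr
        · exact mul_self_nonneg _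
        · nlinarith [sq_nonneg (pd 0 φ ξ)]
      · simp only [(hφ.pd 1).eq_zero hx]
        have := Real.exp_pos (η * M)
        nlinarith [sq_nonneg (pd 0 φ ξ)]
  have hη2 : 0 < η / 2 := by positivity
  have h6 : (∫ ξ in strip, Real.exp (-η * ξ 1) * (φ ξ * φ ξ))
      ≤ 4 / η ^ 2 * ∫ ξ in strip, Real.exp (-η * ξ 1) * (pd 1 φ ξ * pd 1 φ ξ) := by
    have : 4 / η ^ 2 = 2 / η * (2 / η) := by field_simp; norm_num
    rw [this, mul_assoc]
    have h7 : 2 / η * (η / 2) = 1 := by field_simp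
    have h8 : 0 < 2 / η := by positivity
    set A := ∫ ξ in strip, Real.exp (-η * ξ 1) * (φ ξ * φ ξ)
    have h9 : η / 2 * A ≤ 2 / η * ∫ ξ in strip, Real.exp (-η * ξ 1) * (pd 1 φ ξ * pd 1 φ ξ) := by linarith
    calc A = 2 / η * (η / 2 * A) := by rw [← mul_assoc, h7, one_mul]
      _ ≤ _ := mul_le_mul_of_nonneg_left h9 h8.le
  refine h6.trans ?_
  rw [mul_assoc]
  exact mul_le_mul_of_nonneg_left h4 (by positivity)

theorem norm_toLp_two_sq {α E : Type*} [MeasurableSpace α] {μ : Measure α} [NormedAddCommGroup E]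
    [InnerProductSpace ℝ E] {f : α → E} (hf : MemLp f 2 μ) : ‖hf.toLp f‖ ^ 2 = ∫ x, ‖f x‖ ^ 2 ∂μ := by
  rw [← real_inner_self_eq_norm_sq, L2.inner_def]
  refine integral_congr_ae ?_
  filter_upwards [hf.coeFn_toLp] with x hx
  rw [hx, real_inner_self_eq_norm_sq]

theorem inner_toLp_two {α E : Type*} [MeasurableSpace α] {μ : Measure α} [NormedAddCommGroup E]
    [InnerProductSpace ℝ E] {f g : α → E} (hf : MemLp f 2 μ) (hg : MemLp g 2 μ) :
    ⟪hf.toLp f, hg.toLp g⟫_ℝ = ∫ x, ⟪f x, g x⟫_ℝ ∂μ := by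
  rw [L2.inner_def]
  refine integral_congr_ae ?_
  filter_upwards [hf.coeFn_toLp, hg.coeFn_toLp] with x hx hy
  rw [hx, hy]

/-- The space of test functions supported in `U`. -/
def testSpace (U : Set Plane) : Submodule ℝ (Plane → ℝ) where
  carrier := {φ | IsTest U φ}
  add_mem' h h' := h.add h'
  zero_mem' := ⟨contDiff_const, HasCompactSupport.zero, by simp [tsupport_eq_empty_iff.2 rfl]⟩
  smul_mem' c _ h := h.mul_left (g := fun _ => c) contDiff_const

theorem IsTest.gradient_memLp {U : Set Plane} {φ : Plane → ℝ} (h : IsTest U φ) :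
    MemLp (∇ φ) 2 := by
  have hc : Continuous (∇ φ) :=
    (InnerProductSpace.toDual ℝ Plane).symm.continuous.comp (h.smooth.continuous_fderiv (by simp))
  have hs : HasCompactSupport (∇ φ) := (h.compact.fderiv ℝ).comp_left (map_zero _)
  exact hc.memLp_of_hasCompactSupport hs

theorem gradient_fun_add {f g : Plane → ℝ} {x : Plane} (hf : DifferentiableAt ℝ f x)
    (hg : DifferentiableAt ℝ g x) : ∇ (fun y => f y + g y) x = ∇ f x + ∇ g x := by
  simp [gradient, fderiv_fun_add hf hg]

theorem gradient_fun_sub {f g : Plane → ℝ} {x : Plane} (hf : DifferentiableAt ℝ f x)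
    (hg : DifferentiableAt ℝ g x) : ∇ (fun y => f y - g y) x = ∇ f x - ∇ g x := by
  simp [gradient, fderiv_fun_sub hf hg]

theorem gradient_const_mul' {f : Plane → ℝ} {x : Plane} (hf : DifferentiableAt ℝ f x) (c : ℝ) :
    ∇ (fun y => c * f y) x = c • ∇ f x := by
  simp [gradient, fderiv_const_mul hf]

/-- Weak solvability of the mixed problem in the closure of test functions, in the form: the
solution satisfies every linear relation satisfied by all test functions. -/
theorem exists_weak_solution {F : ℝ → ℝ} {M : ℝ} (hM : ∀ t, -M ≤ F t) {η : ℝ} (hη : 0 < η)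
    {g : Plane → ℝ} (hg : MemLp (fun ξ => g ξ * Real.exp (η / 2 * ξ 1)) 2 (volume.restrict (halfStrip F))) :
    ∃ (v : Plane → ℝ) (G : Plane → Plane),
      MemLp (fun ξ => v ξ * Real.exp (-η / 2 * ξ 1)) 2 (volume.restrict (halfStrip F)) ∧
      MemLp G 2 (volume.restrict (halfStrip F)) ∧
      (∀ φ, IsTest (aboveGraph F) φ →
        ∫ ξ in halfStrip F, ⟪G ξ, ∇ φ ξ⟫_ℝ = -∫ ξ in halfStrip F, g ξ * φ ξ) ∧
      ∀ (ψ : Plane → ℝ) (Ψ : Plane → Plane),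
        MemLp (fun ξ => ψ ξ * Real.exp (η / 2 * ξ 1)) 2 (volume.restrict (halfStrip F)) →
        MemLp Ψ 2 (volume.restrict (halfStrip F)) →
        (∀ φ, IsTest (aboveGraph F) φ →
          (∫ ξ in halfStrip F, φ ξ * ψ ξ) + ∫ ξ in halfStrip F, ⟪∇ φ ξ, Ψ ξ⟫_ℝ = 0) →
        (∫ ξ in halfStrip F, v ξ * ψ ξ) + ∫ ξ in halfStrip F, ⟪G ξ, Ψ ξ⟫_ℝ = 0 := by
  set μ := volume.restrict (halfStrip F) with hμ
  set T := testSpace (aboveGraph F)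
  have m1 : ∀ φ : T, MemLp (fun ξ => φ.1 ξ * Real.exp (-η / 2 * ξ 1)) 2 μ := fun φ => by
    have := (IsTest.mul_left φ.2 (contDiff_expWeight (-η / 2))).memLp.restrict (halfStrip F)
    simpa only [mul_comm] using this
  have m2 : ∀ φ : T, MemLp (∇ φ.1) 2 μ := fun φ => (IsTest.gradient_memLp φ.2).restrict _
  have hd : ∀ φ : T, Differentiable ℝ φ.1 := fun φ => (IsTest.smooth φ.2).differentiable (by simp)
  -- Values carry the weight e^{-ηξ₂/2} and gradients carry none; sources carry the reciprocal
  -- weight, so the pairing of source and value is unweighted.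
  let i : T →ₗ[ℝ] Lp ℝ 2 μ :=
    { toFun := fun φ => (m1 φ).toLp _
      map_add' := fun φ φ' => by
        rw [← MemLp.toLp_add]
        congr 1; funext ξ; simp [add_mul]
      map_smul' := fun c φ => by
        rw [RingHom.id_apply, ← MemLp.toLp_const_smul]
        congr 1; funext ξ; simp [mul_assoc] }
  let j : T →ₗ[ℝ] Lp Plane 2 μ :=
    { toFun := fun φ => (m2 φ).toLp _
      map_add' := fun φ φ' => by
        rw [← MemLp.toLp_add]
        congr 1; funext ξ; exact gradient_fun_add (hd φ ξ) (hd φ' ξ)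
      map_smul' := fun c φ => by
        rw [RingHom.id_apply, ← MemLp.toLp_const_smul]
        congr 1; funext ξ; exact gradient_const_mul' (hd φ ξ) c }
  set c := Real.sqrt (4 / η ^ 2 * Real.exp (η * M)) with hc
  have hij : ∀ φ, ‖i φ‖ ≤ c * ‖j φ‖ := by
    intro φ
    have h1 := weighted_poincare hM hη (φ := φ.1) φ.2
    have e1 : ‖i φ‖ ^ 2 = ∫ ξ in halfStrip F, (φ.1 ξ * Real.exp (-η / 2 * ξ 1)) ^ 2 := by
      have : ‖i φ‖ ^ 2 = _ := norm_toLp_two_sq (m1 φ)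
      simpa only [Real.norm_eq_abs, sq_abs] using this
    have e2 : ‖j φ‖ ^ 2 = ∫ ξ in halfStrip F, ‖∇ φ.1 ξ‖ ^ 2 := norm_toLp_two_sq (m2 φ)
    rw [← e1, ← e2] at h1
    refine abs_le_of_sq_le_sq' ?_ (by positivity) |>.2
    rw [mul_pow, hc, Real.sq_sqrt (by positivity)]
    exact h1
  let k := hg.toLp _
  let l : T →ₗ[ℝ] ℝ := -((innerSL ℝ k).toLinearMap ∘ₗ i)
  have hl : ∀ φ, ‖l φ‖ ≤ (‖k‖ * c) * ‖j φ‖ := by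
    intro φ
    have : ‖l φ‖ = ‖⟪k, i φ⟫_ℝ‖ := by simp [l]
    rw [this, mul_assoc]
    exact (norm_inner_le_norm k (i φ)).trans (mul_le_mul_of_nonneg_left (hij φ) (norm_nonneg _))
  obtain ⟨v₁, v₂, hv, hrel⟩ := exists_variational_solution i j l c _ hij hl
  have hexp : ∀ t : ℝ, Real.exp (η / 2 * t) * Real.exp (-η / 2 * t) = 1 := by
    intro t; rw [← Real.exp_add]; ring_nf; simp
  refine ⟨fun ξ => v₁ ξ * Real.exp (η / 2 * ξ 1), v₂, ?_, Lp.memLp v₂, ?_, ?_⟩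
  · refine (Lp.memLp v₁).congr_norm ?_ (Eventually.of_forall fun ξ => ?_)
    · refine ((Lp.memLp v₁).aestronglyMeasurable.mul ?_).mul ?_
      · exact (contDiff_expWeight _).continuous.aestronglyMeasurable
      · exact (contDiff_expWeight _).continuous.aestronglyMeasurable
    · rw [mul_assoc, hexp, mul_one]
  · intro φ hφ
    have h1 := hv ⟨φ, hφ⟩
    have e1 : ⟪v₂, j ⟨φ, hφ⟩⟫_ℝ = ∫ ξ in halfStrip F, ⟪v₂ ξ, ∇ φ ξ⟫_ℝ := by
      rw [L2.inner_def]
      refine integral_congr_ae ?_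
      filter_upwards [(m2 ⟨φ, hφ⟩).coeFn_toLp] with x hx
      rw [← hx]; rfl
    have e2 : l ⟨φ, hφ⟩ = -∫ ξ in halfStrip F, g ξ * φ ξ := by
      have : l ⟨φ, hφ⟩ = -⟪k, i ⟨φ, hφ⟩⟫_ℝ := by simp [l]
      rw [this]
      have h2 : ⟪k, i ⟨φ, hφ⟩⟫_ℝ = _ := inner_toLp_two hg (m1 ⟨φ, hφ⟩)
      rw [h2]
      congr 2; funext ξ
      have := hexp (ξ 1)
      simp only [RCLike.inner_apply, conj_trivial]
      linear_combination (g ξ * φ ξ) * this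
    rw [← e1, h1, e2]
  · intro ψ Ψ hψ hΨ hrel'
    have h1 := hrel (hψ.toLp _) (hΨ.toLp _) ?_
    · have e1 : ⟪v₁, hψ.toLp _⟫_ℝ = ∫ ξ in halfStrip F, v₁ ξ * Real.exp (η / 2 * ξ 1) * ψ ξ := by
        rw [L2.inner_def]
        refine integral_congr_ae ?_
        filter_upwards [hψ.coeFn_toLp] with x hx
        rw [hx]
        simp only [RCLike.inner_apply, conj_trivial]
        ring
      have e2 : ⟪v₂, hΨ.toLp _⟫_ℝ = ∫ ξ in halfStrip F, ⟪v₂ ξ, Ψ ξ⟫_ℝ := by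
        rw [L2.inner_def]
        refine integral_congr_ae ?_
        filter_upwards [hΨ.coeFn_toLp] with x hx
        rw [hx]
      exact (congrArg₂ (· + ·) e1 e2).symm.trans h1
    · intro φ
      have e1 : ⟪i φ, hψ.toLp _⟫_ℝ = ∫ ξ in halfStrip F, φ.1 ξ * ψ ξ := by
        have h2 : ⟪i φ, hψ.toLp _⟫_ℝ = _ := inner_toLp_two (m1 φ) hψ
        rw [h2]
        congr 1; funext ξ
        have := hexp (ξ 1)
        simp only [RCLike.inner_apply, conj_trivial]
        linear_combination (φ.1 ξ * ψ ξ) * this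
      have e2 : ⟪j φ, hΨ.toLp _⟫_ℝ = ∫ ξ in halfStrip F, ⟪∇ φ.1 ξ, Ψ ξ⟫_ℝ := inner_toLp_two (m2 φ) hΨ
      rw [e1, e2]
      exact hrel' φ.1 φ.2

/-! ### From the weak solution to a smooth strip solution -/

theorem IsProfile.exists_lower_bound {F : ℝ → ℝ} (hF : IsProfile F) : ∃ M, 0 < M ∧ ∀ t, -M ≤ F t := by
  obtain ⟨C, hC⟩ := isCompact_Icc.exists_bound_of_continuousOn (s := Set.Icc (0:ℝ) 1)
    hF.smooth.continuous.continuousOn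
  refine ⟨max C 1, lt_max_of_lt_right one_pos, fun t => ?_⟩
  obtain ⟨y, hy, hty⟩ := hF.periodic.exists_mem_Ico₀ one_pos t
  rw [hty]
  have := hC y ⟨hy.1, hy.2.le⟩
  rw [Real.norm_eq_abs] at this
  have h2 := neg_abs_le (F y)
  have := le_max_left C 1
  linarith

/-- The part of the half-strip below height `R`. -/
def truncation (F : ℝ → ℝ) (R : ℝ) : Set Plane := halfStrip F ∩ {ξ | ξ 1 < R}

theorem isOpen_truncation {F : ℝ → ℝ} (hF : IsProfile F) (R : ℝ) : IsOpen (truncation F R) :=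
  (isOpen_halfStrip hF.smooth.continuous).inter
    (isOpen_lt (contDiff_coord 1).continuous continuous_const)

theorem exists_isCompact_truncation_subset {F : ℝ → ℝ} (hF : IsProfile F) (R : ℝ) :
    ∃ K, IsCompact K ∧ truncation F R ⊆ K := by
  obtain ⟨M, -, hM⟩ := hF.exists_lower_bound
  refine ⟨(fun p : ℝ × ℝ => (!₂[p.1, p.2] : Plane)) '' (Set.Icc (-(1 / 2)) (1 / 2) ×ˢ Set.Icc (-M) R),
    (isCompact_Icc.prod isCompact_Icc).image continuous_plane, ?_⟩
  rintro ξ ⟨⟨h1, h2, h3⟩, h4⟩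
  refine ⟨(ξ 0, ξ 1), ⟨⟨h1.le, h2.le⟩, ⟨(hM _).trans h3.le, le_of_lt h4⟩⟩, ?_⟩
  ext i; fin_cases i <;> simp

theorem memLp_truncation_of_continuous {E : Type*} [NormedAddCommGroup E]
    {F : ℝ → ℝ} (hF : IsProfile F) (R : ℝ) {h : Plane → E}
    [SecondCountableTopologyEither Plane E] (hh : Continuous h) (p : ENNReal) :
    MemLp h p (volume.restrict (truncation F R)) := by
  obtain ⟨K, hK, hsub⟩ := exists_isCompact_truncation_subset hF R
  obtain ⟨C, hC⟩ := hK.exists_bound_of_continuousOn hh.continuousOn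
  have : IsFiniteMeasure (volume.restrict (truncation F R)) :=
    ⟨by rw [Measure.restrict_apply_univ]; exact (measure_mono hsub).trans_lt hK.measure_lt_top⟩
  refine MemLp.of_bound hh.aestronglyMeasurable C ?_
  exact (ae_restrict_iff' (isOpen_truncation hF R).measurableSet).2
    (Eventually.of_forall fun x hx => hC x (hsub hx))

theorem memLp_truncation_of_weighted {F : ℝ → ℝ} (hF : IsProfile F) (R : ℝ) {η : ℝ} (hη : 0 < η)
    {v : Plane → ℝ}
    (hv : MemLp (fun ξ => v ξ * Real.exp (-η / 2 * ξ 1)) 2 (volume.restrict (halfStrip F))) :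
    MemLp v 2 (volume.restrict (truncation F R)) := by
  have h1 := hv.mono_measure (Measure.restrict_mono (Set.inter_subset_left : truncation F R ⊆ _) le_rfl)
  have hexp : ∀ t : ℝ, Real.exp (-η / 2 * t) * Real.exp (η / 2 * t) = 1 := by
    intro t; rw [← Real.exp_add]; ring_nf; simp
  have hm : AEStronglyMeasurable v (volume.restrict (truncation F R)) := by
    have := h1.aestronglyMeasurable.mul (contDiff_expWeight (η / 2)).continuous.aestronglyMeasurable
    refine this.congr (Eventually.of_forall fun ξ => ?_)
    simp [mul_assoc, hexp]
  refine h1.of_le_mul (c := Real.exp (η / 2 * R)) hm ?_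
  refine (ae_restrict_iff' (isOpen_truncation hF R).measurableSet).2
    (Eventually.of_forall fun ξ hξ => ?_)
  have : v ξ = Real.exp (η / 2 * ξ 1) * (v ξ * Real.exp (-η / 2 * ξ 1)) := by
    have := hexp (ξ 1)
    linear_combination (-v ξ) * this
  rw [this, norm_mul, Real.norm_eq_abs, abs_of_pos (Real.exp_pos _)]
  have h2 : ξ 1 < R := hξ.2
  have h3 : Real.exp (η / 2 * ξ 1) ≤ Real.exp (η / 2 * R) := Real.exp_le_exp.2 (by nlinarith)
  have h4 : ‖v ξ * Real.exp (-η / 2 * ξ 1)‖ =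
    ‖Real.exp (η / 2 * ξ 1) * (v ξ * Real.exp (-η / 2 * ξ 1)) * Real.exp (-η / 2 * ξ 1)‖ := by
    rw [← this]
  rw [← h4]
  gcongr

theorem locallyIntegrableOn_of_truncation {F : ℝ → ℝ} (hF : IsProfile F) {v : Plane → ℝ}
    (hv : ∀ R, MemLp v 2 (volume.restrict (truncation F R))) : LocallyIntegrableOn v (halfStrip F) := by
  intro x hx
  have h1 : LocallyIntegrableOn v (truncation F (x 1 + 1)) :=
    locallyIntegrableOn_of_locallyIntegrable_restrict ((hv (x 1 + 1)).locallyIntegrable (by norm_num))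
  have hx' : x ∈ truncation F (x 1 + 1) := ⟨hx, by simp⟩
  have h2 := h1 x hx'
  rw [(isOpen_truncation hF _).nhdsWithin_eq hx'] at h2
  exact h2.filter_mono nhdsWithin_le_nhds

theorem laplacian_fun_coord {q : ℝ → ℝ} (hq : ContDiff ℝ ∞ q) :
    Δ (fun ξ : Plane => q (ξ 1)) = fun ξ => deriv (deriv q) (ξ 1) := by
  have hs : ContDiff ℝ ∞ fun ξ : Plane => q (ξ 1) := hq.comp (contDiff_coord 1)
  have hd : ∀ {q : ℝ → ℝ}, ContDiff ℝ ∞ q → ∀ x : Plane, HasDerivAt q (deriv q (x 1)) (x 1) :=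
    fun hq x => (hq.differentiable (by simp) _).hasDerivAt
  rw [laplacian_fun_eq_pd hs]
  have e0 : pd 0 (fun ξ : Plane => q (ξ 1)) = fun _ => 0 := funext fun x => (pd_fun_coord (hd hq x)).1
  have e1 : pd 1 (fun ξ : Plane => q (ξ 1)) = fun ξ => deriv q (ξ 1) :=
    funext fun x => (pd_fun_coord (hd hq x)).2
  funext x
  rw [e0, e1, (pd_fun_coord (hd hq.deriv_real x)).2]
  simp [pd]

theorem ae_eq_of_integral_mul_test {U : Set Plane} (hU : IsOpen U) {f g : Plane → ℝ}
    (hf : LocallyIntegrableOn f U) (hg : LocallyIntegrableOn g U)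
    (h : ∀ φ, IsTest U φ → ∫ x, f x * φ x = ∫ x, g x * φ x) : ∀ᵐ x, x ∈ U → f x = g x := by
  have := hU.ae_eq_zero_of_integral_contDiff_smul_eq_zero (μ := volume) (f := f - g)
    (hf.sub hg) ?_
  · filter_upwards [this] with x hx hxU
    exact sub_eq_zero.1 (hx hxU)
  intro φ h1 h2 h3
  have i1 := hf.integrable_mul_test h1.continuous h2 h3
  have i2 := hg.integrable_mul_test h1.continuous h2 h3
  simp only [Pi.sub_apply, smul_eq_mul, mul_sub]
  simp_rw [mul_comm (φ _)]
  rw [integral_sub i1 i2, h φ ⟨h1, h2, h3⟩, sub_self]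

theorem eqOn_of_integral_mul_test {U : Set Plane} (hU : IsOpen U) {f g : Plane → ℝ}
    (hf : ContinuousOn f U) (hg : ContinuousOn g U)
    (h : ∀ φ, IsTest U φ → ∫ x, f x * φ x = ∫ x, g x * φ x) : Set.EqOn f g U := by
  have := ae_eq_of_integral_mul_test hU (hf.locallyIntegrableOn hU.measurableSet)
    (hg.locallyIntegrableOn hU.measurableSet) h
  exact Measure.eqOn_open_of_ae_eq ((ae_restrict_iff' hU.measurableSet).2 this) hU hf hg

theorem ContDiffOn.laplacian_plane {u : Plane → ℝ} {U : Set Plane} (hU : IsOpen U)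
    (hu : ContDiffOn ℝ ∞ u U) : ContDiffOn ℝ ∞ (Δ u) U := by
  refine ((ContDiffOn.pd (i := 0) hU (ContDiffOn.pd (i := 0) hU hu)).add
    (ContDiffOn.pd (i := 1) hU (ContDiffOn.pd (i := 1) hU hu))).congr fun x hx => ?_
  exact laplacian_eq_pd ((hu.contDiffAt (hU.mem_nhds hx)).of_le (by norm_cast))

theorem setIntegral_mul_eq_of_tests {F : ℝ → ℝ} {φ ψ : Plane → ℝ} (hφ : ∀ x, x ∉ aboveGraph F → φ x = 0)
    (hψ : ∀ x, x ∉ strip → ψ x = 0) : ∫ x in halfStrip F, φ x * ψ x = ∫ x, φ x * ψ x := by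
  refine setIntegral_eq_integral_of_forall_compl_eq_zero fun x hx => ?_
  by_cases h1 : x ∈ aboveGraph F
  · by_cases h2 : x ∈ strip
    · exact absurd ⟨h2.1, h2.2, h1⟩ hx
    · rw [hψ x h2, mul_zero]
  · rw [hφ x h1, zero_mul]

/-- After subtracting q(ξ₂), which vanishes on Γ because F < 0, the source lies in the weighted
space and the variational solution applies. Since `f` is harmonic, the sum is weakly biharmonic and
has a smooth representative. The two integrability conclusions are what later excludes exponential
growth and a linear term. -/
theorem exists_strip_solution {F : ℝ → ℝ} (hF : IsProfile F) {η : ℝ} (hη : 0 < η)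
    {f : Plane → ℝ} {q : ℝ → ℝ} (hq : ContDiff ℝ ∞ q) (hq0 : ∀ t ≤ 0, q t = 0)
    (hf : ContDiffOn ℝ ∞ f (halfStrip F)) (hfh : ∀ ξ ∈ halfStrip F, Δ f ξ = 0)
    (hg : MemLp (fun ξ => (f ξ - deriv (deriv q) (ξ 1)) * Real.exp (η / 2 * ξ 1)) 2
      (volume.restrict (halfStrip F))) :
    ∃ Y : Plane → ℝ, IsStripSolution F f Y ∧
      MemLp (fun ξ => (Y ξ - q (ξ 1)) * Real.exp (-η / 2 * ξ 1)) 2 (volume.restrict (halfStrip F)) ∧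
      MemLp (fun ξ => pd 1 Y ξ - deriv q (ξ 1)) 2 (volume.restrict (halfStrip F)) := by
  obtain ⟨M, -, hM⟩ := hF.exists_lower_bound
  have hO := isOpen_halfStrip hF.smooth.continuous
  obtain ⟨v, G, hv, hG, heq, hrel⟩ := exists_weak_solution hM hη hg
  set Q : Plane → ℝ := fun ξ => q (ξ 1) with hQ
  have hQs : ContDiff ℝ ∞ Q := hq.comp (contDiff_coord 1)
  have hpQ : ∀ x, pd 0 Q x = 0 ∧ pd 1 Q x = deriv q (x 1) := fun x =>
    pd_fun_coord (hq.differentiable (by simp) _).hasDerivAt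
  have hq1 : ∀ t < 0, deriv q t = 0 := fun t ht => by
    have : q =ᶠ[𝓝 t] fun _ => 0 := by
      filter_upwards [Iio_mem_nhds ht] with s hs using hq0 s (le_of_lt hs)
    rw [this.deriv_eq]; simp
  have hneg : ∀ x : Plane, x ∉ aboveGraph F → x 1 < 0 := fun x hx =>
    (not_lt.1 hx).trans_lt (hF.neg _)
  have hQ0 : ∀ x, x ∉ aboveGraph F → Q x = 0 := fun x hx => hq0 _ (hneg x hx).le
  have hpQ0 : ∀ i x, x ∉ aboveGraph F → pd i Q x = 0 := fun i x hx => by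
    fin_cases i
    · exact (hpQ x).1
    · exact (hpQ x).2.trans (hq1 _ (hneg x hx))
  have hvt : ∀ R, MemLp v 2 (volume.restrict (truncation F R)) := fun R =>
    memLp_truncation_of_weighted hF R hη hv
  have hvl : LocallyIntegrableOn v (halfStrip F) := locallyIntegrableOn_of_truncation hF hvt
  have hGi : ∀ i, MemLp (fun ξ => G ξ i) 2 (volume.restrict (halfStrip F)) := fun i =>
    hG.of_le (((EuclideanSpace.proj i : Plane →L[ℝ] ℝ).continuous.comp_aestronglyMeasurable hG.1))
      (Eventually.of_forall fun ξ => PiLp.norm_apply_le (G ξ) i)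
  have hGl : ∀ i, LocallyIntegrableOn (fun ξ => G ξ i) (halfStrip F) := fun i =>
    locallyIntegrableOn_of_truncation hF fun R =>
      (hGi i).mono_measure (Measure.restrict_mono Set.inter_subset_left le_rfl)
  have hvint : ∀ {U : Set Plane} {ψ : Plane → ℝ}, IsTest U ψ →
      IntegrableOn (fun ξ => v ξ * ψ ξ) (halfStrip F) := by
    intro U ψ hψ
    have h1 := (hψ.mul_left (contDiff_expWeight (η / 2))).memLp.restrict (halfStrip F)
    have h2 := MemLp.integrable_mul hv h1
    refine h2.congr (Eventually.of_forall fun ξ => ?_)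
    have : Real.exp (-η / 2 * ξ 1) * Real.exp (η / 2 * ξ 1) = 1 := by
      rw [← Real.exp_add]; ring_nf; simp
    simp only [Pi.mul_apply]
    linear_combination (v ξ * ψ ξ) * this
  have hGint : ∀ {U : Set Plane} {ψ : Plane → ℝ}, IsTest U ψ → ∀ i,
      IntegrableOn (fun ξ => G ξ i * ψ ξ) (halfStrip F) := fun hψ i =>
    MemLp.integrable_mul (hGi i) (hψ.memLp.restrict _)
  -- The relation inherited from test functions, applied to ∂ᵢψ and ψ eᵢ, says at once that `G` is
  -- the weak gradient of `v` and that `v` has zero trace: `ψ` need not vanish near Γ.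
  have hwg : ∀ ψ, IsTest strip ψ → ∀ i,
      ∫ ξ in halfStrip F, v ξ * pd i ψ ξ = -∫ ξ in halfStrip F, G ξ i * ψ ξ := by
    intro ψ hψ i
    have h1 := hrel (pd i ψ) (fun ξ => ψ ξ • EuclideanSpace.single i (1:ℝ)) ?_ ?_ ?_
    · simp only [inner_smul_right, EuclideanSpace.inner_single_right, one_mul, conj_trivial] at h1
      rw [eq_neg_iff_add_eq_zero, ← h1]
      congr 2; funext ξ; ring
    · have := ((hψ.pd i).mul_left (contDiff_expWeight (η / 2))).memLp.restrict (halfStrip F)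
      simpa only [mul_comm] using this
    · refine Continuous.memLp_of_hasCompactSupport (μ := volume) ?_ ?_ |>.restrict _
      · exact hψ.smooth.continuous.smul continuous_const
      · exact hψ.compact.smul_right
    · intro φ hφ
      simp only [inner_smul_right, inner_gradient_left]
      have e1 := setIntegral_mul_eq_of_tests (F := F) (φ := φ) (ψ := pd i ψ) (fun x hx => hφ.eq_zero hx)
        fun x hx => (hψ.pd i).eq_zero hx
      have e2 := setIntegral_mul_eq_of_tests (F := F) (φ := pd i φ) (ψ := ψ) (fun x hx => (hφ.pd i).eq_zero hx)
        fun x hx => hψ.eq_zero hx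
      rw [e1, integral_mul_pd isOpen_univ hφ.smooth.contDiffOn (hψ.mono (Set.subset_univ _)) i, ← e2,
        neg_add_eq_zero]
      congr 1; funext ξ; rw [pd]; ring
  have hwQ : ∀ ψ, IsTest strip ψ → ∀ i,
      ∫ ξ in halfStrip F, Q ξ * pd i ψ ξ = -∫ ξ in halfStrip F, pd i Q ξ * ψ ξ := by
    intro ψ hψ i
    rw [setIntegral_mul_eq_of_tests hQ0 fun x hx => (hψ.pd i).eq_zero hx,
      setIntegral_mul_eq_of_tests (hpQ0 i) fun x hx => hψ.eq_zero hx,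
      integral_mul_pd isOpen_univ hQs.contDiffOn (hψ.mono (Set.subset_univ _)) i]
  set Y₀ : Plane → ℝ := fun ξ => v ξ + Q ξ with hY₀
  have hY₀l : LocallyIntegrableOn Y₀ (halfStrip F) :=
    hvl.add (hQs.continuous.locallyIntegrable.locallyIntegrableOn _)
  have hlap : ∀ φ, IsTest (halfStrip F) φ → ∫ ξ, Y₀ ξ * Δ φ ξ = ∫ ξ, f ξ * φ ξ := by
    intro φ hφ
    have hφs : IsTest strip φ := hφ.mono (halfStrip_subset_strip F)
    have hφa : IsTest (aboveGraph F) φ := hφ.mono (halfStrip_subset_aboveGraph F)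
    have e1 : ∫ ξ in halfStrip F, v ξ * Δ φ ξ = ∫ ξ in halfStrip F, (f ξ - deriv (deriv q) (ξ 1)) * φ ξ := by
      have h1 := heq φ hφa
      have h2 : ∀ ξ, ⟪G ξ, ∇ φ ξ⟫_ℝ = G ξ 0 * pd 0 φ ξ + G ξ 1 * pd 1 φ ξ := fun ξ => by
        rw [inner_gradient_right, fderiv_eq_pd]; simp
      simp_rw [h2] at h1
      rw [integral_add (hGint (hφ.pd 0) 0) (hGint (hφ.pd 1) 1)] at h1
      simp_rw [laplacian_fun_eq_pd hφ.smooth, mul_add]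
      rw [integral_add (hvint ((hφ.pd 0).pd 0)) (hvint ((hφ.pd 1).pd 1)), hwg _ (hφs.pd 0), hwg _ (hφs.pd 1)]
      linarith
    have e2 : ∫ ξ, Q ξ * Δ φ ξ = ∫ ξ, deriv (deriv q) (ξ 1) * φ ξ := by
      rw [integral_mul_laplacian hO hQs.contDiffOn hφ, hQ, laplacian_fun_coord hq]
    have hqq : Continuous fun ξ : Plane => deriv (deriv q) (ξ 1) :=
      hq.deriv_real.deriv_real.continuous.comp (contDiff_coord 1).continuous
    simp_rw [hY₀, add_mul]
    rw [integral_add (hvl.integrable_mul_test hφ.laplacian.smooth.continuous hφ.laplacian.compact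
      hφ.laplacian.supp) (hQs.continuous.continuousOn.integrable_mul_test hO hφ.laplacian.smooth.continuous
      hφ.laplacian.compact hφ.laplacian.supp), ← setIntegral_mul_test hφ.laplacian subset_rfl, e1, e2,
      setIntegral_mul_test hφ subset_rfl]
    simp_rw [sub_mul]
    rw [integral_sub (hf.continuousOn.integrable_mul_test hO hφ.smooth.continuous hφ.compact hφ.supp)
      (hqq.continuousOn.integrable_mul_test hO hφ.smooth.continuous hφ.compact hφ.supp)]
    ring
  -- The weak equation is tested with Δφ, and then harmonicity of `f` is used.
  have hbi : WeaklyBiharmonicOn (halfStrip F) Y₀ := ⟨hY₀l, fun φ hφ => by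
    rw [hlap _ hφ.laplacian, integral_mul_laplacian hO hf hφ]
    refine integral_eq_zero_of_ae (Eventually.of_forall fun x => ?_)
    by_cases hx : x ∈ halfStrip F
    · simp [hfh x hx]
    · simp [hφ.eq_zero hx]⟩
  set Y := weylRep Y₀
  have hYs : ContDiffOn ℝ ∞ Y (halfStrip F) := hbi.contDiffOn hO
  have hYae : ∀ᵐ x, x ∈ halfStrip F → Y x = Y₀ x := hbi.ae_eq hO
  have hYar : Y =ᵐ[volume.restrict (halfStrip F)] Y₀ := (ae_restrict_iff' hO.measurableSet).2 hYae
  have hYint : ∀ ψ : Plane → ℝ, (∀ x, x ∉ halfStrip F → ψ x = 0) → ∫ ξ, Y ξ * ψ ξ = ∫ ξ, Y₀ ξ * ψ ξ := by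
    intro ψ hψ
    refine integral_congr_ae ?_
    filter_upwards [hYae] with x hx
    by_cases hxU : x ∈ halfStrip F
    · simp only [hx hxU]
    · simp only [hψ x hxU, mul_zero]
  have hequ : Set.EqOn (Δ Y) f (halfStrip F) := by
    refine eqOn_of_integral_mul_test hO (ContDiffOn.laplacian_plane hO hYs).continuousOn
      hf.continuousOn fun φ hφ => ?_
    rw [← integral_mul_laplacian hO hYs hφ, hYint _ fun x hx => hφ.laplacian.eq_zero hx, hlap φ hφ]
  -- The representative agrees with `Y₀` only almost everywhere, so its classical derivatives are
  -- matched with the weak gradient by testing.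
  have hgrad : ∀ i, ∀ᵐ x, x ∈ halfStrip F → pd i Y x = G x i + pd i Q x := by
    intro i
    refine ae_eq_of_integral_mul_test hO ((ContDiffOn.pd hO hYs).continuousOn.locallyIntegrableOn
      hO.measurableSet) ((hGl i).add (hQs.pd.continuous.locallyIntegrable.locallyIntegrableOn _))
      fun φ hφ => ?_
    have hφs : IsTest strip φ := hφ.mono (halfStrip_subset_strip F)
    have h1 := integral_mul_pd hO hYs hφ i
    rw [hYint _ fun x hx => (hφ.pd i).eq_zero hx] at h1
    rw [eq_neg_iff_add_eq_zero, add_comm, ← eq_neg_iff_add_eq_zero] at h1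
    simp_rw [hY₀, add_mul] at h1
    rw [h1, integral_add (hvl.integrable_mul_test (hφ.pd i).smooth.continuous (hφ.pd i).compact
      (hφ.pd i).supp) (hQs.continuous.continuousOn.integrable_mul_test hO (hφ.pd i).smooth.continuous
      (hφ.pd i).compact (hφ.pd i).supp), ← setIntegral_mul_test (hφ.pd i) subset_rfl, hwg _ hφs,
      integral_mul_pd hO hQs.contDiffOn hφ, setIntegral_mul_test hφ subset_rfl]
    simp only [add_mul]
    rw [integral_add ((hGl i).integrable_mul_test hφ.smooth.continuous hφ.compact hφ.supp)
      (hQs.pd.continuous.continuousOn.integrable_mul_test hO hφ.smooth.continuous hφ.compact hφ.supp)]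
    ring
  have hgr : ∀ i, (fun x => pd i Y x) =ᵐ[volume.restrict (halfStrip F)] fun x => G x i + pd i Q x :=
    fun i => (ae_restrict_iff' hO.measurableSet).2 (hgrad i)
  have hQint : ∀ {U : Set Plane} {ψ h : Plane → ℝ}, Continuous h → IsTest U ψ →
      IntegrableOn (fun ξ => h ξ * ψ ξ) (halfStrip F) := fun hh hψ =>
    ((hh.mul hψ.smooth.continuous).integrable_of_hasCompactSupport hψ.compact.mul_left).integrableOn
  refine ⟨Y, ⟨hYs, fun ξ hξ => hequ hξ, ?_, ?_, ?_⟩, ?_, ?_⟩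
  · intro R
    have hle : volume.restrict (halfStrip F ∩ {ξ | ξ 1 < R}) ≤ volume.restrict (halfStrip F) :=
      Measure.restrict_mono Set.inter_subset_left le_rfl
    refine ⟨((hvt R).add (memLp_truncation_of_continuous hF R hQs.continuous 2)).ae_eq
      (Filter.EventuallyEq.symm (ae_mono hle hYar)), ?_⟩
    have hcont : Continuous (∇ Q) :=
      (InnerProductSpace.toDual ℝ Plane).symm.continuous.comp (hQs.continuous_fderiv (by simp))
    refine ((hG.mono_measure hle).add (memLp_truncation_of_continuous hF R hcont 2)).ae_eq ?_
    filter_upwards [ae_mono hle (hgr 0), ae_mono hle (hgr 1)] with x h0 h1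
    ext i
    fin_cases i
    · simp [gradient_apply] at h0 ⊢; exact h0.symm
    · simp [gradient_apply] at h1 ⊢; exact h1.symm
  · intro ψ hψ1 hψ2 hψ3 w
    have hψ : IsTest strip ψ := ⟨hψ1, hψ2, hψ3⟩
    have key : ∀ i, ∫ ξ in halfStrip F, Y ξ * pd i ψ ξ = -∫ ξ in halfStrip F, pd i Y ξ * ψ ξ := by
      intro i
      have e1 : ∫ ξ in halfStrip F, Y ξ * pd i ψ ξ = ∫ ξ in halfStrip F, (v ξ * pd i ψ ξ + Q ξ * pd i ψ ξ) :=
        integral_congr_ae (hYar.mono fun x hx => by simp only [hx, hY₀]; ring)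
      have e2 : ∫ ξ in halfStrip F, pd i Y ξ * ψ ξ = ∫ ξ in halfStrip F, (G ξ i * ψ ξ + pd i Q ξ * ψ ξ) :=
        integral_congr_ae ((hgr i).mono fun x hx => by simp only at hx ⊢; rw [hx]; ring)
      rw [e1, e2, integral_add (hvint (hψ.pd i)) (hQint hQs.continuous (hψ.pd i)),
        integral_add (hGint hψ i) (hQint hQs.pd.continuous hψ), hwg ψ hψ i, hwQ ψ hψ i]
      ring
    have i1 : ∀ i, IntegrableOn (fun ξ => Y ξ * pd i ψ ξ) (halfStrip F) := fun i =>
      ((hvint (hψ.pd i)).add (hQint hQs.continuous (hψ.pd i))).congr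
        (hYar.mono fun x hx => by simp only [hx, hY₀, Pi.add_apply]; ring)
    have i2 : ∀ i, IntegrableOn (fun ξ => pd i Y ξ * ψ ξ) (halfStrip F) := fun i =>
      ((hGint hψ i).add (hQint hQs.pd.continuous hψ)).congr
        ((hgr i).mono fun x hx => by simp only [Pi.add_apply] at hx ⊢; rw [hx]; ring)
    have e1 : ∀ ξ, Y ξ * fderiv ℝ ψ ξ w = w 0 * (Y ξ * pd 0 ψ ξ) + w 1 * (Y ξ * pd 1 ψ ξ) := fun ξ => by
      rw [fderiv_eq_pd]; ring
    have e2 : ∀ ξ, fderiv ℝ Y ξ w * ψ ξ = w 0 * (pd 0 Y ξ * ψ ξ) + w 1 * (pd 1 Y ξ * ψ ξ) := fun ξ => by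
      rw [fderiv_eq_pd]; ring
    simp_rw [e1, e2]
    rw [integral_add ((i1 0).const_mul _) ((i1 1).const_mul _),
      integral_add ((i2 0).const_mul _) ((i2 1).const_mul _)]
    simp only [integral_const_mul, key]
    ring
  · intro φ hφ1 hφ2 hφ3
    have hφ : IsTest (aboveGraph F) φ := ⟨hφ1, hφ2, hφ3⟩
    have h1 := heq φ hφ
    have hq' : ContDiff ℝ ∞ fun ξ : Plane => deriv q (ξ 1) := hq.deriv_real.comp (contDiff_coord 1)
    have hqq : Continuous fun ξ : Plane => deriv (deriv q) (ξ 1) :=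
      hq.deriv_real.deriv_real.continuous.comp (contDiff_coord 1).continuous
    have hgφ : IntegrableOn (fun ξ => (f ξ - deriv (deriv q) (ξ 1)) * φ ξ) (halfStrip F) := by
      have h2 := MemLp.integrable_mul hg
        ((hφ.mul_left (contDiff_expWeight (-η / 2))).memLp.restrict (halfStrip F))
      refine h2.congr (Eventually.of_forall fun ξ => ?_)
      have : Real.exp (-η / 2 * ξ 1) * Real.exp (η / 2 * ξ 1) = 1 := by
        rw [← Real.exp_add]; ring_nf; simp
      simp only [Pi.mul_apply]
      linear_combination ((f ξ - deriv (deriv q) (ξ 1)) * φ ξ) * this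
    -- The subtracted term depends on ξ₂ only, hence satisfies the lateral Neumann condition: the
    -- integrand is ∂₂(q'φ).
    have hz : ∫ ξ in halfStrip F, (deriv (deriv q) (ξ 1) * φ ξ + deriv q (ξ 1) * pd 1 φ ξ) = 0 := by
      have t : IsTest (aboveGraph F) fun ξ => deriv q (ξ 1) * φ ξ := hφ.mul_left hq'
      rw [setIntegral_halfStrip_eq_strip (F := F) (h := fun ξ => deriv (deriv q) (ξ 1) * φ ξ + deriv q (ξ 1) * pd 1 φ ξ)
        fun x hx => by rw [hφ.eq_zero hx, (hφ.pd 1).eq_zero hx]; ring]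
      rw [← setIntegral_strip_pd_one t]
      congr 1; funext ξ
      rw [pd_mul (hq'.differentiable (by simp) ξ) (hφ.smooth.differentiable (by simp) ξ),
        (pd_fun_coord (hq.deriv_real.differentiable (by simp) _).hasDerivAt).2]
    rw [integral_add (hQint hqq hφ) (hQint hq'.continuous (hφ.pd 1))] at hz
    have e1 : ∫ ξ in halfStrip F, ⟪∇ Y ξ, ∇ φ ξ⟫_ℝ
        = ∫ ξ in halfStrip F, (⟪G ξ, ∇ φ ξ⟫_ℝ + deriv q (ξ 1) * pd 1 φ ξ) := by
      refine integral_congr_ae ?_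
      filter_upwards [hgr 0, hgr 1] with x h0 h1
      have h2 : ⟪G x, ∇ φ x⟫_ℝ = G x 0 * pd 0 φ x + G x 1 * pd 1 φ x := by
        rw [inner_gradient_right, fderiv_eq_pd]; simp
      rw [inner_gradient, h0, h1, h2, (hpQ x).1, (hpQ x).2]; ring
    have iG : IntegrableOn (fun ξ => ⟪G ξ, ∇ φ ξ⟫_ℝ) (halfStrip F) := by
      refine ((hGint (hφ.pd 0) 0).add (hGint (hφ.pd 1) 1)).congr (Eventually.of_forall fun x => ?_)
      simp only [Pi.add_apply]
      rw [inner_gradient_right, fderiv_eq_pd]; simp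
    rw [e1, integral_add iG (hQint hq'.continuous (hφ.pd 1)), h1]
    have e2 : ∫ ξ in halfStrip F, f ξ * φ ξ = (∫ ξ in halfStrip F, (f ξ - deriv (deriv q) (ξ 1)) * φ ξ)
        + ∫ ξ in halfStrip F, deriv (deriv q) (ξ 1) * φ ξ := by
      rw [← integral_add hgφ (hQint hqq hφ)]
      congr 1; funext ξ; ring
    rw [e2]
    linarith
  · refine hv.ae_eq (hYar.mono fun x hx => ?_)
    simp only [hx, hY₀, hQ]; ring
  · refine (hGi 1).ae_eq ((hgr 1).mono fun x hx => ?_)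
    simp only at hx ⊢
    rw [hx, (hpQ x).2]; ring

/-! ### Reflections in the lateral sides and folding of test functions -/

/-- The upper half-plane `ξ₂ > 0`. -/
def upper : Set Plane := {ξ | 0 < ξ 1}

/-- The part of the half-strip above height zero. -/
def straightStrip : Set Plane := {ξ | -(1 / 2) < ξ 0 ∧ ξ 0 < 1 / 2 ∧ 0 < ξ 1}

/-- Three copies of `straightStrip` glued along the lateral sides. -/
def tripleStrip : Set Plane := {ξ | -(3 / 2) < ξ 0 ∧ ξ 0 < 3 / 2 ∧ 0 < ξ 1}

/-- The reflection in the vertical line `ξ₁ = c / 2`. -/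
noncomputable def reflAt (c : ℝ) (ξ : Plane) : Plane := !₂[c - ξ 0, ξ 1]

@[simp] theorem reflAt_zero (c : ℝ) (ξ : Plane) : reflAt c ξ 0 = c - ξ 0 := by simp [reflAt]

@[simp] theorem reflAt_one (c : ℝ) (ξ : Plane) : reflAt c ξ 1 = ξ 1 := by simp [reflAt]

theorem reflAt_reflAt (c : ℝ) (ξ : Plane) : reflAt c (reflAt c ξ) = ξ := by
  ext i; fin_cases i <;> simp

theorem continuous_reflAt (c : ℝ) : Continuous (reflAt c) :=
  continuous_plane.comp (f := fun ξ : Plane => (c - ξ 0, ξ 1)) (by fun_prop)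

/-- `reflAt c` as a homeomorphism. -/
noncomputable def reflHomeo (c : ℝ) : Plane ≃ₜ Plane where
  toFun := reflAt c
  invFun := reflAt c
  left_inv := reflAt_reflAt c
  right_inv := reflAt_reflAt c
  continuous_toFun := continuous_reflAt c
  continuous_invFun := continuous_reflAt c

/-- The coordinates as a measurable equivalence. -/
noncomputable def planeEquiv : ℝ × ℝ ≃ᵐ Plane :=
  (MeasurableEquiv.finTwoArrow (α := ℝ)).symm.trans (MeasurableEquiv.toLp 2 (Fin 2 → ℝ))

theorem planeEquiv_apply (p : ℝ × ℝ) : planeEquiv p = !₂[p.1, p.2] := rfl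

theorem measurePreserving_planeEquiv : MeasurePreserving planeEquiv := measurePreserving_plane

theorem measurePreserving_reflAt (c : ℝ) : MeasurePreserving (reflAt c) := by
  have h1 : MeasurePreserving (fun p : ℝ × ℝ => (c - p.1, p.2)) :=
    (Measure.measurePreserving_sub_left volume c).prod (MeasurePreserving.id volume)
  have h2 := measurePreserving_planeEquiv.comp (h1.comp measurePreserving_planeEquiv.symm)
  have e : reflAt c = planeEquiv ∘ (fun p : ℝ × ℝ => (c - p.1, p.2)) ∘ planeEquiv.symm := by
    funext ξ
    obtain ⟨p, rfl⟩ := planeEquiv.surjective ξ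
    simp only [Function.comp_apply, MeasurableEquiv.symm_apply_apply]
    simp [planeEquiv_apply, reflAt]
  rw [e]; exact h2

theorem measurableEmbedding_reflAt (c : ℝ) : MeasurableEmbedding (reflAt c) :=
  (reflHomeo c).measurableEmbedding

theorem hasFDerivAt_reflAt (c : ℝ) (ξ : Plane) : HasFDerivAt (reflAt c)
    (ContinuousLinearMap.id ℝ Plane
      - (2 : ℝ) • (EuclideanSpace.proj 0 : Plane →L[ℝ] ℝ).smulRight (EuclideanSpace.single 0 1)) ξ := by
  have e : reflAt c = fun ξ => c • EuclideanSpace.single 0 1 + (ContinuousLinearMap.id ℝ Plane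
      - (2 : ℝ) • (EuclideanSpace.proj 0 : Plane →L[ℝ] ℝ).smulRight (EuclideanSpace.single 0 1) :
        Plane →L[ℝ] Plane) ξ := by
    funext ξ; ext i
    fin_cases i
    · simp; ring
    · simp
  rw [e]
  exact (ContinuousLinearMap.hasFDerivAt _).const_add _

theorem contDiff_reflAt (c : ℝ) : ContDiff ℝ ∞ (reflAt c) := by
  rw [contDiff_euclidean]
  intro i
  fin_cases i
  · simpa using contDiff_const.sub (contDiff_coord 0)
  · simpa using contDiff_coord 1

theorem pd_comp_reflAt {f : Plane → ℝ} (hf : ContDiff ℝ ∞ f) (c : ℝ) :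
    pd 0 (fun ξ => f (reflAt c ξ)) = (fun ξ => -pd 0 f (reflAt c ξ)) ∧
    pd 1 (fun ξ => f (reflAt c ξ)) = fun ξ => pd 1 f (reflAt c ξ) := by
  have h : ∀ ξ, HasFDerivAt (fun ξ => f (reflAt c ξ)) _ ξ := fun ξ =>
    (hf.differentiable (by simp) (reflAt c ξ)).hasFDerivAt.comp ξ (hasFDerivAt_reflAt c ξ)
  refine ⟨funext fun ξ => ?_, funext fun ξ => ?_⟩
  · rw [pd, (h ξ).fderiv, pd]
    simp
    ring
  · rw [pd, (h ξ).fderiv, pd]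
    simp

theorem laplacian_comp_reflAt {f : Plane → ℝ} (hf : ContDiff ℝ ∞ f) (c : ℝ) :
    Δ (fun ξ => f (reflAt c ξ)) = fun ξ => Δ f (reflAt c ξ) := by
  have hs : ContDiff ℝ ∞ fun ξ => f (reflAt c ξ) := hf.comp (contDiff_reflAt c)
  rw [laplacian_fun_eq_pd hs, laplacian_fun_eq_pd hf]
  funext ξ
  have e0 : pd 0 (fun ξ => f (reflAt c ξ)) = fun ξ => (-1) * pd 0 f (reflAt c ξ) := by
    rw [(pd_comp_reflAt hf c).1]; funext ξ; ring
  have h1 : pd 0 (fun ξ => (-1) * pd 0 f (reflAt c ξ)) ξ = pd 0 (pd 0 f) (reflAt c ξ) := by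
    have : DifferentiableAt ℝ (fun ξ => pd 0 f (reflAt c ξ)) ξ :=
      (hf.pd.comp (contDiff_reflAt c)).differentiable (by simp) ξ
    have h2 := congrFun (pd_comp_reflAt (hf.pd (i := 0)) c).1 ξ
    rw [pd, fderiv_const_mul this]
    rw [pd] at h2
    simp [h2]
  rw [e0, h1, (pd_comp_reflAt hf c).2, (pd_comp_reflAt hf.pd c).2]

theorem IsTest.comp_reflAt {U V : Set Plane} {φ : Plane → ℝ} (h : IsTest U φ) (c : ℝ)
    (hUV : ∀ ξ, reflAt c ξ ∈ U → ξ ∈ V) : IsTest V fun ξ => φ (reflAt c ξ) := by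
  refine ⟨h.smooth.comp (contDiff_reflAt c), h.compact.comp_homeomorph (reflHomeo c), ?_⟩
  have : tsupport (fun ξ => φ (reflAt c ξ)) ⊆ reflAt c ⁻¹' tsupport φ :=
    closure_minimal (fun ξ hξ => subset_tsupport φ hξ) ((isClosed_tsupport φ).preimage (continuous_reflAt c))
  exact fun ξ hξ => hUV ξ (h.supp (this hξ))

theorem volume_vertical_line (c : ℝ) : volume {ξ : Plane | ξ 0 = c} = 0 := by
  rw [← measurePreserving_plane.measure_preimage_emb measurableEmbedding_plane]
  have : (fun p : ℝ × ℝ => (!₂[p.1, p.2] : Plane)) ⁻¹' {ξ : Plane | ξ 0 = c} = {c} ×ˢ Set.univ := by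
    ext p; simp
  rw [this, Measure.volume_eq_prod, Measure.prod_prod]
  simp

/-- The folding map of the triple strip onto the straight strip. -/
noncomputable def foldMap (ξ : Plane) : Plane :=
  if 1 / 2 < ξ 0 then reflAt 1 ξ else if ξ 0 < -(1 / 2) then reflAt (-1) ξ else ξ

theorem isOpen_straightStrip : IsOpen straightStrip := by
  have h0 : Continuous fun ξ : Plane => ξ 0 := by fun_prop
  have h1 : Continuous fun ξ : Plane => ξ 1 := by fun_prop
  exact (isOpen_lt continuous_const h0).inter ((isOpen_lt h0 continuous_const).inter (isOpen_lt continuous_const h1))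

theorem isOpen_tripleStrip : IsOpen tripleStrip := by
  have h0 : Continuous fun ξ : Plane => ξ 0 := by fun_prop
  have h1 : Continuous fun ξ : Plane => ξ 1 := by fun_prop
  exact (isOpen_lt continuous_const h0).inter ((isOpen_lt h0 continuous_const).inter (isOpen_lt continuous_const h1))

theorem tripleStrip_ae_eq : tripleStrip =ᵐ[volume]
    ((straightStrip ∪ reflAt 1 ⁻¹' straightStrip ∪ reflAt (-1) ⁻¹' straightStrip : Set Plane)) := by
  have h1 : ∀ᵐ ξ : Plane, ξ 0 ≠ 1 / 2 := by
    rw [ae_iff]; simpa using volume_vertical_line (1 / 2)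
  have h2 : ∀ᵐ ξ : Plane, ξ 0 ≠ -(1 / 2) := by
    rw [ae_iff]; simpa using volume_vertical_line (-(1 / 2))
  filter_upwards [h1, h2] with ξ h1 h2
  apply propext
  change ξ ∈ tripleStrip ↔ ξ ∈ straightStrip ∪ reflAt 1 ⁻¹' straightStrip ∪ reflAt (-1) ⁻¹' straightStrip
  simp only [tripleStrip, straightStrip, Set.mem_union, Set.mem_preimage, Set.mem_ofPred_eq, reflAt_zero, reflAt_one]
  constructor
  · rintro ⟨a, b, c⟩
    rcases lt_or_gt_of_ne h1 with h | h
    · rcases lt_or_gt_of_ne h2 with h' | h'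
      · exact Or.inr ⟨by linarith, by linarith, c⟩
      · exact Or.inl (Or.inl ⟨h', h, c⟩)
    · exact Or.inl (Or.inr ⟨by linarith, by linarith, c⟩)
  · rintro ((⟨a, b, c⟩ | ⟨a, b, c⟩) | ⟨a, b, c⟩) <;> exact ⟨by linarith, by linarith, c⟩

theorem foldMap_of_mem {ξ : Plane} (h : ξ ∈ straightStrip) : foldMap ξ = ξ := by
  rw [foldMap, if_neg (not_lt.2 h.2.1.le), if_neg (not_lt.2 h.1.le)]

theorem foldMap_reflAt_one {ξ : Plane} (h : ξ ∈ straightStrip) : foldMap (reflAt 1 ξ) = ξ := by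
  have : 1 / 2 < reflAt 1 ξ 0 := by have := h.2.1; simp; linarith
  rw [foldMap, if_pos this, reflAt_reflAt]

theorem foldMap_reflAt_neg_one {ξ : Plane} (h : ξ ∈ straightStrip) : foldMap (reflAt (-1) ξ) = ξ := by
  have h1 : reflAt (-1) ξ 0 < -(1 / 2) := by have := h.1; simp; linarith
  rw [foldMap, if_neg (by linarith), if_pos h1, reflAt_reflAt]

theorem measurableSet_reflAt_preimage (c : ℝ) : MeasurableSet (reflAt c ⁻¹' straightStrip) :=
  (isOpen_straightStrip.preimage (continuous_reflAt c)).measurableSet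

theorem setIntegral_tripleStrip {g : Plane → ℝ} (hg : IntegrableOn g tripleStrip) :
    ∫ ξ in tripleStrip, g ξ = ∫ ξ in straightStrip, (g ξ + g (reflAt 1 ξ) + g (reflAt (-1) ξ)) := by
  have hg' := hg.congr_set_ae tripleStrip_ae_eq.symm
  have h1 : IntegrableOn g straightStrip := hg'.mono_set fun x hx => Or.inl (Or.inl hx)
  have h2 : IntegrableOn g (reflAt 1 ⁻¹' straightStrip) := hg'.mono_set fun x hx => Or.inl (Or.inr hx)
  have h3 : IntegrableOn g (reflAt (-1) ⁻¹' straightStrip) := hg'.mono_set fun x hx => Or.inr hx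
  have key : ∀ c, ∫ ξ in reflAt c ⁻¹' straightStrip, g ξ = ∫ ξ in straightStrip, g (reflAt c ξ) := by
    intro c
    have := (measurePreserving_reflAt c).setIntegral_preimage_emb (measurableEmbedding_reflAt c)
      (fun ξ => g (reflAt c ξ)) straightStrip
    simpa only [reflAt_reflAt] using this
  have key2 : ∀ c, IntegrableOn g (reflAt c ⁻¹' straightStrip) →
      IntegrableOn (fun ξ => g (reflAt c ξ)) straightStrip := by
    intro c h
    have := ((measurePreserving_reflAt c).integrableOn_comp_preimage (measurableEmbedding_reflAt c)
      (f := fun ξ => g (reflAt c ξ)) (s := straightStrip)).1 ?_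
    · exact this
    · convert h using 1
      funext ξ
      simp [reflAt_reflAt]
  rw [setIntegral_congr_set tripleStrip_ae_eq, setIntegral_union _ (measurableSet_reflAt_preimage _)
    (h1.union h2) h3, setIntegral_union _ (measurableSet_reflAt_preimage _) h1 h2, key, key,
    ← integral_add h1 (key2 1 h2)]
  · exact (integral_add (f := fun ξ => g ξ + g (reflAt 1 ξ)) (h1.add (key2 1 h2)) (key2 (-1) h3)).symm
  · rw [Set.disjoint_left]
    intro x hx hx'
    have a := hx.2.1
    have b : reflAt 1 x 0 < 1 / 2 := hx'.2.1
    rw [reflAt_zero] at b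
    linarith
  · rw [Set.disjoint_left]
    rintro x (hx | hx) hx'
    · have a := hx.1
      have b : -(1 / 2) < reflAt (-1) x 0 := hx'.1
      rw [reflAt_zero] at b
      linarith
    · have a : reflAt 1 x 0 < 1 / 2 := hx.2.1
      have b : -(1 / 2) < reflAt (-1) x 0 := hx'.1
      rw [reflAt_zero] at a b
      linarith

theorem integrableOn_foldMap {w : Plane → ℝ} {A : Set ℝ} (hA : MeasurableSet A)
    (hw : IntegrableOn w (straightStrip ∩ {ξ | ξ 1 ∈ A})) :
    IntegrableOn (fun ξ => w (foldMap ξ)) (tripleStrip ∩ {ξ | ξ 1 ∈ A}) := by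
  set B : Set Plane := {ξ | ξ 1 ∈ A} with hB
  have hBm : MeasurableSet B := (contDiff_coord 1).continuous.measurable hA
  have hrB : ∀ c, reflAt c ⁻¹' B = B := fun c => by ext ξ; simp [hB]
  have e : (tripleStrip ∩ B : Set Plane) =ᵐ[volume]
      ((straightStrip ∩ B) ∪ reflAt 1 ⁻¹' (straightStrip ∩ B) ∪ reflAt (-1) ⁻¹' (straightStrip ∩ B) : Set Plane) := by
    rw [Set.preimage_inter, Set.preimage_inter, hrB, hrB, ← Set.union_inter_distrib_right,
      ← Set.union_inter_distrib_right]
    exact tripleStrip_ae_eq.inter (ae_eq_refl B)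
  have hm : ∀ c, MeasurableSet (reflAt c ⁻¹' (straightStrip ∩ B)) := fun c =>
    (isOpen_straightStrip.measurableSet.inter hBm).preimage (continuous_reflAt c).measurable
  have key : ∀ c, IntegrableOn (fun ξ => w (reflAt c ξ)) (reflAt c ⁻¹' (straightStrip ∩ B)) := fun c =>
    ((measurePreserving_reflAt c).integrableOn_comp_preimage (measurableEmbedding_reflAt c)).2 hw
  refine IntegrableOn.congr_set_ae ?_ e
  refine (IntegrableOn.union ?_ ?_).union ?_
  · exact hw.congr_fun (fun ξ hξ => by simp only [foldMap_of_mem hξ.1])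
      (isOpen_straightStrip.measurableSet.inter hBm)
  · refine (key 1).congr_fun (fun ξ hξ => ?_) (hm 1)
    have := foldMap_reflAt_one (ξ := reflAt 1 ξ) hξ.1
    rw [reflAt_reflAt] at this
    simp only [this]
  · refine (key (-1)).congr_fun (fun ξ hξ => ?_) (hm _)
    have := foldMap_reflAt_neg_one (ξ := reflAt (-1) ξ) hξ.1
    rw [reflAt_reflAt] at this
    simp only [this]

theorem setIntegral_foldMap {w : Plane → ℝ} {A : Set ℝ} (hA : MeasurableSet A)
    (hw : IntegrableOn w (straightStrip ∩ {ξ | ξ 1 ∈ A})) :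
    ∫ ξ in tripleStrip ∩ {ξ | ξ 1 ∈ A}, w (foldMap ξ) = 3 * ∫ ξ in straightStrip ∩ {ξ | ξ 1 ∈ A}, w ξ := by
  set B : Set Plane := {ξ | ξ 1 ∈ A} with hB
  have hBm : MeasurableSet B := (contDiff_coord 1).continuous.measurable hA
  have hi := integrableOn_foldMap hA hw
  rw [← setIntegral_indicator hBm, ← setIntegral_indicator hBm, setIntegral_tripleStrip,
    ← integral_const_mul]
  · refine setIntegral_congr_fun isOpen_straightStrip.measurableSet fun ξ hξ => ?_
    have hrB : ∀ c, reflAt c ξ ∈ B ↔ ξ ∈ B := fun c => by simp [hB]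
    have hi : ∀ c, B.indicator (fun ξ => w (foldMap ξ)) (reflAt c ξ)
        = B.indicator (fun ξ => w (foldMap (reflAt c ξ))) ξ := fun c => by
      by_cases h : ξ ∈ B
      · rw [Set.indicator_of_mem h, Set.indicator_of_mem ((hrB c).2 h)]
      · rw [Set.indicator_of_notMem h, Set.indicator_of_notMem (mt (hrB c).1 h)]
    simp only [hi]
    simp only [Set.indicator, foldMap_of_mem hξ, foldMap_reflAt_one hξ, foldMap_reflAt_neg_one hξ]
    ring
  · rw [IntegrableOn, integrable_indicator_iff hBm, IntegrableOn, Measure.restrict_restrict hBm, Set.inter_comm]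
    exact hi

theorem locallyIntegrableOn_foldMap {w : Plane → ℝ}
    (hw : ∀ R : ℝ, IntegrableOn w (straightStrip ∩ {ξ | ξ 1 ∈ Set.Iio R})) :
    LocallyIntegrableOn (fun ξ => w (foldMap ξ)) tripleStrip := by
  intro x hx
  refine ⟨tripleStrip ∩ {ξ | ξ 1 ∈ Set.Iio (x 1 + 1)}, ?_, integrableOn_foldMap measurableSet_Iio (hw _)⟩
  refine inter_mem_nhdsWithin _ ?_
  exact (isOpen_lt (contDiff_coord 1).continuous continuous_const).mem_nhds (by simp)

/-- Testing a folded function against `φ` amounts to testing the original one against `φ` plus its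
two reflections. This sum may reach the lateral sides but still stays away from the bottom, as the
weak Neumann equation requires. -/
theorem IsTest.foldSum {φ : Plane → ℝ} (h : IsTest tripleStrip φ) :
    IsTest upper fun ξ => φ ξ + φ (reflAt 1 ξ) + φ (reflAt (-1) ξ) := by
  refine ((h.mono fun ξ hξ => hξ.2.2).add (h.comp_reflAt 1 fun ξ hξ => ?_)).add
    (h.comp_reflAt (-1) fun ξ hξ => ?_)
  · have := hξ.2.2; rwa [reflAt_one] at this
  · have := hξ.2.2; rwa [reflAt_one] at this

theorem pd_zero_foldSum {φ : Plane → ℝ} (h : IsTest tripleStrip φ) (ξ : Plane) :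
    pd 0 (fun ξ => φ ξ + φ (reflAt 1 ξ) + φ (reflAt (-1) ξ)) ξ
      = pd 0 φ ξ - pd 0 φ (reflAt 1 ξ) - pd 0 φ (reflAt (-1) ξ) := by
  have hd : ∀ c, DifferentiableAt ℝ (fun ξ => φ (reflAt c ξ)) ξ := fun c =>
    (h.smooth.comp (contDiff_reflAt c)).differentiable (by simp) ξ
  have e := fun c => congrFun (pd_comp_reflAt h.smooth c).1 ξ
  have h1 : fderiv ℝ (fun ξ => φ ξ + φ (reflAt 1 ξ) + φ (reflAt (-1) ξ)) ξ = _ :=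
    fderiv_fun_add ((h.smooth.differentiable (by simp) ξ).add (hd 1)) (hd (-1))
  have h2 : fderiv ℝ (fun ξ => φ ξ + φ (reflAt 1 ξ)) ξ = _ :=
    fderiv_fun_add (h.smooth.differentiable (by simp) ξ) (hd 1)
  have e1 := e 1
  have e2 := e (-1)
  rw [pd] at e1 e2
  rw [pd, h1, add_apply, h2, add_apply, e1, e2, ← pd]
  ring

theorem laplacian_foldSum {φ : Plane → ℝ} (h : IsTest tripleStrip φ) :
    Δ (fun ξ => φ ξ + φ (reflAt 1 ξ) + φ (reflAt (-1) ξ))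
      = fun ξ => Δ φ ξ + Δ φ (reflAt 1 ξ) + Δ φ (reflAt (-1) ξ) := by
  have hc : ∀ c, ContDiff ℝ ∞ fun ξ => φ (reflAt c ξ) := fun c => h.smooth.comp (contDiff_reflAt c)
  have h2 : ∀ {f : Plane → ℝ}, ContDiff ℝ ∞ f → ∀ ξ, ContDiffAt ℝ 2 f ξ := fun hf ξ =>
    hf.contDiffAt.of_le (by norm_cast)
  funext ξ
  have e1 : Δ (fun ξ => φ ξ + φ (reflAt 1 ξ) + φ (reflAt (-1) ξ)) ξ = _ :=
    (h2 (h.smooth.add (hc 1)) ξ).laplacian_add (h2 (hc (-1)) ξ)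
  have e2 : Δ (fun ξ => φ ξ + φ (reflAt 1 ξ)) ξ = _ := (h2 h.smooth ξ).laplacian_add (h2 (hc 1) ξ)
  rw [e1, e2, laplacian_comp_reflAt h.smooth, laplacian_comp_reflAt h.smooth]

/-- On each side `φ` and its reflection in that side contribute opposite normal derivatives, while
the other reflection evaluates at ξ₁ = ±3/2, where `φ` vanishes. -/
theorem pd_zero_foldSum_eq_zero {φ : Plane → ℝ} (h : IsTest tripleStrip φ) (t : ℝ) :
    pd 0 (fun ξ => φ ξ + φ (reflAt 1 ξ) + φ (reflAt (-1) ξ)) !₂[1 / 2, t] = 0 ∧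
    pd 0 (fun ξ => φ ξ + φ (reflAt 1 ξ) + φ (reflAt (-1) ξ)) !₂[-(1 / 2), t] = 0 := by
  have h3 : pd 0 φ !₂[3 / 2, t] = 0 := (h.pd 0).eq_zero fun hx => by have := hx.2.1; simp at this
  have h4 : pd 0 φ !₂[-(3 / 2), t] = 0 := (h.pd 0).eq_zero fun hx => by have := hx.1; simp at this
  have a1 : reflAt 1 !₂[1 / 2, t] = !₂[1 / 2, t] := by ext i; fin_cases i <;> (simp; try norm_num)
  have a2 : reflAt (-1) !₂[1 / 2, t] = !₂[-(3 / 2), t] := by ext i; fin_cases i <;> (simp; try norm_num)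
  have a3 : reflAt 1 !₂[-(1 / 2), t] = !₂[3 / 2, t] := by ext i; fin_cases i <;> (simp; try norm_num)
  have a4 : reflAt (-1) !₂[-(1 / 2), t] = !₂[-(1 / 2), t] := by ext i; fin_cases i <;> (simp; try norm_num)
  rw [pd_zero_foldSum h, pd_zero_foldSum h, a1, a2, a3, a4, h3, h4]
  constructor <;> ring

/-! ### Green's formula up to the lateral sides -/

/-- A smooth cutoff vanishing within distance `ε` of `±1/2`. -/
noncomputable def sideCutoff (ε x : ℝ) : ℝ :=
  Real.smoothTransition ((1 / 2 - x) / ε - 1) * Real.smoothTransition ((1 / 2 + x) / ε - 1)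

theorem contDiff_sideCutoff (ε : ℝ) : ContDiff ℝ ∞ (sideCutoff ε) :=
  (Real.smoothTransition.contDiff.comp (((contDiff_const.sub contDiff_id).div_const _).sub contDiff_const)).mul
    (Real.smoothTransition.contDiff.comp (((contDiff_const.add contDiff_id).div_const _).sub contDiff_const))

theorem abs_sideCutoff_le (ε x : ℝ) : |sideCutoff ε x| ≤ 1 := by
  rw [sideCutoff, abs_mul, abs_of_nonneg (Real.smoothTransition.nonneg _),
    abs_of_nonneg (Real.smoothTransition.nonneg _)]
  exact mul_le_one₀ (Real.smoothTransition.le_one _) (Real.smoothTransition.nonneg _)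
    (Real.smoothTransition.le_one _)

theorem sideCutoff_ne_zero {ε x : ℝ} (hε : 0 < ε) (h : sideCutoff ε x ≠ 0) :
    -(1 / 2) + ε ≤ x ∧ x ≤ 1 / 2 - ε := by
  constructor
  · by_contra hlt
    refine h ?_
    rw [sideCutoff, Real.smoothTransition.zero_of_nonpos (x := (1 / 2 + x) / ε - 1), mul_zero]
    rw [sub_nonpos, div_le_one hε]; linarith
  · by_contra hlt
    refine h ?_
    rw [sideCutoff, Real.smoothTransition.zero_of_nonpos (x := (1 / 2 - x) / ε - 1), zero_mul]
    rw [sub_nonpos, div_le_one hε]; linarith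

theorem deriv_smoothTransition_eq_zero {s : ℝ} (hs : 1 < s) : deriv Real.smoothTransition s = 0 := by
  have : Real.smoothTransition =ᶠ[𝓝 s] fun _ => 1 := by
    filter_upwards [Ioi_mem_nhds hs] with t ht using Real.smoothTransition.one_of_one_le (le_of_lt ht)
  rw [this.deriv_eq]; simp

theorem exists_deriv_smoothTransition_bound : ∃ C, 0 ≤ C ∧ ∀ s, |deriv Real.smoothTransition s| ≤ C := by
  have hc : Continuous (deriv Real.smoothTransition) :=
    (Real.smoothTransition.contDiff (n := ⊤)).deriv_real.continuous
  obtain ⟨C, hC⟩ := isCompact_Icc.exists_bound_of_continuousOn (s := Set.Icc (0:ℝ) 1) hc.continuousOn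
  have hC0 : 0 ≤ C := (norm_nonneg _).trans (hC 0 ⟨le_rfl, zero_le_one⟩)
  refine ⟨C, hC0, fun s => ?_⟩
  by_cases h1 : 1 < s
  · rw [deriv_smoothTransition_eq_zero h1, abs_zero]; exact hC0
  · by_cases h0 : s < 0
    · have : Real.smoothTransition =ᶠ[𝓝 s] fun _ => 0 := by
        filter_upwards [Iio_mem_nhds h0] with t ht using Real.smoothTransition.zero_of_nonpos (le_of_lt ht)
      rw [this.deriv_eq]; simpa using hC0
    · exact hC s ⟨not_lt.1 h0, not_lt.1 h1⟩

theorem deriv_sideCutoff (ε x : ℝ) : deriv (sideCutoff ε) x =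
    -(deriv Real.smoothTransition ((1 / 2 - x) / ε - 1) / ε) * Real.smoothTransition ((1 / 2 + x) / ε - 1)
    + Real.smoothTransition ((1 / 2 - x) / ε - 1) * (deriv Real.smoothTransition ((1 / 2 + x) / ε - 1) / ε) := by
  have hT : ∀ s, HasDerivAt Real.smoothTransition (deriv Real.smoothTransition s) s := fun s =>
    ((Real.smoothTransition.contDiff (n := ⊤)).differentiable (by simp) s).hasDerivAt
  have h1 : HasDerivAt (fun x => (1 / 2 - x) / ε - 1) (-1 / ε) x := by
    exact (((hasDerivAt_id x).const_sub (1 / 2)).div_const ε).sub_const 1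
  have h2 : HasDerivAt (fun x => (1 / 2 + x) / ε - 1) (1 / ε) x := by
    exact (((hasDerivAt_id x).const_add (1 / 2)).div_const ε).sub_const 1
  have h3 := (HasDerivAt.comp (h := fun x => (1 / 2 - x) / ε - 1) x (hT _) h1).mul
    (HasDerivAt.comp (h := fun x => (1 / 2 + x) / ε - 1) x (hT _) h2)
  have h4 : HasDerivAt (sideCutoff ε) _ x := h3
  rw [h4.deriv]
  simp only [Function.comp]
  ring

/-- The derivative of the cutoff has size 1/ε but lives within 2ε of the sides, where a quantity
vanishing linearly is O(ε). The product is bounded uniformly in ε. -/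
theorem abs_deriv_sideCutoff_mul_le : ∃ C, 0 ≤ C ∧ ∀ ε, 0 < ε → ∀ x p L, 0 ≤ L → |p| ≤ L * |1 / 2 - x| →
    |p| ≤ L * |1 / 2 + x| → -(1 / 2) < x → x < 1 / 2 → |deriv (sideCutoff ε) x * p| ≤ C * L := by
  obtain ⟨C, hC0, hC⟩ := exists_deriv_smoothTransition_bound
  refine ⟨4 * C, by positivity, fun ε hε x p L hL h1 h2 hx1 hx2 => ?_⟩
  have key : ∀ y, 0 < y → |p| ≤ L * |y| → |deriv Real.smoothTransition (y / ε - 1) / ε * p| ≤ 2 * C * L := by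
    intro y hy hp
    rw [abs_of_pos hy] at hp
    by_cases h : 1 < y / ε - 1
    · rw [deriv_smoothTransition_eq_zero h]; simp; positivity
    · have hy2 : y ≤ 2 * ε := by
        have : y / ε ≤ 2 := by linarith
        rwa [div_le_iff₀ hε] at this
      rw [abs_mul, abs_div, abs_of_pos hε]
      calc |deriv Real.smoothTransition (y / ε - 1)| / ε * |p| ≤ C / ε * (L * (2 * ε)) := by
            gcongr
            · exact hC _
            · exact hp.trans (by gcongr)
        _ = 2 * C * L := by field_simp
  have k1 := key (1 / 2 - x) (by linarith) h1
  have k2 := key (1 / 2 + x) (by linarith) h2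
  have T0 : ∀ s, |Real.smoothTransition s| ≤ 1 := fun s => by
    rw [abs_of_nonneg (Real.smoothTransition.nonneg _)]; exact Real.smoothTransition.le_one _
  rw [deriv_sideCutoff, add_mul]
  refine (abs_add_le _ _).trans ?_
  have e1 : -(deriv Real.smoothTransition ((1 / 2 - x) / ε - 1) / ε) * Real.smoothTransition ((1 / 2 + x) / ε - 1) * p
    = -((deriv Real.smoothTransition ((1 / 2 - x) / ε - 1) / ε * p) * Real.smoothTransition ((1 / 2 + x) / ε - 1)) := by ring
  have e2 : Real.smoothTransition ((1 / 2 - x) / ε - 1) * (deriv Real.smoothTransition ((1 / 2 + x) / ε - 1) / ε) * p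
    = (deriv Real.smoothTransition ((1 / 2 + x) / ε - 1) / ε * p) * Real.smoothTransition ((1 / 2 - x) / ε - 1) := by ring
  rw [e1, e2, abs_neg, abs_mul, abs_mul _ (Real.smoothTransition _)]
  have a1 : ∀ a b : ℝ, |a| ≤ 2 * C * L → |b| ≤ 1 → |a| * |b| ≤ 2 * C * L := fun a b ha hb =>
    (mul_le_mul ha hb (abs_nonneg _) (by positivity)).trans_eq (mul_one _)
  linarith [a1 _ _ k1 (T0 ((1 / 2 + x) / ε - 1)), a1 _ _ k2 (T0 ((1 / 2 - x) / ε - 1))]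

theorem sideCutoff_eventually {x : ℝ} (h1 : -(1 / 2) < x) (h2 : x < 1 / 2) :
    ∀ᶠ n : ℕ in atTop, sideCutoff (1 / ((n : ℝ) + 1)) x = 1 ∧ deriv (sideCutoff (1 / ((n : ℝ) + 1))) x = 0 := by
  have key : ∀ y : ℝ, 0 < y → ∀ᶠ n : ℕ in atTop, 1 < y / (1 / ((n : ℝ) + 1)) - 1 := by
    intro y hy
    have : Tendsto (fun n : ℕ => y * ((n : ℝ) + 1)) atTop atTop :=
      (tendsto_atTop_add_const_right _ _ tendsto_natCast_atTop_atTop).const_mul_atTop hy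
    filter_upwards [this.eventually_gt_atTop 2] with n hn
    rw [div_div_eq_mul_div, div_one]; linarith
  filter_upwards [key (1 / 2 - x) (by linarith), key (1 / 2 + x) (by linarith)] with n a b
  rw [deriv_sideCutoff, sideCutoff, deriv_smoothTransition_eq_zero a, deriv_smoothTransition_eq_zero b,
    Real.smoothTransition.one_of_one_le a.le, Real.smoothTransition.one_of_one_le b.le]
  simp

theorem isTest_sideCutoff_mul {F : ℝ → ℝ} (hF : IsProfile F) {ε : ℝ} (hε : 0 < ε) {Φ : Plane → ℝ}
    (hΦ : IsTest upper Φ) : IsTest (halfStrip F) fun ξ => sideCutoff ε (ξ 0) * Φ ξ := by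
  have hs : ContDiff ℝ ∞ fun ξ : Plane => sideCutoff ε (ξ 0) := (contDiff_sideCutoff ε).comp (contDiff_coord 0)
  refine ⟨hs.mul hΦ.smooth, hΦ.compact.mul_left, fun ξ hξ => ?_⟩
  have h1 : 0 < ξ 1 := hΦ.supp (tsupport_mul_subset_right hξ)
  have hc : IsClosed {ξ : Plane | -(1 / 2) + ε ≤ ξ 0 ∧ ξ 0 ≤ 1 / 2 - ε} :=
    (isClosed_le continuous_const (contDiff_coord 0).continuous).inter
      (isClosed_le (contDiff_coord 0).continuous continuous_const)
  have h2 : tsupport (fun ξ : Plane => sideCutoff ε (ξ 0)) ⊆ {ξ : Plane | -(1 / 2) + ε ≤ ξ 0 ∧ ξ 0 ≤ 1 / 2 - ε} :=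
    closure_minimal (fun ξ h => sideCutoff_ne_zero hε h) hc
  have h3 := h2 (tsupport_mul_subset_left hξ)
  exact ⟨by linarith [h3.1], by linarith [h3.2], (hF.neg _).trans h1⟩

theorem abs_pd_zero_le_of_isTest {U : Set Plane} {Φ : Plane → ℝ} (hΦ : IsTest U Φ) {c : ℝ}
    (h0 : ∀ t, pd 0 Φ !₂[c, t] = 0) : ∃ L, 0 ≤ L ∧ ∀ ξ, |pd 0 Φ ξ| ≤ L * |c - ξ 0| := by
  obtain ⟨L, hL⟩ := ((hΦ.pd 0).pd 0).compact.exists_bound_of_continuous ((hΦ.pd 0).pd 0).smooth.continuous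
  refine ⟨L, (norm_nonneg _).trans (hL 0), fun ξ => ?_⟩
  have h1 := Convex.norm_image_sub_le_of_norm_hasDerivWithin_le (f := fun x => pd 0 Φ !₂[x, ξ 1])
    (f' := fun x => pd 0 (pd 0 Φ) !₂[x, ξ 1]) (s := Set.univ) (C := L) (x := c) (y := ξ 0)
    (fun x _ => (hasDerivAt_horizontal ((hΦ.pd 0).smooth.differentiable (by simp) _)).hasDerivWithinAt)
    (fun x _ => hL _) convex_univ trivial trivial
  have e : (!₂[ξ 0, ξ 1] : Plane) = ξ := by ext i; fin_cases i <;> simp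
  rw [e, h0, sub_zero] at h1
  rw [abs_sub_comm]
  exact h1

/-- Solutions of `Δu = f` with the lateral Neumann condition but without condition on `Γ`. -/
structure IsNeumannSolution (F : ℝ → ℝ) (f u : Plane → ℝ) : Prop where
  smooth : ContDiffOn ℝ ∞ u (halfStrip F)
  rhs : ∀ R, MemLp f 2 (volume.restrict (truncation F R))
  energy : HasLocalEnergy F u
  neumann : WeakNeumannEq F f u

theorem exists_height_bound {ψ : Plane → ℝ} (hc : HasCompactSupport ψ) :
    ∃ R : ℝ, ∀ ξ : Plane, R ≤ ξ 1 → ψ ξ = 0 := by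
  obtain ⟨C, hC⟩ := hc.isCompact.exists_bound_of_continuousOn (contDiff_coord 1).continuous.continuousOn
  refine ⟨C + 1, fun ξ hξ => image_eq_zero_of_notMem_tsupport fun h => ?_⟩
  have := hC ξ h
  rw [Real.norm_eq_abs] at this
  have := le_abs_self (ξ 1)
  linarith

theorem setIntegral_halfStrip_eq_truncation {F : ℝ → ℝ} (hF : IsProfile F) {R : ℝ} {h : Plane → ℝ}
    (hh : ∀ ξ : Plane, R ≤ ξ 1 → h ξ = 0) : ∫ ξ in halfStrip F, h ξ = ∫ ξ in truncation F R, h ξ :=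
  setIntegral_eq_of_subset_of_forall_sdiff_eq_zero (isOpen_halfStrip hF.smooth.continuous).measurableSet
    Set.inter_subset_left fun ξ hξ => hh ξ (not_lt.1 fun h' => hξ.2 ⟨hξ.1, h'⟩)

theorem integrableOn_halfStrip_of_truncation {F : ℝ → ℝ} (hF : IsProfile F) {R : ℝ} {h : Plane → ℝ}
    (hi : IntegrableOn h (truncation F R)) (hh : ∀ ξ : Plane, R ≤ ξ 1 → h ξ = 0) :
    IntegrableOn h (halfStrip F) :=
  hi.of_forall_sdiff_eq_zero (isOpen_halfStrip hF.smooth.continuous).measurableSet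
    fun ξ hξ => hh ξ (not_lt.1 fun h' => hξ.2 ⟨hξ.1, h'⟩)

theorem integrableOn_mul_of_truncation {F : ℝ → ℝ} (hF : IsProfile F) {w ψ : Plane → ℝ}
    (hw : ∀ R, MemLp w 2 (volume.restrict (truncation F R))) (hψ : Continuous ψ)
    (hc : HasCompactSupport ψ) : IntegrableOn (fun ξ => w ξ * ψ ξ) (halfStrip F) := by
  obtain ⟨R, hR⟩ := exists_height_bound hc
  refine integrableOn_halfStrip_of_truncation hF (R := R) ?_ fun ξ hξ => by rw [hR ξ hξ, mul_zero]
  have hψ2 : MemLp ψ 2 (volume.restrict (truncation F R)) :=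
    (hψ.memLp_of_hasCompactSupport (μ := volume) hc).restrict _
  exact MemLp.integrable_mul (hw R) hψ2

theorem isFiniteMeasure_truncation {F : ℝ → ℝ} (hF : IsProfile F) (R : ℝ) :
    IsFiniteMeasure (volume.restrict (truncation F R)) := by
  obtain ⟨K, hK, hsub⟩ := exists_isCompact_truncation_subset hF R
  exact ⟨by rw [Measure.restrict_apply_univ]; exact (measure_mono hsub).trans_lt hK.measure_lt_top⟩

theorem HasLocalEnergy.memLp_pd {F : ℝ → ℝ} {u : Plane → ℝ} (h : HasLocalEnergy F u) (i : Fin 2) (R : ℝ) :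
    MemLp (fun ξ => pd i u ξ) 2 (volume.restrict (truncation F R)) := by
  have h2 := (h R).2
  refine MemLp.of_le (f := fun ξ => pd i u ξ) h2 ?_ (Eventually.of_forall fun ξ => ?_)
  · have := (EuclideanSpace.proj i : Plane →L[ℝ] ℝ).continuous.comp_aestronglyMeasurable h2.1
    refine this.congr (Eventually.of_forall fun ξ => gradient_apply u ξ i)
  · rw [← gradient_apply]
    exact PiLp.norm_apply_le (∇ u ξ) i

theorem pd_fun_coord_zero {q : ℝ → ℝ} {q' : ℝ} {x : Plane} (h : HasDerivAt q q' (x 0)) :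
    pd 0 (fun ξ : Plane => q (ξ 0)) x = q' ∧ pd 1 (fun ξ : Plane => q (ξ 0)) x = 0 := by
  have h1 : HasFDerivAt (fun ξ : Plane => q (ξ 0)) (q' • (EuclideanSpace.proj 0 : Plane →L[ℝ] ℝ)) x :=
    h.comp_hasFDerivAt x (hasFDerivAt_coord 0 x)
  simp [pd, h1.fderiv]

/-- Green's formula up to the lateral sides for functions with vanishing normal derivative. -/
theorem integral_mul_laplacian_of_lateral {F : ℝ → ℝ} (hF : IsProfile F) {u Φ : Plane → ℝ}
    (hu : ContDiffOn ℝ ∞ u (halfStrip F)) (he : HasLocalEnergy F u) (hΦ : IsTest upper Φ)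
    (h1 : ∀ t, pd 0 Φ !₂[1 / 2, t] = 0) (h2 : ∀ t, pd 0 Φ !₂[-(1 / 2), t] = 0) :
    ∫ ξ in halfStrip F, u ξ * Δ Φ ξ = -∫ ξ in halfStrip F, ⟪∇ u ξ, ∇ Φ ξ⟫_ℝ := by
  have hO := isOpen_halfStrip hF.smooth.continuous
  set ε : ℕ → ℝ := fun n => 1 / ((n : ℝ) + 1) with hε
  have hεp : ∀ n, 0 < ε n := fun n => by simp only [hε]; positivity
  have hut : ∀ R, MemLp u 2 (volume.restrict (truncation F R)) := fun R => (he R).1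
  obtain ⟨R1, hR1⟩ := exists_height_bound (hΦ.pd 0).compact
  obtain ⟨R2, hR2⟩ := exists_height_bound hΦ.laplacian.compact
  obtain ⟨K, hK⟩ := hΦ.laplacian.compact.exists_bound_of_continuous hΦ.laplacian.smooth.continuous
  obtain ⟨C, hC0, hC⟩ := abs_deriv_sideCutoff_mul_le
  obtain ⟨L1, hL10, hL1⟩ := abs_pd_zero_le_of_isTest hΦ h1
  obtain ⟨L2, hL20, hL2⟩ := abs_pd_zero_le_of_isTest hΦ h2
  -- The components of ∇Φ times the side cutoff are test functions in the open strip; the cutoff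
  -- depends on ξ₁ only, so its derivative meets only ∂₁Φ, that is `pd 0 Φ`.
  have hid : ∀ n, ∫ ξ in halfStrip F, u ξ * (sideCutoff (ε n) (ξ 0) * Δ Φ ξ + deriv (sideCutoff (ε n)) (ξ 0) * pd 0 Φ ξ)
      = -∫ ξ in halfStrip F, sideCutoff (ε n) (ξ 0) * ⟪∇ u ξ, ∇ Φ ξ⟫_ℝ := by
    intro n
    have hz : ContDiff ℝ ∞ fun ξ : Plane => sideCutoff (ε n) (ξ 0) := (contDiff_sideCutoff _).comp (contDiff_coord 0)
    have hpz : ∀ ξ : Plane, pd 0 (fun ξ : Plane => sideCutoff (ε n) (ξ 0)) ξ = deriv (sideCutoff (ε n)) (ξ 0) ∧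
        pd 1 (fun ξ : Plane => sideCutoff (ε n) (ξ 0)) ξ = 0 := fun ξ =>
      pd_fun_coord_zero ((contDiff_sideCutoff _).differentiable (by simp) _).hasDerivAt
    have t := fun i => isTest_sideCutoff_mul hF (hεp n) (hΦ.pd i)
    have k := fun i => integral_mul_pd hO hu (t i) i
    have i1 : ∀ i, Integrable fun ξ => u ξ * pd i (fun ξ => sideCutoff (ε n) (ξ 0) * pd i Φ ξ) ξ := fun i =>
      hu.continuousOn.integrable_mul_test hO ((t i).pd i).smooth.continuous ((t i).pd i).compact ((t i).pd i).supp
    have i2 : ∀ i, Integrable fun ξ => pd i u ξ * (sideCutoff (ε n) (ξ 0) * pd i Φ ξ) := fun i =>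
      (ContDiffOn.pd hO hu).continuousOn.integrable_mul_test hO (t i).smooth.continuous (t i).compact (t i).supp
    have e1 : ∀ ξ, u ξ * (sideCutoff (ε n) (ξ 0) * Δ Φ ξ + deriv (sideCutoff (ε n)) (ξ 0) * pd 0 Φ ξ)
        = u ξ * pd 0 (fun ξ => sideCutoff (ε n) (ξ 0) * pd 0 Φ ξ) ξ
          + u ξ * pd 1 (fun ξ => sideCutoff (ε n) (ξ 0) * pd 1 Φ ξ) ξ := by
      intro ξ
      have d := fun i => (hΦ.pd i).smooth.differentiable (by simp) ξ
      rw [pd_mul (hz.differentiable (by simp) ξ) (d 0), pd_mul (hz.differentiable (by simp) ξ) (d 1),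
        (hpz ξ).1, (hpz ξ).2, laplacian_fun_eq_pd hΦ.smooth]
      ring
    have e2 : ∀ ξ, sideCutoff (ε n) (ξ 0) * ⟪∇ u ξ, ∇ Φ ξ⟫_ℝ
        = pd 0 u ξ * (sideCutoff (ε n) (ξ 0) * pd 0 Φ ξ) + pd 1 u ξ * (sideCutoff (ε n) (ξ 0) * pd 1 Φ ξ) := by
      intro ξ; rw [inner_gradient]; ring
    simp_rw [e1, e2]
    rw [integral_add (i1 0).integrableOn (i1 1).integrableOn, integral_add (i2 0).integrableOn (i2 1).integrableOn]
    rw [setIntegral_mul_test ((t 0).pd 0) subset_rfl, setIntegral_mul_test ((t 1).pd 1) subset_rfl,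
      setIntegral_mul_test (t 0) subset_rfl, setIntegral_mul_test (t 1) subset_rfl, k, k]
    ring
  have hmem : ∀ᵐ ξ ∂(volume.restrict (halfStrip F)), ξ ∈ halfStrip F := ae_restrict_mem hO.measurableSet
  -- The term with the derivative of the cutoff tends to zero pointwise, and it is dominated because
  -- the normal derivative of `Φ` vanishes on the sides.
  have lim1 : Tendsto (fun n => ∫ ξ in halfStrip F, u ξ * (sideCutoff (ε n) (ξ 0) * Δ Φ ξ + deriv (sideCutoff (ε n)) (ξ 0) * pd 0 Φ ξ))
      atTop (𝓝 (∫ ξ in halfStrip F, u ξ * Δ Φ ξ)) := by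
    set R3 := max R1 R2
    have hz1 : ∀ ξ : Plane, R3 ≤ ξ 1 → pd 0 Φ ξ = 0 := fun ξ h => hR1 ξ ((le_max_left _ _).trans h)
    have hz2 : ∀ ξ : Plane, R3 ≤ ξ 1 → Δ Φ ξ = 0 := fun ξ h => hR2 ξ ((le_max_right _ _).trans h)
    rw [setIntegral_halfStrip_eq_truncation hF (R := R3) fun ξ h => by rw [hz2 ξ h, mul_zero]]
    have e : ∀ n, ∫ ξ in halfStrip F, u ξ * (sideCutoff (ε n) (ξ 0) * Δ Φ ξ + deriv (sideCutoff (ε n)) (ξ 0) * pd 0 Φ ξ)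
        = ∫ ξ in truncation F R3, u ξ * (sideCutoff (ε n) (ξ 0) * Δ Φ ξ + deriv (sideCutoff (ε n)) (ξ 0) * pd 0 Φ ξ) :=
      fun n => setIntegral_halfStrip_eq_truncation hF fun ξ h => by rw [hz1 ξ h, hz2 ξ h]; ring
    simp_rw [e]
    have hfin := isFiniteMeasure_truncation hF R3
    have hui : Integrable u (volume.restrict (truncation F R3)) := (hut R3).integrable (by norm_num)
    have hmt : ∀ᵐ ξ ∂(volume.restrict (truncation F R3)), ξ ∈ truncation F R3 :=
      ae_restrict_mem (isOpen_truncation hF R3).measurableSet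
    refine tendsto_integral_of_dominated_convergence (fun ξ => ‖u ξ‖ * (K + C * (L1 + L2))) ?_ ?_ ?_ ?_
    · intro n
      refine hui.aestronglyMeasurable.mul (Continuous.aestronglyMeasurable ?_)
      exact ((((contDiff_sideCutoff _).comp (contDiff_coord 0)).continuous.mul hΦ.laplacian.smooth.continuous).add
        (((contDiff_sideCutoff _).deriv_real.comp (contDiff_coord 0)).continuous.mul (hΦ.pd 0).smooth.continuous))
    · exact hui.norm.mul_const _
    · intro n
      filter_upwards [hmt] with ξ hξ
      rw [norm_mul]
      refine mul_le_mul_of_nonneg_left ((norm_add_le _ _).trans (add_le_add ?_ ?_)) (norm_nonneg _)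
      · rw [norm_mul]
        calc ‖sideCutoff (ε n) (ξ 0)‖ * ‖Δ Φ ξ‖ ≤ 1 * K :=
              mul_le_mul (abs_sideCutoff_le _ _) (hK ξ) (norm_nonneg _) zero_le_one
          _ = K := one_mul K
      · refine hC _ (hεp n) _ _ _ (by positivity) ?_ ?_ hξ.1.1 hξ.1.2.1
        · refine (hL1 ξ).trans (mul_le_mul_of_nonneg_right (by linarith) (abs_nonneg _))
        · have h3 := hL2 ξ
          have h4 : |-(1 / 2) - ξ 0| = |1 / 2 + ξ 0| := by rw [← abs_neg]; congr 1; ring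
          rw [h4] at h3
          exact h3.trans (mul_le_mul_of_nonneg_right (by linarith) (abs_nonneg _))
    · filter_upwards [hmt] with ξ hξ
      refine tendsto_const_nhds.congr' ?_
      filter_upwards [sideCutoff_eventually hξ.1.1 hξ.1.2.1] with n hn
      simp only [hε]
      rw [hn.1, hn.2]; ring
  have lim2 : Tendsto (fun n => -∫ ξ in halfStrip F, sideCutoff (ε n) (ξ 0) * ⟪∇ u ξ, ∇ Φ ξ⟫_ℝ)
      atTop (𝓝 (-∫ ξ in halfStrip F, ⟪∇ u ξ, ∇ Φ ξ⟫_ℝ)) := by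
    refine Tendsto.neg ?_
    have hi : IntegrableOn (fun ξ => ⟪∇ u ξ, ∇ Φ ξ⟫_ℝ) (halfStrip F) := by
      simp_rw [inner_gradient]
      exact (integrableOn_mul_of_truncation hF (he.memLp_pd 0) (hΦ.pd 0).smooth.continuous (hΦ.pd 0).compact).add
        (integrableOn_mul_of_truncation hF (he.memLp_pd 1) (hΦ.pd 1).smooth.continuous (hΦ.pd 1).compact)
    refine tendsto_integral_of_dominated_convergence (fun ξ => ‖⟪∇ u ξ, ∇ Φ ξ⟫_ℝ‖) ?_ hi.norm ?_ ?_
    · intro n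
      exact ((contDiff_sideCutoff _).comp (contDiff_coord 0)).continuous.aestronglyMeasurable.mul hi.aestronglyMeasurable
    · intro n
      refine Eventually.of_forall fun ξ => ?_
      rw [norm_mul]
      exact mul_le_of_le_one_left (norm_nonneg _) (abs_sideCutoff_le _ _)
    · filter_upwards [hmem] with ξ hξ
      refine tendsto_const_nhds.congr' ?_
      filter_upwards [sideCutoff_eventually hξ.1 hξ.2.1] with n hn
      simp only [hε]
      rw [hn.1, one_mul]
  refine tendsto_nhds_unique lim1 (lim2.congr fun n => (hid n).symm)

/-! ### The smooth even extension and estimates up to the lateral sides -/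

theorem straightStrip_subset_halfStrip {F : ℝ → ℝ} (hF : IsProfile F) : straightStrip ⊆ halfStrip F :=
  fun _ h => ⟨h.1, h.2.1, (hF.neg _).trans h.2.2⟩

theorem straightStrip_subset_tripleStrip : straightStrip ⊆ tripleStrip :=
  fun _ h => ⟨by linarith [h.1], by linarith [h.2.1], h.2.2⟩

theorem integrableOn_straightStrip_of_truncation {F : ℝ → ℝ} (hF : IsProfile F) {w : Plane → ℝ}
    (hw : ∀ R, MemLp w 2 (volume.restrict (truncation F R))) (R : ℝ) :
    IntegrableOn w (straightStrip ∩ {ξ | ξ 1 ∈ Set.Iio R}) := by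
  have := isFiniteMeasure_truncation hF R
  have h1 : IntegrableOn w (truncation F R) := (hw R).integrable (by norm_num)
  exact h1.mono_set (Set.inter_subset_inter_left _ (straightStrip_subset_halfStrip hF))

theorem integral_foldMap_mul {F : ℝ → ℝ} (hF : IsProfile F) {w ψ : Plane → ℝ}
    (hw : ∀ R, MemLp w 2 (volume.restrict (truncation F R))) (hψ : IsTest tripleStrip ψ) :
    ∫ ξ, w (foldMap ξ) * ψ ξ = ∫ ξ in halfStrip F, w ξ * (ψ ξ + ψ (reflAt 1 ξ) + ψ (reflAt (-1) ξ)) := by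
  have hl := locallyIntegrableOn_foldMap (integrableOn_straightStrip_of_truncation hF hw)
  have hi := hl.integrable_mul_test hψ.smooth.continuous hψ.compact hψ.supp
  rw [← setIntegral_mul_test hψ subset_rfl, setIntegral_tripleStrip hi.integrableOn]
  rw [setIntegral_eq_of_subset_of_forall_sdiff_eq_zero (isOpen_halfStrip hF.smooth.continuous).measurableSet
    (straightStrip_subset_halfStrip hF)]
  · refine setIntegral_congr_fun isOpen_straightStrip.measurableSet fun ξ hξ => ?_
    simp only [foldMap_of_mem hξ, foldMap_reflAt_one hξ, foldMap_reflAt_neg_one hξ]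
    ring
  · intro ξ hξ
    have : ξ ∉ upper := fun h => hξ.2 ⟨hξ.1.1, hξ.1.2.1, h⟩
    rw [hψ.foldSum.eq_zero this, mul_zero]

/-- The folded function solves the equation across the lateral sides. Unfolding replaces the test
function by its symmetrised sum, whose normal derivative vanishes there, so Green's formula has no
lateral term and the weak Neumann equation applies. -/
theorem IsNeumannSolution.integral_foldMap {F : ℝ → ℝ} (hF : IsProfile F) {f u ψ : Plane → ℝ}
    (h : IsNeumannSolution F f u) (hψ : IsTest tripleStrip ψ) :
    ∫ ξ, u (foldMap ξ) * Δ ψ ξ = ∫ ξ, f (foldMap ξ) * ψ ξ := by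
  rw [integral_foldMap_mul hF (fun R => (h.energy R).1) hψ.laplacian, integral_foldMap_mul hF h.rhs hψ]
  have h1 := integral_mul_laplacian_of_lateral hF h.smooth h.energy hψ.foldSum
    (fun t => (pd_zero_foldSum_eq_zero hψ t).1) (fun t => (pd_zero_foldSum_eq_zero hψ t).2)
  rw [laplacian_foldSum hψ] at h1
  rw [h1, h.neumann _ hψ.foldSum.smooth hψ.foldSum.compact
    (hψ.foldSum.supp.trans fun ξ hξ => (hF.neg _).trans hξ), neg_neg]

theorem IsNeumannSolution.laplacian_eq {F : ℝ → ℝ} (hF : IsProfile F) {f u : Plane → ℝ}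
    (h : IsNeumannSolution F f u) (hf : ContDiffOn ℝ ∞ f (halfStrip F)) :
    Set.EqOn (Δ u) f (halfStrip F) := by
  have hO := isOpen_halfStrip hF.smooth.continuous
  refine eqOn_of_integral_mul_test hO (ContDiffOn.laplacian_plane hO h.smooth).continuousOn hf.continuousOn
    fun φ hφ => ?_
  have k := h.neumann φ hφ.smooth hφ.compact (hφ.supp.trans fun ξ hξ => hξ.2.2)
  rw [setIntegral_mul_test hφ subset_rfl] at k
  rw [← integral_mul_laplacian hO h.smooth hφ, ← neg_eq_iff_eq_neg.2 k]
  rw [laplacian_fun_eq_pd hφ.smooth]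
  simp_rw [inner_gradient, mul_add]
  have t := fun i => hφ.pd i
  have i1 : ∀ i, Integrable fun ξ => u ξ * pd i (pd i φ) ξ := fun i =>
    h.smooth.continuousOn.integrable_mul_test hO ((t i).pd i).smooth.continuous ((t i).pd i).compact ((t i).pd i).supp
  have i2 : ∀ i, Integrable fun ξ => pd i u ξ * pd i φ ξ := fun i =>
    (ContDiffOn.pd hO h.smooth).continuousOn.integrable_mul_test hO (t i).smooth.continuous (t i).compact (t i).supp
  rw [integral_add (i1 0) (i1 1), integral_add (i2 0).integrableOn (i2 1).integrableOn,
    setIntegral_mul_test (t 0) subset_rfl, setIntegral_mul_test (t 1) subset_rfl,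
    integral_mul_pd hO h.smooth (t 0), integral_mul_pd hO h.smooth (t 1)]
  ring

/-- The smooth even extension of a solution across the lateral sides. -/
noncomputable def evenExt (u : Plane → ℝ) : Plane → ℝ := weylRep fun ξ => u (foldMap ξ)

section

variable {F : ℝ → ℝ} {f u : Plane → ℝ}

/-- The folded equation is used for `u` tested with Δφ, then for the source, which is itself a
Neumann solution with source 0. -/
theorem IsNeumannSolution.weaklyBiharmonicOn (hF : IsProfile F)
    (h : IsNeumannSolution F f u) (hf : IsNeumannSolution F (fun _ => 0) f) :
    WeaklyBiharmonicOn tripleStrip fun ξ => u (foldMap ξ) where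
  locInt := locallyIntegrableOn_foldMap (integrableOn_straightStrip_of_truncation hF fun R => (h.energy R).1)
  eq φ hφ := by
    rw [h.integral_foldMap hF hφ.laplacian, hf.integral_foldMap hF hφ]
    simp

theorem IsNeumannSolution.contDiffOn_evenExt (hF : IsProfile F)
    (h : IsNeumannSolution F f u) (hf : IsNeumannSolution F (fun _ => 0) f) :
    ContDiffOn ℝ ∞ (evenExt u) tripleStrip :=
  (h.weaklyBiharmonicOn hF hf).contDiffOn isOpen_tripleStrip

theorem IsNeumannSolution.evenExt_eq (hF : IsProfile F)
    (h : IsNeumannSolution F f u) (hf : IsNeumannSolution F (fun _ => 0) f) :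
    Set.EqOn (evenExt u) u straightStrip := by
  have h1 := (h.weaklyBiharmonicOn hF hf).ae_eq isOpen_tripleStrip
  refine Measure.eqOn_open_of_ae_eq (μ := volume) ?_ isOpen_straightStrip
    ((h.contDiffOn_evenExt hF hf).continuousOn.mono straightStrip_subset_tripleStrip)
    (h.smooth.continuousOn.mono (straightStrip_subset_halfStrip hF))
  rw [EventuallyEq, ae_restrict_iff' isOpen_straightStrip.measurableSet]
  filter_upwards [h1] with ξ hξ hm
  rw [evenExt, hξ (straightStrip_subset_tripleStrip hm), foldMap_of_mem hm]

theorem mapsTo_reflAt {c : ℝ} (hc : c = 1 ∨ c = -1) : Set.MapsTo (reflAt c) straightStrip tripleStrip := by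
  intro ξ hξ
  have h1 := hξ.1
  have h2 := hξ.2.1
  have h3 := hξ.2.2
  refine ⟨?_, ?_, ?_⟩ <;> rcases hc with rfl | rfl <;> simp <;> linarith

theorem IsNeumannSolution.evenExt_reflAt_eq (hF : IsProfile F)
    (h : IsNeumannSolution F f u) (hf : IsNeumannSolution F (fun _ => 0) f) {c : ℝ} (hc : c = 1 ∨ c = -1) :
    Set.EqOn (fun ξ => evenExt u (reflAt c ξ)) u straightStrip := by
  have h1 := (measurePreserving_reflAt c).quasiMeasurePreserving.ae
    ((h.weaklyBiharmonicOn hF hf).ae_eq isOpen_tripleStrip)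
  refine Measure.eqOn_open_of_ae_eq (μ := volume) ?_ isOpen_straightStrip
    ((h.contDiffOn_evenExt hF hf).continuousOn.comp (continuous_reflAt c).continuousOn (mapsTo_reflAt hc))
    (h.smooth.continuousOn.mono (straightStrip_subset_halfStrip hF))
  rw [EventuallyEq, ae_restrict_iff' isOpen_straightStrip.measurableSet]
  filter_upwards [h1] with ξ hξ hm
  rw [evenExt, hξ (mapsTo_reflAt hc hm)]
  rcases hc with rfl | rfl
  · rw [foldMap_reflAt_one hm]
  · rw [foldMap_reflAt_neg_one hm]

theorem deriv_eq_zero_of_symm {g : ℝ → ℝ} {c δ : ℝ} (hδ : 0 < δ)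
    (h : ∀ x, |x - c / 2| < δ → g (c - x) = g x) : deriv g (c / 2) = 0 := by
  have e : (fun x => g (c - x)) =ᶠ[𝓝 (c / 2)] g := by
    filter_upwards [Metric.ball_mem_nhds (c / 2) hδ] with x hx
    exact h x (by simpa [Real.dist_eq] using hx)
  have h1 := e.deriv_eq
  rw [deriv_comp_const_sub] at h1
  have : c - c / 2 = c / 2 := by ring
  rw [this] at h1
  linarith

/-- The weak Neumann condition becomes classical: the extension is smooth and even about the side,
so its normal derivative vanishes there. -/
theorem IsNeumannSolution.pd_zero_evenExt (hF : IsProfile F)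
    (h : IsNeumannSolution F f u) (hf : IsNeumannSolution F (fun _ => 0) f) {c : ℝ} (hc : c = 1 ∨ c = -1)
    {t : ℝ} (ht : 0 < t) : pd 0 (evenExt u) !₂[c / 2, t] = 0 := by
  have hmem : ∀ x, |x| < 3 / 2 → (!₂[x, t] : Plane) ∈ tripleStrip := fun x hx => by
    rw [abs_lt] at hx; exact ⟨by simpa using hx.1, by simpa using hx.2, by simpa using ht⟩
  have hmem' : ∀ x, |x| < 1 / 2 → (!₂[x, t] : Plane) ∈ straightStrip := fun x hx => by
    rw [abs_lt] at hx; exact ⟨by simpa using hx.1, by simpa using hx.2, by simpa using ht⟩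
  have hc2 : |c / 2| < 3 / 2 := by rcases hc with rfl | rfl <;> norm_num [abs_div]
  have hs := (h.contDiffOn_evenExt hF hf).contDiffAt (isOpen_tripleStrip.mem_nhds (hmem _ hc2))
  have hd := hasDerivAt_horizontal (f := evenExt u) (x := c / 2) (t := t) (hs.differentiableAt (by simp))
  rw [← hd.deriv]
  have key : ∀ x, |x| < 1 / 2 → evenExt u !₂[c - x, t] = evenExt u !₂[x, t] := by
    intro x hx
    have e1 := h.evenExt_eq hF hf (hmem' x hx)
    have e2 := h.evenExt_reflAt_eq hF hf hc (hmem' x hx)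
    rw [e1, ← e2]
    simp [reflAt]
  refine deriv_eq_zero_of_symm (g := fun x => evenExt u !₂[x, t]) one_pos fun x hx => ?_
  -- Evenness is known for points with |x| < 1/2. If |x| > 1/2, the reflected point c - x lies in
  -- that range; if |x| = 1/2, then x = c/2 is its own reflection, since x = -c/2 is at distance 1
  -- from c/2.
  rcases lt_trichotomy (|x|) (1 / 2) with h' | h' | h'
  · exact key x h'
  · rcases abs_eq (by norm_num : (0:ℝ) ≤ 1 / 2) |>.1 h' with rfl | rfl <;> rcases hc with rfl | rfl <;>
      first | (norm_num; done) | norm_num [abs_lt] at hx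
  · have : |c - x| < 1 / 2 := by
      rw [lt_abs] at h'
      rw [abs_lt] at hx ⊢
      rcases hc with rfl | rfl <;> rcases h' with h' | h' <;> constructor <;> linarith
    have := key _ this
    rw [sub_sub_cancel] at this
    exact this.symm

theorem IsNeumannSolution.laplacian_evenExt (hF : IsProfile F)
    (h : IsNeumannSolution F f u) (hf : IsNeumannSolution F (fun _ => 0) f) :
    Set.EqOn (Δ (evenExt u)) f straightStrip := by
  intro ξ hξ
  have : evenExt u =ᶠ[𝓝 ξ] u := (h.evenExt_eq hF hf).eventuallyEq_of_mem (isOpen_straightStrip.mem_nhds hξ)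
  rw [(InnerProductSpace.laplacian_congr_nhds this).eq_of_nhds]
  exact h.laplacian_eq hF hf.smooth (straightStrip_subset_halfStrip hF hξ)

end

/-- Since r < 1, balls centred in the strip stay in the triple strip, so interior estimates for the
extension hold up to the sides. Folding the ball back into a horizontal band costs the factor 3, one
for each copy. -/
theorem norm_iteratedFDeriv_le_of_isNeumannSolution (k : ℕ) {r : ℝ} (hr : 0 < r) (hr1 : r < 1) : ∃ C, 0 ≤ C ∧
    ∀ F f u, IsProfile F → IsNeumannSolution F f u → IsNeumannSolution F (fun _ => 0) f →
      ∀ ξ ∈ straightStrip, r < ξ 1 → ‖iteratedFDeriv ℝ k u ξ‖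
        ≤ C * ∫ η in straightStrip ∩ {η | η 1 ∈ Set.Icc (ξ 1 - r) (ξ 1 + r)}, ‖u η‖ := by
  obtain ⟨C, hC0, hC⟩ := norm_iteratedFDeriv_weylRep_le k hr
  refine ⟨C * 3, by positivity, fun F f u hF h hf ξ hξ hξr => ?_⟩
  have e : evenExt u =ᶠ[𝓝 ξ] u := (h.evenExt_eq hF hf).eventuallyEq_of_mem (isOpen_straightStrip.mem_nhds hξ)
  rw [← (e.iteratedFDeriv ℝ k).eq_of_nhds]
  have hsub : Metric.closedBall ξ r ⊆ tripleStrip ∩ {η | η 1 ∈ Set.Icc (ξ 1 - r) (ξ 1 + r)} := by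
    intro η hη
    have hn : ∀ i, |η i - ξ i| ≤ r := fun i => by
      have h1 := PiLp.norm_apply_le (η - ξ) i
      rw [Metric.mem_closedBall, dist_eq_norm] at hη
      exact h1.trans hη
    have h0 := abs_le.1 (hn 0)
    have h1 := abs_le.1 (hn 1)
    exact ⟨⟨by linarith [hξ.1], by linarith [hξ.2.1], by linarith⟩, by linarith, by linarith⟩
  refine (hC tripleStrip _ (h.weaklyBiharmonicOn hF hf) ξ (hsub.trans Set.inter_subset_left)).trans ?_
  rw [mul_assoc]
  refine mul_le_mul_of_nonneg_left ?_ hC0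
  have hi : IntegrableOn (fun ξ => ‖u ξ‖) (straightStrip ∩ {η | η 1 ∈ Set.Icc (ξ 1 - r) (ξ 1 + r)}) :=
    ((integrableOn_straightStrip_of_truncation hF (fun R => (h.energy R).1) (ξ 1 + r + 1)).mono_set
      (Set.inter_subset_inter_right _ fun η hη => by
        have : η 1 ≤ ξ 1 + r := hη.2
        show η 1 < _
        linarith)).norm
  rw [← setIntegral_foldMap measurableSet_Icc hi]
  exact setIntegral_mono_set (integrableOn_foldMap measurableSet_Icc hi)
    (Eventually.of_forall fun _ => norm_nonneg _) hsub.eventuallyLE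

/-! ### A differential inequality and the Poincaré–Wirtinger inequality -/

theorem monotoneOn_Ioi_of_hasDerivAt {g g' : ℝ → ℝ} {δ : ℝ} (hg : ∀ t, δ < t → HasDerivAt g (g' t) t)
    (h : ∀ t, δ < t → 0 ≤ g' t) : MonotoneOn g (Set.Ioi δ) := by
  refine monotoneOn_of_deriv_nonneg (convex_Ioi δ) (fun t ht => (hg t ht).continuousAt.continuousWithinAt) ?_ ?_
  · rw [interior_Ioi]
    exact fun t ht => (hg t ht).differentiableAt.differentiableWithinAt
  · rw [interior_Ioi]
    exact fun t ht => by rw [(hg t ht).deriv]; exact h t ht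

/-- A nonnegative function satisfying `N'' ≥ N - K e^{-ct}` either grows at least like `e^t` or
decays at least like `e^{-ct}`. -/
theorem exp_growth_or_decay_at {N N1 N2 : ℝ → ℝ} {c δ K : ℝ} (hc : 0 < c) (hc' : c ≤ 1 / 2)
    (hK : 0 ≤ K)
    (h1 : ∀ t, δ < t → HasDerivAt N (N1 t) t) (h2 : ∀ t, δ < t → HasDerivAt N1 (N2 t) t)
    (h : ∀ t, δ < t → N t - K * Real.exp (-c * t) ≤ N2 t) :
    (∃ m, 0 < m ∧ ∃ T, ∀ t, T < t → m * Real.exp t ≤ N t) ∨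
    (∀ t1, δ < t1 → ∃ K', ∀ t, t1 < t → N t ≤ K' * Real.exp (-c * t)) := by
  -- P = N - κ e^{-ct} satisfies P'' ≥ P as soon as κ(1 - c²) ≥ K, which κ = 2K achieves because c ≤
  -- 1/2.
  set κ := 2 * K with hκ
  set P : ℝ → ℝ := fun t => N t - κ * Real.exp (-c * t) with hP
  set P1 : ℝ → ℝ := fun t => N1 t + κ * c * Real.exp (-c * t) with hP1
  set P2 : ℝ → ℝ := fun t => N2 t - κ * c ^ 2 * Real.exp (-c * t) with hP2
  have hexp : ∀ a t, HasDerivAt (fun t => Real.exp (a * t)) (a * Real.exp (a * t)) t := fun a t => by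
    have := ((hasDerivAt_id t).const_mul a).exp
    simpa [mul_comm] using this
  have hex := hexp (-c)
  have d1 : ∀ t, δ < t → HasDerivAt P (P1 t) t := fun t ht => by
    exact ((h1 t ht).sub ((hex t).const_mul κ)).congr_deriv (by simp only [hP1]; ring)
  have d2 : ∀ t, δ < t → HasDerivAt P1 (P2 t) t := fun t ht => by
    exact ((h2 t ht).add ((hex t).const_mul (κ * c))).congr_deriv (by simp only [hP2]; ring)
  have hP0 : ∀ t, δ < t → P t ≤ P2 t := fun t ht => by
    have := h t ht
    have e := Real.exp_pos (-c * t)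
    have hc2 : c ^ 2 ≤ 1 / 4 := by nlinarith
    have : K ≤ κ * (1 - c ^ 2) := by
      have := mul_le_mul_of_nonneg_left hc2 hK
      simp only [hκ]; linarith
    have := mul_le_mul_of_nonneg_right this e.le
    simp only [hP, hP2]
    nlinarith
  -- Factorisation of d²/dt² - 1 as (d/dt - 1)(d/dt + 1), with integrating factor e^{-t}.
  have hM : MonotoneOn (fun t => (P1 t + P t) * Real.exp (-1 * t)) (Set.Ioi δ) := by
    refine monotoneOn_Ioi_of_hasDerivAt (g' := fun t => (P2 t - P t) * Real.exp (-1 * t)) (fun t ht => ?_)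
      fun t ht => mul_nonneg (sub_nonneg.2 (hP0 t ht)) (Real.exp_pos _).le
    exact (((d2 t ht).add (d1 t ht)).mul (hexp (-1) t)).congr_deriv (by simp only [Pi.add_apply]; ring)
  have dE : ∀ t, δ < t → HasDerivAt (fun t => P t * Real.exp t) ((P1 t + P t) * Real.exp t) t := fun t ht => by
    exact ((d1 t ht).mul (Real.hasDerivAt_exp t)).congr_deriv (by ring)
  -- If P' + P is positive somewhere, it then grows like e^t and carries P along. Otherwise P e^t is
  -- nonincreasing, and P is bounded above by a multiple of e^{-t}.
  by_cases hcase : ∃ t0, δ < t0 ∧ 0 < P1 t0 + P t0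
  · left
    obtain ⟨t0, ht0, hpos⟩ := hcase
    set m := (P1 t0 + P t0) * Real.exp (-1 * t0) with hm
    have hm0 : 0 < m := mul_pos hpos (Real.exp_pos _)
    have hge : ∀ t, t0 < t → m * Real.exp t ≤ P1 t + P t := fun t ht => by
      have := hM ht0 (ht0.trans ht) ht.le
      have := mul_le_mul_of_nonneg_right this (Real.exp_pos t).le
      rwa [mul_assoc _ (Real.exp (-1 * t)), ← Real.exp_add, neg_one_mul, neg_add_cancel, Real.exp_zero, mul_one] at this
    have hG : MonotoneOn (fun t => P t * Real.exp t - m / 2 * Real.exp (2 * t)) (Set.Ioi t0) := by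
      refine monotoneOn_Ioi_of_hasDerivAt
        (g' := fun t => (P1 t + P t) * Real.exp t - m * Real.exp (2 * t)) (fun t ht => ?_) fun t ht => ?_
      · exact ((dE t (ht0.trans ht)).sub ((hexp 2 t).const_mul (m / 2))).congr_deriv (by ring)
      · have := mul_le_mul_of_nonneg_right (hge t ht) (Real.exp_pos t).le
        rw [two_mul, Real.exp_add]
        nlinarith
    set C := P (t0 + 1) * Real.exp (t0 + 1) - m / 2 * Real.exp (2 * (t0 + 1)) with hC
    have hlarge : ∀ᶠ t in atTop, -C ≤ m / 4 * Real.exp t := by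
      have : Tendsto (fun t => m / 4 * Real.exp t) atTop atTop :=
        Real.tendsto_exp_atTop.const_mul_atTop (by positivity)
      exact this.eventually_ge_atTop (-C)
    obtain ⟨T, hT⟩ := eventually_atTop.1 hlarge
    refine ⟨m / 4, by positivity, max (max T 0) (t0 + 1), fun t ht => ?_⟩
    simp only [max_lt_iff] at ht
    have a1 := hG (a := t0 + 1) (b := t) (by simp) (by simp only [Set.mem_Ioi]; linarith) ht.2.le
    have a2 := hT t ht.1.1.le
    have e1 : 1 ≤ Real.exp t := Real.one_le_exp ht.1.2.le
    have a3 : P t ≤ N t := by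
      have := Real.exp_pos (-c * t)
      simp only [hP]; nlinarith
    refine le_trans ?_ a3
    have e2 : Real.exp (2 * t) = Real.exp t * Real.exp t := by rw [two_mul, Real.exp_add]
    simp only at a1
    rw [e2] at a1
    refine le_of_mul_le_mul_right ?_ (Real.exp_pos t)
    nlinarith [mul_le_mul_of_nonneg_left e1 (by positivity : 0 ≤ m / 4 * Real.exp t)]
  · right
    push Not at hcase
    intro t1 ht1
    have hG : MonotoneOn (fun t => -(P t * Real.exp t)) (Set.Ioi δ) :=
      monotoneOn_Ioi_of_hasDerivAt (fun t ht => (dE t ht).neg) fun t ht => by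
        have := mul_nonneg (sub_nonneg.2 (hcase t ht)) (Real.exp_pos t).le
        linarith
    refine ⟨κ + |P t1 * Real.exp t1| * Real.exp (-(1 - c) * t1), fun t ht => ?_⟩
    have a1 := hG ht1 (ht1.trans ht) ht.le
    simp only [neg_le_neg_iff] at a1
    have a2 : P t ≤ |P t1 * Real.exp t1| * Real.exp (-t) := by
      have := mul_le_mul_of_nonneg_right (a1.trans (le_abs_self _)) (Real.exp_pos (-t)).le
      rwa [mul_assoc, ← Real.exp_add, add_neg_cancel, Real.exp_zero, mul_one] at this
    have a3 : Real.exp (-t) ≤ Real.exp (-(1 - c) * t1) * Real.exp (-c * t) := by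
      rw [← Real.exp_add]
      refine Real.exp_le_exp.2 ?_
      nlinarith
    have a4 := mul_le_mul_of_nonneg_left a3 (abs_nonneg (P t1 * Real.exp t1))
    have a5 : N t = P t + κ * Real.exp (-c * t) := by simp [hP]
    rw [a5]
    linarith

/-- The constant `K` depends on `δ`, while growth concerns only large t; the case distinction on
growth is therefore made before `δ` is fixed. Passing from δ/2 to δ supplies the margin needed by
the decay alternative. -/
theorem exp_growth_or_decay {N N1 N2 : ℝ → ℝ} {c : ℝ} (hc : 0 < c) (hc' : c ≤ 1 / 2)
    (h1 : ∀ t, 0 < t → HasDerivAt N (N1 t) t) (h2 : ∀ t, 0 < t → HasDerivAt N1 (N2 t) t)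
    (h : ∀ δ, 0 < δ → ∃ K, ∀ t, δ < t → N t - K * Real.exp (-c * t) ≤ N2 t) :
    (∃ m, 0 < m ∧ ∃ T, ∀ t, T < t → m * Real.exp t ≤ N t) ∨
    (∀ δ, 0 < δ → ∃ K', ∀ t, δ < t → N t ≤ K' * Real.exp (-c * t)) := by
  by_cases hg : ∃ m, 0 < m ∧ ∃ T, ∀ t, T < t → m * Real.exp t ≤ N t
  · exact Or.inl hg
  refine Or.inr fun δ hδ => ?_
  obtain ⟨K, hK⟩ := h (δ / 2) (half_pos hδ)
  refine (exp_growth_or_decay_at (K := max K 0) hc hc' (le_max_right _ _) (fun t ht => h1 t ((half_pos hδ).trans ht))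
    (fun t ht => h2 t ((half_pos hδ).trans ht)) fun t ht => ?_).resolve_left hg δ (half_lt_self hδ)
  have := mul_le_mul_of_nonneg_right (le_max_left K 0) (Real.exp_pos (-c * t)).le
  linarith [hK t ht]

/-- Poincaré–Wirtinger inequality on the unit interval. -/
theorem integral_sq_le_integral_deriv_sq {w w' : ℝ → ℝ} {a : ℝ}
    (hw : ∀ x ∈ Set.Icc a (a + 1), HasDerivAt w (w' x) x) (hc : ContinuousOn w' (Set.Icc a (a + 1)))
    (h0 : ∫ x in a..(a + 1), w x = 0) : ∫ x in a..(a + 1), w x ^ 2 ≤ ∫ x in a..(a + 1), w' x ^ 2 := by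
  have hle : a ≤ a + 1 := by linarith
  have hu : Set.uIcc a (a + 1) = Set.Icc a (a + 1) := Set.uIcc_of_le hle
  have hwc : ContinuousOn w (Set.Icc a (a + 1)) := fun x hx => (hw x hx).continuousAt.continuousWithinAt
  have ii : ∀ {g : ℝ → ℝ}, ContinuousOn g (Set.Icc a (a + 1)) → IntervalIntegrable g volume a (a + 1) :=
    fun hg => (hg.mono hu.subset).intervalIntegrable
  -- A continuous function of mean zero has a zero `y`; integrating from `y` gives |w| ≤ ∫|w'|. The
  -- resulting constant 1 is not sharp but suffices.
  obtain ⟨y, hy, hy0⟩ : ∃ y ∈ Set.Icc a (a + 1), w y = 0 := by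
    by_contra! hne
    have hpos : (∀ x ∈ Set.Icc a (a + 1), 0 < w x) ∨ (∀ x ∈ Set.Icc a (a + 1), 0 < -w x) := by
      by_contra! hcon
      obtain ⟨⟨x, hx, hx0⟩, z, hz, hz0⟩ := hcon
      have := isPreconnected_Icc.intermediate_value hx hz hwc
      obtain ⟨y, hy, hy0⟩ := this ⟨hx0, by linarith⟩
      exact hne y hy hy0
    rcases hpos with hp | hp
    · have := intervalIntegral.intervalIntegral_pos_of_pos_on (ii hwc) (fun x hx => hp x (Set.Ioo_subset_Icc_self hx)) (by linarith)
      linarith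
    · have := intervalIntegral.intervalIntegral_pos_of_pos_on (ii hwc.neg) (fun x hx => hp x (Set.Ioo_subset_Icc_self hx)) (by linarith)
      simp only [Pi.neg_apply, intervalIntegral.integral_neg] at this
      linarith
  set m := ∫ x in a..(a + 1), |w' x| with hm
  have hm0 : 0 ≤ m := intervalIntegral.integral_nonneg hle fun _ _ => abs_nonneg _
  have hb : ∀ x ∈ Set.Icc a (a + 1), |w x| ≤ m := by
    intro x hx
    have hsub : Set.uIcc y x ⊆ Set.Icc a (a + 1) := Set.ordConnected_Icc.uIcc_subset hy hx
    have h1 := intervalIntegral.integral_eq_sub_of_hasDerivAt (fun z hz => hw z (hsub hz)) ((hc.mono hsub).intervalIntegrable)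
    rw [hy0, sub_zero] at h1
    rw [← h1, ← Real.norm_eq_abs]
    refine intervalIntegral.norm_integral_le_abs_integral_norm.trans ?_
    refine (intervalIntegral.abs_integral_mono_interval (c := a) (d := a + 1) ?_
      (Eventually.of_forall fun _ => norm_nonneg _) (ii hc.norm)).trans ?_
    · rw [Set.uIoc_of_le hle]
      intro z hz
      rcases le_total y x with hyx | hyx
      · rw [Set.uIoc_of_le hyx] at hz
        exact ⟨hy.1.trans_lt hz.1, hz.2.trans hx.2⟩
      · rw [Set.uIoc_of_ge hyx] at hz
        exact ⟨hx.1.trans_lt hz.1, hz.2.trans hy.2⟩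
    · exact (abs_of_nonneg hm0).le
  have h2 : ∫ x in a..(a + 1), w x ^ 2 ≤ m ^ 2 := by
    have := intervalIntegral.integral_mono_on hle (ii (hwc.pow 2)) (ii (continuousOn_const (c := m ^ 2)))
      fun x hx => by rw [Pi.pow_apply, ← sq_abs]; exact pow_le_pow_left₀ (abs_nonneg _) (hb x hx) 2
    simpa using this
  -- Cauchy–Schwarz on an interval of length one: m² ≤ ∫ w'².
  have h3 : 0 ≤ ∫ x in a..(a + 1), (w' x ^ 2 - 2 * m * |w' x| + m ^ 2) := by
    refine intervalIntegral.integral_nonneg hle fun x _ => ?_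
    rw [← sq_abs (w' x)]
    nlinarith [sq_nonneg (|w' x| - m)]
  have i1 : IntervalIntegrable (fun x => w' x ^ 2) volume a (a + 1) := ii (hc.pow 2)
  have i2 : IntervalIntegrable (fun x => 2 * m * |w' x|) volume a (a + 1) := (ii hc.abs).const_mul _
  rw [intervalIntegral.integral_add (i1.sub i2) (by simp), intervalIntegral.integral_sub i1 i2,
    intervalIntegral.integral_const_mul, ← hm] at h3
  simp only [intervalIntegral.integral_const, add_sub_cancel_left, smul_eq_mul, one_mul] at h3
  nlinarith

/-! ### Integrals over horizontal sections -/

/-- The integral of a function over the horizontal section of the strip at height `t`. -/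
noncomputable def sliceInt (G : Plane → ℝ) (t : ℝ) : ℝ := ∫ x in (-(1 / 2) : ℝ)..(1 / 2), G !₂[x, t]

theorem slice_mem_tripleStrip {x t : ℝ} (hx : x ∈ Set.Icc (-(1 / 2) : ℝ) (1 / 2)) (ht : 0 < t) :
    (!₂[x, t] : Plane) ∈ tripleStrip := by
  have h1 := hx.1
  have h2 := hx.2
  exact ⟨by simp; linarith, by simp; linarith, by simpa using ht⟩

theorem ContinuousOn.slice {G : Plane → ℝ} (hG : ContinuousOn G tripleStrip) {t : ℝ} (ht : 0 < t) :
    ContinuousOn (fun x : ℝ => G !₂[x, t]) (Set.Icc (-(1 / 2)) (1 / 2)) :=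
  hG.comp (continuous_plane.comp (f := fun x : ℝ => (x, t)) (by fun_prop)).continuousOn
    fun _ hx => slice_mem_tripleStrip hx ht

theorem ContinuousOn.slice_intervalIntegrable {G : Plane → ℝ} (hG : ContinuousOn G tripleStrip) {t : ℝ}
    (ht : 0 < t) : IntervalIntegrable (fun x : ℝ => G !₂[x, t]) volume (-(1 / 2)) (1 / 2) :=
  ((hG.slice ht).mono (Set.uIcc_of_le (by norm_num)).subset).intervalIntegrable

theorem sliceInt_congr {G H : Plane → ℝ} (h : Set.EqOn G H straightStrip) {t : ℝ} (ht : 0 < t) :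
    sliceInt G t = sliceInt H t := by
  have hle : (-(1 / 2) : ℝ) ≤ 1 / 2 := by norm_num
  rw [sliceInt, sliceInt, intervalIntegral.integral_of_le hle, intervalIntegral.integral_of_le hle,
    integral_Ioc_eq_integral_Ioo, integral_Ioc_eq_integral_Ioo]
  refine setIntegral_congr_fun measurableSet_Ioo fun x hx => h ⟨?_, ?_, ?_⟩
  · simpa using hx.1
  · simpa using hx.2
  · simpa using ht

theorem sliceInt_mono {G H : Plane → ℝ} (hG : ContinuousOn G tripleStrip) (hH : ContinuousOn H tripleStrip)
    {t : ℝ} (ht : 0 < t) (h : ∀ ξ ∈ tripleStrip, G ξ ≤ H ξ) : sliceInt G t ≤ sliceInt H t :=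
  intervalIntegral.integral_mono_on (by norm_num) (hG.slice_intervalIntegrable ht)
    (hH.slice_intervalIntegrable ht) fun _ hx => h _ (slice_mem_tripleStrip hx ht)

theorem sliceInt_add {G H : Plane → ℝ} (hG : ContinuousOn G tripleStrip) (hH : ContinuousOn H tripleStrip)
    {t : ℝ} (ht : 0 < t) : sliceInt (fun ξ => G ξ + H ξ) t = sliceInt G t + sliceInt H t :=
  intervalIntegral.integral_add (hG.slice_intervalIntegrable ht) (hH.slice_intervalIntegrable ht)

theorem sliceInt_sub {G H : Plane → ℝ} (hG : ContinuousOn G tripleStrip) (hH : ContinuousOn H tripleStrip)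
    {t : ℝ} (ht : 0 < t) : sliceInt (fun ξ => G ξ - H ξ) t = sliceInt G t - sliceInt H t :=
  intervalIntegral.integral_sub (hG.slice_intervalIntegrable ht) (hH.slice_intervalIntegrable ht)

theorem sliceInt_const_mul (c : ℝ) (G : Plane → ℝ) (t : ℝ) :
    sliceInt (fun ξ => c * G ξ) t = c * sliceInt G t :=
  intervalIntegral.integral_const_mul _ _

theorem sliceInt_fun_coord (q : ℝ → ℝ) (t : ℝ) : sliceInt (fun ξ => q (ξ 1)) t = q t := by
  rw [sliceInt]; norm_num

theorem hasDerivAt_sliceInt {G : Plane → ℝ} (hG : ContDiffOn ℝ ∞ G tripleStrip) {t : ℝ} (ht : 0 < t) :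
    HasDerivAt (sliceInt G) (sliceInt (pd 1 G) t) t := by
  have hG1 := (ContDiffOn.pd (i := 1) isOpen_tripleStrip hG).continuousOn
  have hIoc : Set.uIoc (-(1 / 2) : ℝ) (1 / 2) = Set.Ioc (-(1 / 2)) (1 / 2) := Set.uIoc_of_le (by norm_num)
  obtain ⟨C, hC⟩ := ((isCompact_Icc (a := (-(1 / 2) : ℝ)) (b := 1 / 2)).prod
    (isCompact_Icc (a := t / 2) (b := 2 * t))).exists_bound_of_continuousOn
    (f := fun p : ℝ × ℝ => pd 1 G !₂[p.1, p.2]) (hG1.comp continuous_plane.continuousOn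
      fun p hp => slice_mem_tripleStrip hp.1 ((half_pos ht).trans_le hp.2.1))
  refine (intervalIntegral.hasDerivAt_integral_of_dominated_loc_of_deriv_le
    (F := fun t x => G !₂[x, t]) (F' := fun t x => pd 1 G !₂[x, t]) (bound := fun _ => C)
    (Icc_mem_nhds (half_lt_self ht) (by linarith : t < 2 * t)) ?_
    (hG.continuousOn.slice_intervalIntegrable ht) ?_ ?_ (by simp) ?_).2
  · filter_upwards [lt_mem_nhds ht] with s hs
    have := hG.continuousOn.slice_intervalIntegrable hs
    rw [intervalIntegrable_iff] at this
    exact this.aestronglyMeasurable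
  · have := hG1.slice_intervalIntegrable ht
    rw [intervalIntegrable_iff] at this
    exact this.aestronglyMeasurable
  · refine Eventually.of_forall fun x hx s hs => hC (x, s) ⟨?_, hs⟩
    rw [hIoc] at hx
    exact Set.Ioc_subset_Icc_self hx
  · refine Eventually.of_forall fun x hx s hs => hasDerivAt_vertical ?_
    rw [hIoc] at hx
    exact (hG.contDiffAt (isOpen_tripleStrip.mem_nhds (slice_mem_tripleStrip (Set.Ioc_subset_Icc_self hx)
      ((half_pos ht).trans_le hs.1)))).differentiableAt (by simp)

theorem sliceInt_pd_zero {G : Plane → ℝ} (hG : ContDiffOn ℝ ∞ G tripleStrip) {t : ℝ} (ht : 0 < t) :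
    sliceInt (pd 0 G) t = G !₂[1 / 2, t] - G !₂[-(1 / 2), t] := by
  refine intervalIntegral.integral_eq_sub_of_hasDerivAt (f := fun x => G !₂[x, t]) (fun x hx => ?_)
    ((ContDiffOn.pd isOpen_tripleStrip hG).continuousOn.slice_intervalIntegrable ht)
  rw [Set.uIcc_of_le (by norm_num)] at hx
  exact hasDerivAt_horizontal ((hG.contDiffAt (isOpen_tripleStrip.mem_nhds
    (slice_mem_tripleStrip hx ht))).differentiableAt (by simp))

theorem eq_affine_of_hasDerivAt {A A1 : ℝ → ℝ} (h1 : ∀ t, 0 < t → HasDerivAt A (A1 t) t)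
    (h2 : ∀ t, 0 < t → HasDerivAt A1 0 t) : ∃ a b, ∀ t, 0 < t → A t = a + b * t := by
  have hconst : ∀ {g : ℝ → ℝ}, (∀ t, 0 < t → HasDerivAt g 0 t) → ∀ t, 0 < t → g t = g 1 := by
    intro g hg t ht
    exact isOpen_Ioi.is_const_of_deriv_eq_zero (convex_Ioi 0).isPreconnected
      (fun s hs => (hg s hs).differentiableAt.differentiableWithinAt) (fun s hs => (hg s hs).deriv) ht
      (Set.mem_Ioi.2 one_pos)
  refine ⟨A 1 - A1 1, A1 1, fun t ht => ?_⟩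
  have := hconst (g := fun t => A t - A1 1 * t) (fun s hs => ?_) t ht
  · linarith
  · refine ((h1 s hs).sub ((hasDerivAt_id s).const_mul (A1 1))).congr_deriv ?_
    rw [hconst h2 s hs]; ring

section

variable {W : Plane → ℝ}

/-- The second derivative of the section mean is the mean of ΔW minus the mean of the second
horizontal derivative. The latter is a difference of normal derivatives on the sides, hence zero. -/
theorem sliceInt_affine (hW : ContDiffOn ℝ ∞ W tripleStrip)
    (h1 : ∀ t, 0 < t → pd 0 W !₂[1 / 2, t] = 0) (h2 : ∀ t, 0 < t → pd 0 W !₂[-(1 / 2), t] = 0)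
    (hΔ : ∀ t, 0 < t → sliceInt (Δ W) t = 0) : ∃ a b, ∀ t, 0 < t → sliceInt W t = a + b * t := by
  have hO := isOpen_tripleStrip
  have p := fun i => ContDiffOn.pd (i := i) hO hW
  have pp := fun i => ContDiffOn.pd (i := i) hO (p i)
  refine eq_affine_of_hasDerivAt (fun t ht => hasDerivAt_sliceInt hW ht) fun t ht => ?_
  refine (hasDerivAt_sliceInt (p 1) ht).congr_deriv ?_
  have e := sliceInt_add (pp 0).continuousOn (pp 1).continuousOn ht
  rw [sliceInt_pd_zero (p 0) ht, h1 t ht, h2 t ht, sub_zero, zero_add] at e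
  rw [← e, ← hΔ t ht]
  exact sliceInt_congr (fun ξ hξ => (laplacian_eq_pd ((hW.contDiffAt (hO.mem_nhds
    (straightStrip_subset_tripleStrip hξ))).of_le (by norm_cast))).symm) ht

/-- With N the section integral of W², integration by parts in ξ₁ gives N'' = 2∫(|∇W|² + WΔW).
Wirtinger bounds the horizontal part below by 2N, and 2WΔW ≥ -W² - (ΔW)² costs one N. What is left
is N'' ≥ N - ∫(ΔW)². -/
theorem slice_growth_or_decay (hW : ContDiffOn ℝ ∞ W tripleStrip)
    (h1 : ∀ t, 0 < t → pd 0 W !₂[1 / 2, t] = 0) (h2 : ∀ t, 0 < t → pd 0 W !₂[-(1 / 2), t] = 0)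
    (h0 : ∀ t, 0 < t → sliceInt W t = 0) {c : ℝ} (hc : 0 < c) (hc' : c ≤ 1 / 2)
    (hΔ : ∀ δ, 0 < δ → ∃ K, ∀ t, δ < t → sliceInt (fun ξ => Δ W ξ ^ 2) t ≤ K * Real.exp (-c * t)) :
    (∃ m, 0 < m ∧ ∃ T, ∀ t, T < t → m * Real.exp t ≤ sliceInt (fun ξ => W ξ ^ 2) t) ∨
    (∀ δ, 0 < δ → ∃ K, ∀ t, δ < t → sliceInt (fun ξ => W ξ ^ 2) t ≤ K * Real.exp (-c * t)) := by
  have hO := isOpen_tripleStrip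
  have p := fun i => ContDiffOn.pd (i := i) hO hW
  have pp := fun i => ContDiffOn.pd (i := i) hO (p i)
  have hd : ∀ {g : Plane → ℝ}, ContDiffOn ℝ ∞ g tripleStrip → ∀ ξ ∈ tripleStrip, DifferentiableAt ℝ g ξ :=
    fun hg ξ hξ => (hg.contDiffAt (hO.mem_nhds hξ)).differentiableAt (by simp)
  have s2 : ContDiffOn ℝ ∞ (fun ξ => W ξ ^ 2) tripleStrip := hW.pow 2
  have s3 : ContDiffOn ℝ ∞ (fun ξ => 2 * (W ξ * pd 1 W ξ)) tripleStrip := contDiffOn_const.mul (hW.mul (p 1))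
  have s4 : ContDiffOn ℝ ∞ (fun ξ => W ξ * pd 0 W ξ) tripleStrip := hW.mul (p 0)
  refine exp_growth_or_decay (N1 := sliceInt fun ξ => 2 * (W ξ * pd 1 W ξ))
    (N2 := sliceInt fun ξ => 2 * (pd 1 W ξ ^ 2 + W ξ * pd 1 (pd 1 W) ξ)) hc hc' (fun t ht => ?_) (fun t ht => ?_) ?_
  · refine (hasDerivAt_sliceInt s2 ht).congr_deriv (sliceInt_congr (fun ξ hξ => ?_) ht)
    have hξ' := straightStrip_subset_tripleStrip hξ
    simp only [pow_two]
    rw [pd_mul (hd hW ξ hξ') (hd hW ξ hξ')]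
    ring
  · refine (hasDerivAt_sliceInt s3 ht).congr_deriv (sliceInt_congr (fun ξ hξ => ?_) ht)
    have hξ' := straightStrip_subset_tripleStrip hξ
    have e1 := pd_mul (f := fun _ => (2:ℝ)) (g := fun ξ => W ξ * pd 1 W ξ) (differentiableAt_const _)
      (hd (hW.mul (p 1)) ξ hξ') 1
    rw [e1, pd_mul (hd hW ξ hξ') (hd (p 1) ξ hξ')]
    simp [pd]
    ring
  · intro δ hδ
    obtain ⟨K, hK⟩ := hΔ δ hδ
    refine ⟨K, fun t ht => ?_⟩
    have ht0 := hδ.trans ht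
    have hL := ContDiffOn.laplacian_plane hO hW
    -- The integrand is the horizontal derivative of W times its horizontal derivative, and the
    -- latter vanishes at both ends.
    have hb : sliceInt (fun ξ => pd 0 W ξ ^ 2 + W ξ * pd 0 (pd 0 W) ξ) t = 0 := by
      have := sliceInt_pd_zero s4 ht0
      rw [h1 t ht0, h2 t ht0, mul_zero, mul_zero, sub_zero] at this
      rw [← this]
      refine sliceInt_congr (fun ξ hξ => ?_) ht0
      have hξ' := straightStrip_subset_tripleStrip hξ
      rw [pd_mul (hd hW ξ hξ') (hd (p 0) ξ hξ')]
      ring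
    have hP : sliceInt (fun ξ => W ξ ^ 2) t ≤ sliceInt (fun ξ => pd 0 W ξ ^ 2) t := by
      have e : (-(1 / 2) : ℝ) + 1 = 1 / 2 := by norm_num
      have := integral_sq_le_integral_deriv_sq (w := fun x => W !₂[x, t]) (w' := fun x => pd 0 W !₂[x, t])
        (a := -(1 / 2)) (fun x hx => ?_) ?_ ?_
      · rwa [e] at this
      · rw [e] at hx
        exact hasDerivAt_horizontal (hd hW _ (slice_mem_tripleStrip hx ht0))
      · rw [e]; exact (p 0).continuousOn.slice ht0
      · rw [e]; exact h0 t ht0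
    have c1 : ContinuousOn (fun ξ => 2 * (pd 0 W ξ ^ 2)) tripleStrip :=
      continuousOn_const.mul ((p 0).continuousOn.pow 2)
    have c2 : ContinuousOn (fun ξ => W ξ ^ 2) tripleStrip := s2.continuousOn
    have c3 : ContinuousOn (fun ξ => Δ W ξ ^ 2) tripleStrip := hL.continuousOn.pow 2
    have c4 : ContinuousOn (fun ξ => 2 * (pd 0 W ξ ^ 2 + W ξ * pd 0 (pd 0 W) ξ)) tripleStrip :=
      continuousOn_const.mul (((p 0).continuousOn.pow 2).add (hW.continuousOn.mul (pp 0).continuousOn))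
    have c5 : ContinuousOn (fun ξ => 2 * (pd 1 W ξ ^ 2 + W ξ * pd 1 (pd 1 W) ξ)) tripleStrip :=
      continuousOn_const.mul (((p 1).continuousOn.pow 2).add (hW.continuousOn.mul (pp 1).continuousOn))
    have c12 : ContinuousOn (fun ξ => 2 * (pd 0 W ξ ^ 2) - W ξ ^ 2) tripleStrip := c1.sub c2
    have c123 : ContinuousOn (fun ξ => 2 * (pd 0 W ξ ^ 2) - W ξ ^ 2 - Δ W ξ ^ 2) tripleStrip := c12.sub c3
    have c1234 : ContinuousOn (fun ξ => 2 * (pd 0 W ξ ^ 2) - W ξ ^ 2 - Δ W ξ ^ 2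
        - 2 * (pd 0 W ξ ^ 2 + W ξ * pd 0 (pd 0 W) ξ)) tripleStrip := c123.sub c4
    have key := sliceInt_mono c1234 c5 ht0 fun ξ hξ => by
      rw [laplacian_eq_pd ((hW.contDiffAt (hO.mem_nhds hξ)).of_le (by norm_cast))]
      nlinarith [sq_nonneg (W ξ + (pd 0 (pd 0 W) ξ + pd 1 (pd 1 W) ξ)), sq_nonneg (pd 1 W ξ)]
    rw [sliceInt_sub c123 c4 ht0, sliceInt_sub c12 c3 ht0, sliceInt_sub c1 c2 ht0,
      sliceInt_const_mul 2 (fun ξ => pd 0 W ξ ^ 2),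
      sliceInt_const_mul 2 (fun ξ => pd 0 W ξ ^ 2 + W ξ * pd 0 (pd 0 W) ξ), hb] at key
    have hK' := hK t ht
    linarith

end

theorem abs_sliceInt_le {G : Plane → ℝ} {t C : ℝ} (ht : 0 < t)
    (h : ∀ ξ ∈ straightStrip, ξ 1 = t → |G ξ| ≤ C) : |sliceInt G t| ≤ C := by
  have := intervalIntegral.norm_integral_le_of_norm_le_const_ae (a := (-(1 / 2) : ℝ)) (b := 1 / 2) (C := C)
    (f := fun x => G !₂[x, t]) ?_
  · norm_num at this
    simpa [sliceInt] using this
  · filter_upwards [Measure.ae_ne volume (1 / 2 : ℝ)] with x hx hx'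
    rw [Set.uIoc_of_le (by norm_num)] at hx'
    exact h _ ⟨by simpa using hx'.1, by simpa using lt_of_le_of_ne hx'.2 hx, by simpa using ht⟩ (by simp)

theorem setIntegral_straightStrip_slice {A : Set ℝ} (hA0 : A ⊆ Set.Ioi 0) {g : Plane → ℝ}
    (hg : IntegrableOn g (straightStrip ∩ {ξ | ξ 1 ∈ A})) :
    IntegrableOn (sliceInt g) A ∧
      ∫ ξ in straightStrip ∩ {ξ | ξ 1 ∈ A}, g ξ = ∫ t in A, sliceInt g t := by
  have hpre : (fun p : ℝ × ℝ => (!₂[p.1, p.2] : Plane)) ⁻¹' (straightStrip ∩ {ξ | ξ 1 ∈ A})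
      = Set.Ioo (-(1 / 2)) (1 / 2) ×ˢ A := by
    ext p
    constructor
    · rintro ⟨⟨h1, h2, -⟩, h3⟩
      exact ⟨⟨by simpa using h1, by simpa using h2⟩, by simpa using h3⟩
    · rintro ⟨h1, h2⟩
      exact ⟨⟨by simpa using h1.1, by simpa using h1.2, by simpa using hA0 h2⟩, by simpa using h2⟩
  have hi : Integrable (fun p : ℝ × ℝ => g !₂[p.1, p.2])
      ((volume.restrict (Set.Ioo (-(1 / 2)) (1 / 2))).prod (volume.restrict A)) := by
    rw [Measure.prod_restrict, ← hpre]
    exact (measurePreserving_plane.integrableOn_comp_preimage measurableEmbedding_plane).2 hg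
  have hs : ∀ t, sliceInt g t = ∫ x in Set.Ioo (-(1 / 2)) (1 / 2), g !₂[x, t] := fun t => by
    rw [sliceInt, intervalIntegral.integral_of_le (by norm_num), integral_Ioc_eq_integral_Ioo]
  simp_rw [funext hs]
  refine ⟨hi.integral_prod_right, ?_⟩
  rw [← measurePreserving_plane.setIntegral_preimage_emb measurableEmbedding_plane, hpre,
    Measure.volume_eq_prod, ← Measure.prod_restrict, integral_prod_symm _ hi]

/-! ### Asymptotics of Neumann solutions at infinity -/

/-- The square means of `u` over horizontal sections grow at least like `e^t`. -/
def ExpGrowth (u : Plane → ℝ) : Prop :=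
  ∃ m, 0 < m ∧ ∃ T, ∀ t, T < t → m * Real.exp t ≤ sliceInt (fun ξ => u ξ ^ 2) t

theorem not_integrableOn_Ioi_of_le {g : ℝ → ℝ} {m T : ℝ} (hm : 0 < m) (hg : ∀ t, T < t → m ≤ g t) :
    ¬ IntegrableOn g (Set.Ioi T) := by
  intro hi
  have : IntegrableOn (fun _ : ℝ => m) (Set.Ioi T) := by
    refine Integrable.mono' hi aestronglyMeasurable_const ?_
    rw [ae_restrict_iff' measurableSet_Ioi]
    exact Eventually.of_forall fun t ht => by rw [Real.norm_of_nonneg hm.le]; exact hg t ht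
  rw [integrableOn_const_iff] at this
  simp [hm.ne'] at this

section

variable {F : ℝ → ℝ}

theorem integrableOn_sliceInt_sq (hF : IsProfile F) {v : Plane → ℝ}
    (hv : MemLp v 2 (volume.restrict (halfStrip F))) {T : ℝ} (hT : 0 ≤ T) :
    IntegrableOn (sliceInt fun ξ => v ξ ^ 2) (Set.Ioi T) := by
  refine (setIntegral_straightStrip_slice (Set.Ioi_subset_Ioi hT) ?_).1
  have h1 : IntegrableOn (fun ξ => v ξ ^ 2) (halfStrip F) := hv.integrable_sq
  exact h1.mono_set (Set.inter_subset_left.trans (straightStrip_subset_halfStrip hF))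

/-- Since η ≤ 1, growth like e^t beats the weight e^{-ηt}, so the weighted section integrals stay
above a positive constant and cannot be integrable on a half-line. -/
theorem not_expGrowth_of_memLp (hF : IsProfile F) {v w : Plane → ℝ} {η T0 : ℝ} (hη : η ≤ 1)
    (hv : MemLp (fun ξ => v ξ * Real.exp (-η / 2 * ξ 1)) 2 (volume.restrict (halfStrip F)))
    (hw : ∀ ξ ∈ straightStrip, T0 < ξ 1 → w ξ = v ξ) : ¬ ExpGrowth w := by
  rintro ⟨m, hm, T, hT⟩
  set T1 := max (max T T0) 0
  refine not_integrableOn_Ioi_of_le (T := T1) hm (fun t ht => ?_) (integrableOn_sliceInt_sq hF hv (le_max_right _ _))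
  simp only [T1, max_lt_iff] at ht
  have e : sliceInt (fun ξ => (v ξ * Real.exp (-η / 2 * ξ 1)) ^ 2) t
      = Real.exp (-η * t) * sliceInt (fun ξ => w ξ ^ 2) t := by
    rw [← sliceInt_const_mul, sliceInt, sliceInt, intervalIntegral.integral_of_le (by norm_num),
      intervalIntegral.integral_of_le (by norm_num), integral_Ioc_eq_integral_Ioo, integral_Ioc_eq_integral_Ioo]
    refine setIntegral_congr_fun measurableSet_Ioo fun x hx => ?_
    have := hw !₂[x, t] ⟨by simpa using hx.1, by simpa using hx.2, by simpa using ht.2⟩ (by simpa using ht.1.2)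
    simp only
    rw [this, mul_pow, ← Real.exp_nat_mul, mul_comm]
    congr 2
    simp; ring
  rw [e]
  calc m ≤ Real.exp (-η * t) * (m * Real.exp t) := by
        rw [mul_left_comm, ← Real.exp_add]
        exact le_mul_of_one_le_right hm.le (Real.one_le_exp (by nlinarith))
    _ ≤ _ := mul_le_mul_of_nonneg_left (hT t ht.1.1) (Real.exp_pos _).le

/-- The dichotomy is applied to the even extension. In the decaying case the derivative estimate up
to the lateral sides turns decay of section integrals of squares into pointwise decay of every
derivative, at half the rate. -/
theorem IsNeumannSolution.growth_or_expSmall (hF : IsProfile F) {f w : Plane → ℝ}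
    (h : IsNeumannSolution F f w) (hf : IsNeumannSolution F (fun _ => 0) f)
    (hfs : EqUpToExpSmall F f fun _ => 0) (h0 : ∀ t, 0 < t → sliceInt w t = 0) :
    ExpGrowth w ∨ EqUpToExpSmall F w fun _ => 0 := by
  have hW := h.contDiffOn_evenExt hF hf
  have hWw := h.evenExt_eq hF hf
  obtain ⟨ς, hς, hfs⟩ := hfs
  -- The cap 1/2 is required by `exp_growth_or_decay`; the square of the source decays at rate 2ς,
  -- more than enough.
  set c := min ς (1 / 2) with hc
  have hc0 : 0 < c := lt_min hς (by norm_num)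
  have e2 : ∀ t, 0 < t → sliceInt (fun ξ => evenExt w ξ ^ 2) t = sliceInt (fun ξ => w ξ ^ 2) t := fun t ht =>
    sliceInt_congr (fun ξ hξ => by simp only [hWw hξ]) ht
  have main := slice_growth_or_decay hW (fun t ht => h.pd_zero_evenExt hF hf (Or.inl rfl) ht)
    (fun t ht => by
      have := h.pd_zero_evenExt hF hf (Or.inr rfl) ht
      rwa [neg_div] at this)
    (fun t ht => by rw [sliceInt_congr hWw ht, h0 t ht]) hc0 (min_le_right _ _) fun δ hδ => by
      obtain ⟨K, hK⟩ := hfs δ hδ 0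
      refine ⟨K ^ 2, fun t ht => (le_abs_self _).trans (abs_sliceInt_le (hδ.trans ht) fun ξ hξ hξt => ?_)⟩
      have := hK ξ (straightStrip_subset_halfStrip hF hξ) (hξt ▸ ht)
      rw [norm_iteratedFDeriv_zero, sub_zero, Real.norm_eq_abs, hξt] at this
      rw [h.laplacian_evenExt hF hf hξ, abs_of_nonneg (sq_nonneg _), ← sq_abs]
      calc |f ξ| ^ 2 ≤ (K * Real.exp (-ς * t)) ^ 2 := pow_le_pow_left₀ (abs_nonneg _) this 2
        _ = K ^ 2 * Real.exp (-(2 * ς) * t) := by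
          rw [mul_pow, ← Real.exp_nat_mul]; congr 2; push_cast; ring
        _ ≤ _ := by
          refine mul_le_mul_of_nonneg_left (Real.exp_le_exp.2 ?_) (sq_nonneg K)
          have := min_le_left ς (1 / 2)
          have h3 := hδ.trans ht
          nlinarith
  rcases main with ⟨m, hm, T, hT⟩ | hdec
  · refine Or.inl ⟨m, hm, max T 0, fun t ht => ?_⟩
    rw [max_lt_iff] at ht
    rw [← e2 t ht.2]
    exact hT t ht.1
  refine Or.inr ⟨c / 2, half_pos hc0, fun δ hδ k => ?_⟩
  -- The band of half-width r around a point above height δ stays above δ/2, where a decay constant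
  -- is available; the cap keeps its thickness at most 1.
  set r := min (δ / 2) (1 / 2) with hr
  have hr0 : 0 < r := lt_min (half_pos hδ) (by norm_num)
  have hr1 : r ≤ 1 / 2 := min_le_right _ _
  have hrδ : r ≤ δ / 2 := min_le_left _ _
  obtain ⟨C, hC0, hC⟩ := norm_iteratedFDeriv_le_of_isNeumannSolution k hr0 (by linarith)
  obtain ⟨K, hK⟩ := hdec (δ / 2) (half_pos hδ)
  refine ⟨C * ((|K| + 1) * Real.exp c), fun ξ hξ hξδ => ?_⟩
  have hξs : ξ ∈ straightStrip := ⟨hξ.1, hξ.2.1, hδ.trans hξδ⟩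
  simp only [sub_zero]
  refine (hC F f w hF h hf ξ hξs (by linarith)).trans ?_
  rw [mul_assoc]
  refine mul_le_mul_of_nonneg_left ?_ hC0
  have hi : IntegrableOn (fun ξ => ‖w ξ‖) (straightStrip ∩ {η | η 1 ∈ Set.Icc (ξ 1 - r) (ξ 1 + r)}) :=
    ((integrableOn_straightStrip_of_truncation hF (fun R => (h.energy R).1) (ξ 1 + r + 1)).mono_set
      (Set.inter_subset_inter_right _ fun η hη => by
        have : η 1 ≤ ξ 1 + r := hη.2
        show η 1 < _
        linarith)).norm
  rw [(setIntegral_straightStrip_slice (fun t ht => by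
    have := ht.1
    simp only [Set.mem_Ioi]; linarith) hi).2]
  set B := (|K| + 1) * Real.exp c * Real.exp (-(c / 2) * ξ 1) with hB
  have hB0 : 0 ≤ B := by positivity
  have key : ∀ t ∈ Set.Icc (ξ 1 - r) (ξ 1 + r), ‖sliceInt (fun η => ‖w η‖) t‖ ≤ B := by
    intro t ht
    have htδ : δ / 2 < t := by linarith [ht.1]
    have ht0 : 0 < t := (half_pos hδ).trans htδ
    have hWc := hW.continuousOn
    have e1 : sliceInt (fun η => ‖w η‖) t = sliceInt (fun η => ‖evenExt w η‖) t :=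
      sliceInt_congr (fun ξ hξ => by simp only [hWw hξ]) ht0
    set E := Real.exp (c / 2 * t)
    set E' := Real.exp (-(c / 2) * t) with hE'
    have hEE : E * E' = 1 := by rw [← Real.exp_add]; ring_nf; simp
    have hEpos : 0 < E := Real.exp_pos _
    have hEpos' : 0 < E' := Real.exp_pos _
    have hc1 : ContinuousOn (fun η => E * evenExt w η ^ 2) tripleStrip := continuousOn_const.mul (hWc.pow 2)
    have hc2 : ContinuousOn (fun η => E * evenExt w η ^ 2 + E') tripleStrip := hc1.add continuousOn_const
    -- Young's inequality |w| ≤ E w² + E' with E E' = 1; the choice E = e^{ct/2} makes both terms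
    -- O(e^{-ct/2}) after integration.
    have hle : sliceInt (fun η => ‖evenExt w η‖) t ≤ sliceInt (fun η => E * evenExt w η ^ 2 + E') t := by
      refine sliceInt_mono hWc.norm hc2 ht0 fun η _ => ?_
      rw [Real.norm_eq_abs, ← sq_abs]
      refine le_of_mul_le_mul_left ?_ hEpos
      nlinarith [sq_nonneg (E * |evenExt w η| - 1), mul_nonneg hEpos.le (abs_nonneg (evenExt w η))]
    have hq := sliceInt_fun_coord (fun _ => E') t
    rw [sliceInt_add hc1 continuousOn_const ht0, sliceInt_const_mul, hq] at hle
    have hn : 0 ≤ sliceInt (fun η => ‖evenExt w η‖) t :=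
      intervalIntegral.integral_nonneg (by norm_num) fun _ _ => norm_nonneg _
    rw [e1, Real.norm_of_nonneg hn]
    have hk := hK t htδ
    have e3 : Real.exp (-c * t) = E' * E' := by rw [← Real.exp_add]; ring_nf
    have e4 : E * sliceInt (fun η => evenExt w η ^ 2) t ≤ |K| * E' := by
      calc E * sliceInt (fun η => evenExt w η ^ 2) t ≤ E * (|K| * (E' * E')) := by
            refine mul_le_mul_of_nonneg_left (hk.trans ?_) hEpos.le
            rw [e3]
            exact mul_le_mul_of_nonneg_right (le_abs_self K) (by positivity)
        _ = |K| * E' * (E * E') := by ring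
        _ = _ := by rw [hEE, mul_one]
    have e5 : E' ≤ Real.exp c * Real.exp (-(c / 2) * ξ 1) := by
      rw [← Real.exp_add]
      refine Real.exp_le_exp.2 ?_
      have := ht.1
      nlinarith
    calc _ ≤ (|K| + 1) * E' := by linarith
      _ ≤ (|K| + 1) * (Real.exp c * Real.exp (-(c / 2) * ξ 1)) := mul_le_mul_of_nonneg_left e5 (by positivity)
      _ = B := by rw [hB]; ring
  refine (le_abs_self _).trans ((norm_setIntegral_le_of_norm_le_const (by simp) key).trans ?_)
  have hvol : volume.real (Set.Icc (ξ 1 - r) (ξ 1 + r)) ≤ 1 := by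
    rw [Real.volume_real_Icc_of_le (by linarith)]; linarith
  exact mul_le_of_le_one_right hB0 hvol

end

section

variable {F : ℝ → ℝ}

theorem HasLocalEnergy.sub (hF : IsProfile F) {u v : Plane → ℝ} (hu : ContDiffOn ℝ ∞ u (halfStrip F))
    (hv : ContDiffOn ℝ ∞ v (halfStrip F)) (eu : HasLocalEnergy F u) (ev : HasLocalEnergy F v) :
    HasLocalEnergy F fun ξ => u ξ - v ξ := by
  have hO := isOpen_halfStrip hF.smooth.continuous
  refine fun R => ⟨(eu R).1.sub (ev R).1, MemLp.ae_eq ?_ ((eu R).2.sub (ev R).2)⟩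
  filter_upwards [ae_restrict_mem (isOpen_truncation hF R).measurableSet] with ξ hξ
  have hd : ∀ {g : Plane → ℝ}, ContDiffOn ℝ ∞ g (halfStrip F) → DifferentiableAt ℝ g ξ :=
    fun hg => (hg.contDiffAt (hO.mem_nhds hξ.1)).differentiableAt (by simp)
  exact (gradient_fun_sub (hd hu) (hd hv)).symm

theorem WeakNeumannEq.sub (hF : IsProfile F) {f g u v : Plane → ℝ}
    (hf : ∀ R, MemLp f 2 (volume.restrict (truncation F R)))
    (hg : ∀ R, MemLp g 2 (volume.restrict (truncation F R)))
    (hu : ContDiffOn ℝ ∞ u (halfStrip F)) (hv : ContDiffOn ℝ ∞ v (halfStrip F))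
    (eu : HasLocalEnergy F u) (ev : HasLocalEnergy F v)
    (nu : WeakNeumannEq F f u) (nv : WeakNeumannEq F g v) :
    WeakNeumannEq F (fun ξ => f ξ - g ξ) fun ξ => u ξ - v ξ := by
  intro φ h1 h2 h3
  have hO := isOpen_halfStrip hF.smooth.continuous
  have hφ : IsTest (aboveGraph F) φ := ⟨h1, h2, h3⟩
  have hin : ∀ {w : Plane → ℝ}, HasLocalEnergy F w → IntegrableOn (fun ξ => ⟪∇ w ξ, ∇ φ ξ⟫_ℝ) (halfStrip F) := by
    intro w hw
    simp_rw [inner_gradient]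
    exact (integrableOn_mul_of_truncation hF (hw.memLp_pd 0) (hφ.pd 0).smooth.continuous (hφ.pd 0).compact).add
      (integrableOn_mul_of_truncation hF (hw.memLp_pd 1) (hφ.pd 1).smooth.continuous (hφ.pd 1).compact)
  have e : ∫ ξ in halfStrip F, ⟪∇ (fun ξ => u ξ - v ξ) ξ, ∇ φ ξ⟫_ℝ
      = ∫ ξ in halfStrip F, (⟪∇ u ξ, ∇ φ ξ⟫_ℝ - ⟪∇ v ξ, ∇ φ ξ⟫_ℝ) := by
    refine setIntegral_congr_fun hO.measurableSet fun ξ hξ => ?_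
    have hd : ∀ {g : Plane → ℝ}, ContDiffOn ℝ ∞ g (halfStrip F) → DifferentiableAt ℝ g ξ :=
      fun hg => (hg.contDiffAt (hO.mem_nhds hξ)).differentiableAt (by simp)
    rw [gradient_fun_sub (hd hu) (hd hv), inner_sub_left]
  rw [e, integral_sub (hin eu) (hin ev), nu φ h1 h2 h3, nv φ h1 h2 h3]
  simp_rw [sub_mul]
  rw [integral_sub (integrableOn_mul_of_truncation hF hf h1.continuous h2)
    (integrableOn_mul_of_truncation hF hg h1.continuous h2)]
  ring

theorem IsNeumannSolution.sub (hF : IsProfile F) {f g u v : Plane → ℝ} (h : IsNeumannSolution F f u)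
    (h' : IsNeumannSolution F g v) :
    IsNeumannSolution F (fun ξ => f ξ - g ξ) fun ξ => u ξ - v ξ where
  smooth := h.smooth.sub h'.smooth
  rhs R := (h.rhs R).sub (h'.rhs R)
  energy := h.energy.sub hF h.smooth h'.smooth h'.energy
  neumann := WeakNeumannEq.sub hF h.rhs h'.rhs h.smooth h'.smooth h.energy h'.energy h.neumann h'.neumann

theorem isNeumannSolution_fun_coord (hF : IsProfile F) {q : ℝ → ℝ} (hq : ContDiff ℝ ∞ q) :
    IsNeumannSolution F (fun ξ => deriv (deriv q) (ξ 1)) fun ξ => q (ξ 1) := by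
  have hs : ∀ {q : ℝ → ℝ}, ContDiff ℝ ∞ q → ContDiff ℝ ∞ fun ξ : Plane => q (ξ 1) :=
    fun hq => hq.comp (contDiff_coord 1)
  have hd : ∀ {q : ℝ → ℝ}, ContDiff ℝ ∞ q → ∀ x : Plane, HasDerivAt q (deriv q (x 1)) (x 1) :=
    fun hq x => (hq.differentiable (by simp) _).hasDerivAt
  have hq1 := hq.deriv_real
  refine ⟨(hs hq).contDiffOn, fun R => memLp_truncation_of_continuous hF R (hs hq1.deriv_real).continuous 2,
    fun R => ⟨memLp_truncation_of_continuous hF R (hs hq).continuous 2, memLp_truncation_of_continuous hF R ?_ 2⟩, ?_⟩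
  · exact (InnerProductSpace.toDual ℝ Plane).symm.continuous.comp ((hs hq).continuous_fderiv (by simp))
  · intro φ h1 h2 h3
    have hφ : IsTest (aboveGraph F) φ := ⟨h1, h2, h3⟩
    have ht := hφ.mul_left (hs hq1)
    have i1 := (hφ.mul_left (hs hq1.deriv_real)).integrable
    have i2 := ((hφ.pd 1).mul_left (hs hq1)).integrable
    have k := setIntegral_strip_pd_one ht
    have e : ∀ ξ, pd 1 (fun ξ => deriv q (ξ 1) * φ ξ) ξ = deriv (deriv q) (ξ 1) * φ ξ + deriv q (ξ 1) * pd 1 φ ξ := by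
      intro ξ
      rw [pd_mul ((hs hq1).differentiable (by simp) ξ) (h1.differentiable (by simp) ξ), (pd_fun_coord (hd hq1 ξ)).2]
    simp_rw [e] at k
    rw [integral_add i1.integrableOn i2.integrableOn] at k
    simp_rw [inner_gradient, (pd_fun_coord (hd hq _)).1, (pd_fun_coord (hd hq _)).2, zero_mul, zero_add]
    rw [setIntegral_halfStrip_eq_strip fun x hx => by rw [(hφ.pd 1).eq_zero hx, mul_zero],
      setIntegral_halfStrip_eq_strip fun x hx => by rw [hφ.eq_zero hx, mul_zero]]
    linarith

theorem isNeumannSolution_affine (hF : IsProfile F) (a b : ℝ) :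
    IsNeumannSolution F (fun _ => 0) fun ξ => a + b * ξ 1 := by
  have := isNeumannSolution_fun_coord hF (q := fun t => a + b * t) (by fun_prop)
  have e : deriv (fun t : ℝ => a + b * t) = fun _ => b := by
    funext t; simp
  simpa [e] using this

/-- By (x - y)² ≤ 2x² + 2y², the loss is twice the square of an affine function, which is eventually
absorbed by a fraction of m e^t. -/
theorem ExpGrowth.of_sub_affine {u U : Plane → ℝ} (hU : ContDiffOn ℝ ∞ U tripleStrip)
    (hu : Set.EqOn U u straightStrip) {a b : ℝ} (h : ExpGrowth fun ξ => u ξ - (a + b * ξ 1)) : ExpGrowth u := by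
  obtain ⟨m, hm, T, hT⟩ := h
  have hlit : (fun t : ℝ => (a + b * t) ^ 2) =o[atTop] Real.exp := by
    have e : (fun t : ℝ => (a + b * t) ^ 2) = fun t => a ^ 2 * t ^ 0 + 2 * a * b * t ^ 1 + b ^ 2 * t ^ 2 := by
      funext t; ring
    rw [e]
    exact (((Real.isLittleO_pow_exp_atTop).const_mul_left _).add ((Real.isLittleO_pow_exp_atTop).const_mul_left _)).add
      ((Real.isLittleO_pow_exp_atTop).const_mul_left _)
  obtain ⟨T', hT'⟩ := eventually_atTop.1 (hlit.def (by positivity : 0 < m / 4))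
  refine ⟨m / 4, by positivity, max (max T T') 0, fun t ht => ?_⟩
  simp only [max_lt_iff] at ht
  have h1 := hT t ht.1.1
  have h2 := hT' t ht.1.2.le
  rw [Real.norm_of_nonneg (sq_nonneg _), Real.norm_of_nonneg (Real.exp_pos t).le] at h2
  have c0 : ContinuousOn (fun ξ : Plane => a + b * ξ 1) tripleStrip := by fun_prop
  have c1 : ContinuousOn (fun ξ => (U ξ - (a + b * ξ 1)) ^ 2) tripleStrip := (hU.continuousOn.sub c0).pow 2
  have c2 : ContinuousOn (fun ξ => 2 * U ξ ^ 2) tripleStrip := continuousOn_const.mul (hU.continuousOn.pow 2)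
  have c3 : ContinuousOn (fun ξ : Plane => 2 * (a + b * ξ 1) ^ 2) tripleStrip := by fun_prop
  have h3 := sliceInt_mono c1 (c2.add c3) ht.2 fun ξ _ => by
    simp only [Pi.add_apply]
    nlinarith [sq_nonneg (U ξ + (a + b * ξ 1))]
  have h4 : sliceInt ((fun ξ => 2 * U ξ ^ 2) + fun ξ => 2 * (a + b * ξ 1) ^ 2) t = _ := sliceInt_add c2 c3 ht.2
  rw [sliceInt_const_mul, sliceInt_fun_coord (fun s => 2 * (a + b * s) ^ 2) t,
    sliceInt_congr (G := fun ξ => U ξ ^ 2) (H := fun ξ => u ξ ^ 2) (fun ξ hξ => by simp only [hu hξ]) ht.2] at h4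
  rw [sliceInt_congr (H := fun ξ => (u ξ - (a + b * ξ 1)) ^ 2) (fun ξ hξ => by simp only [hu hξ]) ht.2] at h3
  have h5 : sliceInt (fun ξ => (u ξ - (a + b * ξ 1)) ^ 2) t ≤ _ := h3.trans_eq h4
  linarith

/-- Solutions of at most subexponential growth are affine in `ξ₂` up to exponentially small terms. -/
theorem IsNeumannSolution.exists_affine_asymptotics (hF : IsProfile F) {f u : Plane → ℝ}
    (h : IsNeumannSolution F f u) (hf : IsNeumannSolution F (fun _ => 0) f)
    (hfs : EqUpToExpSmall F f fun _ => 0) (hf0 : ∀ t, 0 < t → sliceInt f t = 0) (hg : ¬ ExpGrowth u) :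
    ∃ a b, (∀ t, 0 < t → sliceInt u t = a + b * t) ∧ EqUpToExpSmall F u fun ξ => a + b * ξ 1 := by
  have hU := h.contDiffOn_evenExt hF hf
  have hUu := h.evenExt_eq hF hf
  obtain ⟨a, b, hab⟩ := sliceInt_affine hU (fun t ht => h.pd_zero_evenExt hF hf (Or.inl rfl) ht)
    (fun t ht => by
      have := h.pd_zero_evenExt hF hf (Or.inr rfl) ht
      rwa [neg_div] at this) fun t ht => by
      rw [sliceInt_congr (h.laplacian_evenExt hF hf) ht, hf0 t ht]
  have hab' : ∀ t, 0 < t → sliceInt u t = a + b * t := fun t ht => by rw [← hab t ht, sliceInt_congr hUu ht]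
  refine ⟨a, b, hab', ?_⟩
  -- Removing the affine section mean leaves a solution with the same source and zero means, to
  -- which the dichotomy applies.
  have hw := h.sub hF (isNeumannSolution_affine hF a b)
  simp only [sub_zero] at hw
  have h0 : ∀ t, 0 < t → sliceInt (fun ξ => u ξ - (a + b * ξ 1)) t = 0 := fun t ht => by
    rw [← sliceInt_congr (G := fun ξ => evenExt u ξ - (a + b * ξ 1)) (fun ξ hξ => by simp only [hUu hξ]) ht,
      sliceInt_sub hU.continuousOn (by fun_prop) ht, hab t ht, sliceInt_fun_coord fun t => a + b * t, sub_self]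
  have := (hw.growth_or_expSmall hF hf hfs h0).resolve_left fun hgr => hg (hgr.of_sub_affine hU hUu)
  simpa only [EqUpToExpSmall, sub_zero] using this

/-- The section mean of ∂₂u is the slope b, so the section integral of (∂₂u)² is at least b². Over
infinitely many heights this is integrable only if b = 0. -/
theorem IsNeumannSolution.slope_eq_zero (hF : IsProfile F) {f u g : Plane → ℝ} {a b T0 : ℝ}
    (h : IsNeumannSolution F f u) (hf : IsNeumannSolution F (fun _ => 0) f)
    (hab : ∀ t, 0 < t → sliceInt u t = a + b * t) (hg : MemLp g 2 (volume.restrict (halfStrip F)))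
    (hgu : ∀ ξ ∈ straightStrip, T0 < ξ 1 → pd 1 u ξ = g ξ) : b = 0 := by
  by_contra hb
  have hU := h.contDiffOn_evenExt hF hf
  have hUu := h.evenExt_eq hF hf
  have hp := (ContDiffOn.pd (i := 1) isOpen_tripleStrip hU).continuousOn
  refine not_integrableOn_Ioi_of_le (T := max T0 0) (pow_pos (abs_pos.2 hb) 2) (fun t ht => ?_)
    (integrableOn_sliceInt_sq hF hg (le_max_right _ _))
  simp only [max_lt_iff] at ht
  have e1 : sliceInt (pd 1 (evenExt u)) t = b := by
    have h1 := hasDerivAt_sliceInt hU ht.2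
    have h2 : HasDerivAt (fun t => a + b * t) b t := by
      simpa using ((hasDerivAt_id t).const_mul b).const_add a
    refine h1.unique (h2.congr_of_eventuallyEq ?_)
    filter_upwards [lt_mem_nhds ht.2] with s hs
    rw [sliceInt_congr hUu hs, hab s hs]
  have e2 : sliceInt (fun ξ => g ξ ^ 2) t = sliceInt (fun ξ => pd 1 (evenExt u) ξ ^ 2) t := by
    rw [sliceInt, sliceInt, intervalIntegral.integral_of_le (by norm_num),
      intervalIntegral.integral_of_le (by norm_num), integral_Ioc_eq_integral_Ioo, integral_Ioc_eq_integral_Ioo]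
    refine setIntegral_congr_fun measurableSet_Ioo fun x hx => ?_
    have hm : (!₂[x, t] : Plane) ∈ straightStrip := ⟨by simpa using hx.1, by simpa using hx.2, by simpa using ht.2⟩
    have := hgu !₂[x, t] hm (by simpa using ht.1)
    have hev : evenExt u =ᶠ[𝓝 !₂[x, t]] u := hUu.eventuallyEq_of_mem (isOpen_straightStrip.mem_nhds hm)
    rw [← this, pd, pd, hev.fderiv_eq]
  rw [sq_abs, e2]
  have c1 : ContinuousOn (fun ξ => 2 * b * pd 1 (evenExt u) ξ) tripleStrip := continuousOn_const.mul hp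
  have := sliceInt_mono (c1.sub (continuousOn_const (c := b ^ 2))) (hp.pow 2) ht.2 fun ξ _ => by
    simp only [Pi.sub_apply, Pi.pow_apply]
    nlinarith [sq_nonneg (pd 1 (evenExt u) ξ - b)]
  have e3 := sliceInt_sub c1 (continuousOn_const (c := b ^ 2)) ht.2
  rw [sliceInt_const_mul, e1, sliceInt_fun_coord fun _ => b ^ 2] at e3
  have h5 : 2 * b * b - b ^ 2 ≤ sliceInt (fun ξ => pd 1 (evenExt u) ξ ^ 2) t := e3.symm.trans_le this
  linarith [h5]

end

/-! ### Zero-trace functions as limits of test functions: squeezing and mollifying -/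

/-- An area-preserving map squeezing the strip horizontally and stretching it vertically, followed
by a downward shift. -/
noncomputable def squeeze (K τ : ℝ) (x : Plane) : Plane :=
  !₂[Real.exp (-τ) * x 0, Real.exp τ * x 1 - K * τ]

@[simp] theorem squeeze_apply_zero (K τ : ℝ) (x : Plane) : squeeze K τ x 0 = Real.exp (-τ) * x 0 := by
  simp [squeeze]

@[simp] theorem squeeze_apply_one (K τ : ℝ) (x : Plane) : squeeze K τ x 1 = Real.exp τ * x 1 - K * τ := by
  simp [squeeze]

theorem squeeze_zero_apply (K : ℝ) (x : Plane) : squeeze K 0 x = x := by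
  ext i; fin_cases i <;> simp

theorem continuous_squeeze_uncurry (K : ℝ) : Continuous fun p : ℝ × Plane => squeeze K p.1 p.2 := by
  have : Continuous fun p : ℝ × Plane =>
      (!₂[Real.exp (-p.1) * p.2 0, Real.exp p.1 * p.2 1 - K * p.1] : Plane) :=
    continuous_plane.comp (f := fun p : ℝ × Plane => (Real.exp (-p.1) * p.2 0, Real.exp p.1 * p.2 1 - K * p.1))
      (by fun_prop)
  exact this

theorem measurePreserving_scale (τ : ℝ) :
    MeasurePreserving fun p : ℝ × ℝ => (Real.exp (-τ) * p.1, Real.exp τ * p.2) := by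
  refine ⟨by fun_prop, ?_⟩
  have h : ∀ a : ℝ, 0 < a → Measure.map (fun x : ℝ => a * x) volume = ENNReal.ofReal a⁻¹ • volume := fun a ha => by
    have := Real.map_volume_mul_left ha.ne'
    rwa [abs_of_pos (inv_pos.2 ha)] at this
  have e : (fun p : ℝ × ℝ => (Real.exp (-τ) * p.1, Real.exp τ * p.2))
      = Prod.map (fun x => Real.exp (-τ) * x) fun x => Real.exp τ * x := rfl
  rw [e, Measure.volume_eq_prod, ← Measure.map_prod_map _ _ (by fun_prop) (by fun_prop),
    h _ (Real.exp_pos _), h _ (Real.exp_pos _), Measure.prod_smul_left, Measure.prod_smul_right, smul_smul,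
    ← ENNReal.ofReal_mul (by positivity), ← mul_inv, ← Real.exp_add]
  simp

theorem measurePreserving_squeeze_sub (K τ : ℝ) (y : Plane) : MeasurePreserving fun x => squeeze K τ x - y := by
  have h2 := measurePreserving_planeEquiv.comp ((measurePreserving_scale τ).comp measurePreserving_planeEquiv.symm)
  have h3 := (measurePreserving_sub_right volume (!₂[0, K * τ] + y : Plane)).comp h2
  have e : (fun x => squeeze K τ x - y) = (fun x : Plane => x - (!₂[0, K * τ] + y)) ∘ planeEquiv ∘
      (fun p : ℝ × ℝ => (Real.exp (-τ) * p.1, Real.exp τ * p.2)) ∘ planeEquiv.symm := by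
    funext ξ
    obtain ⟨p, rfl⟩ := planeEquiv.surjective ξ
    simp only [Function.comp_apply, MeasurableEquiv.symm_apply_apply]
    ext i
    fin_cases i <;> simp [planeEquiv_apply]
    ring
  rw [e]; exact h3

theorem measurePreserving_squeeze (K τ : ℝ) : MeasurePreserving (squeeze K τ) := by
  simpa using measurePreserving_squeeze_sub K τ 0

/-- All these maps preserve area, so composition with them is isometric on L² and depends strongly
continuously on the parameters. This is why the squeeze compensates its horizontal contraction by a
vertical stretch. -/
theorem continuous_integral_mul_comp_squeeze (K : ℝ) {G H : Plane → ℝ} (hG : MemLp G 2) (hH : MemLp H 2) :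
    Continuous fun p : ℝ × Plane => ∫ x, H x * G (squeeze K p.1 x - p.2) := by
  let S : C((ℝ × Plane) × Plane, Plane) :=
    ⟨fun p => squeeze K p.1.1 p.2 - p.1.2,
      ((continuous_squeeze_uncurry K).comp (f := fun p : (ℝ × Plane) × Plane => (p.1.1, p.2)) (by fun_prop)).sub
        (by fun_prop)⟩
  have hmp : ∀ p, MeasurePreserving (S.curry p) := fun p => measurePreserving_squeeze_sub K p.1 p.2
  have hcont : Continuous fun p => Lp.compMeasurePreserving (S.curry p) (hmp p) (hG.toLp G) :=
    continuous_const.compMeasurePreservingLp S.curry.continuous hmp (by norm_num)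
  have hin : Continuous fun p => ⟪hH.toLp H, Lp.compMeasurePreserving (S.curry p) (hmp p) (hG.toLp G)⟫_ℝ :=
    continuous_const.inner hcont
  have e : ∀ p : ℝ × Plane, ⟪hH.toLp H, Lp.compMeasurePreserving (S.curry p) (hmp p) (hG.toLp G)⟫_ℝ
      = ∫ x, H x * G (squeeze K p.1 x - p.2) := by
    intro p
    rw [Lp.toLp_compMeasurePreserving, inner_toLp_two hH]
    refine integral_congr_ae (Eventually.of_forall fun x => ?_)
    simp [S, mul_comm]
  simpa only [e] using hin

theorem exists_mollifier {ε : ℝ} (hε : 0 < ε) : ∃ ρ : Plane → ℝ, ContDiff ℝ ∞ ρ ∧ HasCompactSupport ρ ∧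
    (∀ y, 0 ≤ ρ y) ∧ ∫ y, ρ y = 1 ∧ ∀ y, ρ y ≠ 0 → ‖y‖ < ε := by
  let b : ContDiffBump (0 : Plane) := ⟨ε / 2, ε, half_pos hε, half_lt_self hε⟩
  refine ⟨b.normed volume, b.contDiff_normed, b.hasCompactSupport_normed, b.nonneg_normed, b.integral_normed, ?_⟩
  intro y hy
  have : y ∈ Function.support (b.normed volume) := hy
  rw [b.support_normed_eq] at this
  simpa using this

/-- Fubini is justified by the domination |HρG| ≤ |ρ|G² + H²|ρ|, both terms being integrable on the
product. -/
theorem integral_mul_mollified_comp {K τ : ℝ} {G H ρ : Plane → ℝ} (hG : MemLp G 2) (hH : MemLp H 2)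
    (hρ : Continuous ρ) (hc : HasCompactSupport ρ) :
    ∫ x, H x * ∫ y, ρ y * G (squeeze K τ x - y) = ∫ y, ρ y * ∫ x, H x * G (squeeze K τ x - y) := by
  have hρi : Integrable ρ := hρ.integrable_of_hasCompactSupport hc
  have hT : MeasurePreserving (Prod.map (squeeze K τ) id : Plane × Plane → Plane × Plane)
      (volume.prod volume) (volume.prod volume) := (measurePreserving_squeeze K τ).prod (MeasurePreserving.id _)
  have h1 : Integrable (fun p : Plane × Plane => ‖ρ p.2‖ * G (squeeze K τ p.1 - p.2) ^ 2) (volume.prod volume) :=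
    hT.integrable_comp_of_integrable
      (hρi.norm.convolution_integrand (ContinuousLinearMap.mul ℝ ℝ) hG.integrable_sq)
  have h2 : Integrable (fun p : Plane × Plane => H p.1 ^ 2 * ‖ρ p.2‖) (volume.prod volume) :=
    hH.integrable_sq.mul_prod hρi.norm
  have hm : AEStronglyMeasurable (fun p : Plane × Plane => H p.1 * (ρ p.2 * G (squeeze K τ p.1 - p.2)))
      (volume.prod volume) :=
    hH.aestronglyMeasurable.comp_fst.mul
      ((hρ.aestronglyMeasurable.convolution_integrand (ContinuousLinearMap.mul ℝ ℝ)
        hG.aestronglyMeasurable).comp_measurePreserving hT)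
  have hi : Integrable (fun p : Plane × Plane => H p.1 * (ρ p.2 * G (squeeze K τ p.1 - p.2)))
      (volume.prod volume) := by
    refine (h1.add h2).mono' hm (Eventually.of_forall fun p => ?_)
    simp only [Pi.add_apply, norm_mul, Real.norm_eq_abs]
    rw [← sq_abs (G _), ← sq_abs (H _)]
    nlinarith [mul_nonneg (abs_nonneg (ρ p.2)) (sq_nonneg (|H p.1| - |G (squeeze K τ p.1 - p.2)|)),
      mul_nonneg (abs_nonneg (ρ p.2)) (mul_nonneg (abs_nonneg (H p.1)) (abs_nonneg (G (squeeze K τ p.1 - p.2))))]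
  have := integral_integral_swap (f := fun x y => H x * (ρ y * G (squeeze K τ x - y))) hi
  simp_rw [integral_const_mul] at this
  rw [this]
  refine integral_congr_ae (Eventually.of_forall fun y => ?_)
  simp only
  rw [← integral_const_mul]
  refine integral_congr_ae (Eventually.of_forall fun x => ?_)
  simp only
  ring

/-- After Fubini the integral is an average, with total weight one over a shrinking ball of shifts,
of a quantity continuous in the squeeze parameter and the shift. Weak convergence is all that is
needed. -/
theorem tendsto_integral_mul_mollified_comp {K : ℝ} {G H : Plane → ℝ} (hG : MemLp G 2) (hH : MemLp H 2)
    {τ ε : ℕ → ℝ} {ρ : ℕ → Plane → ℝ} (hτ : Tendsto τ atTop (𝓝 0)) (hε : Tendsto ε atTop (𝓝 0))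
    (h1 : ∀ n, Continuous (ρ n)) (h2 : ∀ n, HasCompactSupport (ρ n)) (h3 : ∀ n y, 0 ≤ ρ n y)
    (h4 : ∀ n, ∫ y, ρ n y = 1) (h5 : ∀ n y, ρ n y ≠ 0 → ‖y‖ < ε n) :
    Tendsto (fun n => ∫ x, H x * ∫ y, ρ n y * G (squeeze K (τ n) x - y)) atTop (𝓝 (∫ x, H x * G x)) := by
  have hcont := continuous_integral_mul_comp_squeeze K hG hH
  have hmain := hcont.tendsto (0, 0)
  simp only [squeeze_zero_apply, sub_zero] at hmain
  rw [Metric.tendsto_nhds] at hmain ⊢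
  intro δ hδ
  have hδ' := hmain (δ / 2) (half_pos hδ)
  rw [nhds_prod_eq, eventually_prod_iff] at hδ'
  obtain ⟨pa, ha, pb, hb, hab⟩ := hδ'
  obtain ⟨r, hr, hrb⟩ := Metric.eventually_nhds_iff.1 hb
  filter_upwards [hτ.eventually ha, hε.eventually (gt_mem_nhds hr)] with n hn hn'
  rw [integral_mul_mollified_comp hG hH (h1 n) (h2 n)]
  set I := ∫ x, H x * G x
  have hρi : Integrable (ρ n) := (h1 n).integrable_of_hasCompactSupport (h2 n)
  set J : Plane → ℝ := fun y => ∫ x, H x * G (squeeze K (τ n) x - y)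
  have hb' : ∀ y, ‖ρ n y * (J y - I)‖ ≤ ρ n y * (δ / 2) := by
    intro y
    rw [norm_mul, Real.norm_of_nonneg (h3 n y)]
    by_cases hy : ρ n y = 0
    · simp [hy]
    · refine mul_le_mul_of_nonneg_left ?_ (h3 n y)
      have := hab hn (hrb (y := y) (by simpa using (h5 n y hy).trans hn'))
      rw [dist_eq_norm] at this
      exact this.le
  have e : ∫ y, ρ n y * J y = (∫ y, ρ n y * (J y - I)) + I := by
    have hJ : Continuous J := hcont.comp (f := fun y => (τ n, y)) (by fun_prop)
    have i1 : Integrable fun y => ρ n y * J y := ((h1 n).mul hJ).integrable_of_hasCompactSupport (h2 n).mul_right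
    simp_rw [mul_sub]
    rw [integral_sub i1 (hρi.mul_const I), integral_mul_const, h4 n]
    ring
  rw [e, dist_eq_norm, add_sub_cancel_right]
  refine (norm_integral_le_of_norm_le (hρi.mul_const (δ / 2)) (Eventually.of_forall hb')).trans_lt ?_
  rw [integral_mul_const, h4 n]
  linarith

theorem IsProfile.exists_lipschitz {F : ℝ → ℝ} (hF : IsProfile F) :
    ∃ L, 0 ≤ L ∧ ∀ x y, |F x - F y| ≤ L * |x - y| := by
  have hper : Function.Periodic (deriv F) 1 := fun x => by
    rw [← deriv_comp_add_const, show (fun x => F (x + 1)) = F from funext hF.periodic]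
  obtain ⟨C, hC⟩ := isCompact_Icc.exists_bound_of_continuousOn (s := Set.Icc (0:ℝ) 1)
    (hF.smooth.deriv_real).continuous.continuousOn
  have hb : ∀ x, ‖deriv F x‖ ≤ C := fun x => by
    obtain ⟨y, hy, hty⟩ := hper.exists_mem_Ico₀ one_pos x
    rw [hty]; exact hC y ⟨hy.1, hy.2.le⟩
  refine ⟨C, (norm_nonneg _).trans (hb 0), fun x y => ?_⟩
  exact Convex.norm_image_sub_le_of_norm_deriv_le (fun z _ => hF.smooth.differentiable (by simp) z)
    (fun z _ => hb z) convex_univ (Set.mem_univ y) (Set.mem_univ x)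

/-- Average of translates of `E` against the weight `ρ`. -/
noncomputable def mollify (ρ E : Plane → ℝ) (z : Plane) : ℝ := ∫ y, ρ y * E (z - y)

theorem mollify_eq (ρ E : Plane → ℝ) (z : Plane) : mollify ρ E z = ∫ t, E t * ρ (z - t) := by
  have := integral_sub_left_eq_self (fun t => ρ (z - t) * E t) volume z
  simp only [sub_sub_cancel] at this
  rw [mollify, this]
  simp_rw [mul_comm]

theorem mollify_eq_convolution (ρ E : Plane → ℝ) :
    mollify ρ E = E ⋆[ContinuousLinearMap.lsmul ℝ ℝ, volume] ρ := by
  funext z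
  rw [mollify_eq, convolution_lsmul]
  rfl

theorem contDiff_mollify {ρ E : Plane → ℝ} (hρ : ContDiff ℝ ∞ ρ) (hc : HasCompactSupport ρ)
    (hE : LocallyIntegrable E) : ContDiff ℝ ∞ (mollify ρ E) := by
  rw [mollify_eq_convolution]
  exact hc.contDiff_convolution_right (n := ⊤) _ hE hρ

theorem pd_mollify {ρ E : Plane → ℝ} (hρ : ContDiff ℝ ∞ ρ) (hc : HasCompactSupport ρ)
    (hE : LocallyIntegrable E) (i : Fin 2) (z : Plane) : pd i (mollify ρ E) z = ∫ t, E t * pd i ρ (z - t) := by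
  have h1 := hc.hasFDerivAt_convolution_right (ContinuousLinearMap.lsmul ℝ ℝ) hE (hρ.of_le (by norm_cast)) z
  rw [mollify_eq_convolution, pd, h1.fderiv, convolution_precompR_apply _ hE (hc.fderiv ℝ)
    (hρ.continuous_fderiv (by simp)), convolution_lsmul]
  rfl

theorem hasFDerivAt_squeeze (K τ : ℝ) (x : Plane) : HasFDerivAt (squeeze K τ)
    (Real.exp (-τ) • (EuclideanSpace.proj 0 : Plane →L[ℝ] ℝ).smulRight (EuclideanSpace.single 0 1)
      + Real.exp τ • (EuclideanSpace.proj 1 : Plane →L[ℝ] ℝ).smulRight (EuclideanSpace.single 1 1)) x := by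
  have e : squeeze K τ = fun x => (Real.exp (-τ) • (EuclideanSpace.proj 0 : Plane →L[ℝ] ℝ).smulRight (EuclideanSpace.single 0 1)
      + Real.exp τ • (EuclideanSpace.proj 1 : Plane →L[ℝ] ℝ).smulRight (EuclideanSpace.single 1 1) : Plane →L[ℝ] Plane) x
      + -(K * τ) • EuclideanSpace.single 1 1 := by
    funext x; ext i
    fin_cases i <;> simp [sub_eq_add_neg]
  rw [e]
  exact (ContinuousLinearMap.hasFDerivAt _).add_const _

theorem contDiff_squeeze (K τ : ℝ) : ContDiff ℝ ∞ (squeeze K τ) := by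
  rw [contDiff_euclidean]
  intro i
  fin_cases i
  · simpa using contDiff_const.mul (contDiff_coord 0)
  · simpa using (contDiff_const.mul (contDiff_coord 1)).sub contDiff_const

theorem pd_comp_squeeze {f : Plane → ℝ} (hf : ContDiff ℝ ∞ f) (K τ : ℝ) (x : Plane) :
    pd 0 (fun x => f (squeeze K τ x)) x = Real.exp (-τ) * pd 0 f (squeeze K τ x) ∧
    pd 1 (fun x => f (squeeze K τ x)) x = Real.exp τ * pd 1 f (squeeze K τ x) := by
  have h : HasFDerivAt (fun x => f (squeeze K τ x)) _ x :=
    (hf.differentiable (by simp) _).hasFDerivAt.comp x (hasFDerivAt_squeeze K τ x)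
  constructor <;> rw [pd, h.fderiv] <;> simp [pd]

section

variable {F : ℝ → ℝ} {u : Plane → ℝ}

theorem integral_indicator_mul_eq (hF : IsProfile F) (v ψ : Plane → ℝ) :
    ∫ t, (halfStrip F).indicator v t * ψ t = ∫ t in halfStrip F, v t * ψ t := by
  rw [← integral_indicator (isOpen_halfStrip hF.smooth.continuous).measurableSet]
  congr 1; funext t
  by_cases h : t ∈ halfStrip F <;> simp [h]

/-- Differentiating the mollification tests the zero extension of `u` with `fun t => ρ (z - t)`. The
trace condition admits this function once its support avoids the lateral sides, even if it crosses
Γ. -/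
theorem VanishesOnBottom.pd_mollify_eq (hF : IsProfile F) (hv : VanishesOnBottom F u)
    (hu : MemLp u 2 (volume.restrict (halfStrip F))) {ρ : Plane → ℝ} {ε : ℝ}
    (hρ : ContDiff ℝ ∞ ρ) (hc : HasCompactSupport ρ) (hs : ∀ y, ρ y ≠ 0 → ‖y‖ < ε) {z : Plane}
    (hz : |z 0| + ε < 1 / 2) (i : Fin 2) :
    pd i (mollify ρ ((halfStrip F).indicator u)) z = mollify ρ ((halfStrip F).indicator (pd i u)) z := by
  have hO := isOpen_halfStrip hF.smooth.continuous
  have hE : LocallyIntegrable ((halfStrip F).indicator u) :=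
    ((memLp_indicator_iff_restrict hO.measurableSet).2 hu).locallyIntegrable (by norm_num)
  rw [pd_mollify hρ hc hE, mollify_eq, integral_indicator_mul_eq hF, integral_indicator_mul_eq hF]
  have hcomp : ContDiff ℝ ∞ fun t : Plane => ρ (z - t) := hρ.comp (contDiff_const.sub contDiff_id)
  have hk := hv (fun t => ρ (z - t)) hcomp
    (hc.comp_homeomorph (Homeomorph.subLeft z)) ?_ (EuclideanSpace.single i 1)
  · have e : ∀ t, fderiv ℝ (fun t => ρ (z - t)) t (EuclideanSpace.single i 1) = -pd i ρ (z - t) := fun t => by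
      have h1 : HasFDerivAt (fun t => ρ (z - t)) _ t :=
        (hρ.differentiable (by simp) (z - t)).hasFDerivAt.comp t ((hasFDerivAt_id t).const_sub z)
      rw [h1.fderiv]; simp [pd]
    simp_rw [e, mul_neg, integral_neg, neg_inj] at hk
    exact hk
  · have hsub : tsupport (fun t => ρ (z - t)) ⊆ Metric.closedBall z ε := by
      refine closure_minimal (fun t ht => ?_) Metric.isClosed_closedBall
      rw [Metric.mem_closedBall, dist_comm, dist_eq_norm]
      exact (hs _ ht).le
    intro t ht
    have h1 := hsub ht
    rw [Metric.mem_closedBall, dist_eq_norm] at h1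
    have h2 := (PiLp.norm_apply_le (t - z) 0).trans h1
    simp only [PiLp.sub_apply, Real.norm_eq_abs] at h2
    have h3 := abs_le.1 h2
    have h4 := abs_lt.1 (show |z 0| < 1 / 2 - ε by linarith)
    exact ⟨by linarith, by linarith⟩

theorem one_sub_exp_neg_bounds {τ : ℝ} (h0 : 0 < τ) (h1 : τ ≤ 1 / 2) :
    τ / 2 ≤ 1 - Real.exp (-τ) ∧ 1 - Real.exp (-τ) ≤ τ ∧ 1 ≤ Real.exp τ ∧ Real.exp τ ≤ 2 := by
  have a1 := Real.add_one_le_exp τ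
  have a2 := Real.add_one_le_exp (-τ)
  have a3 : Real.exp (-τ) * Real.exp τ = 1 := by rw [← Real.exp_add]; simp
  have a4 := Real.exp_pos (-τ)
  have a5 := Real.exp_pos τ
  refine ⟨?_, by linarith, by linarith, ?_⟩
  · nlinarith
  · nlinarith

/-- The downward shift by (3L + 2)τ beats all errors: the horizontal displacement is at most 3τ,
which changes F by at most 3Lτ, and mollification moves points by less than τ/8. The stretch only
helps because F is negative, so the support stays at least τ/4 above the graph. -/
theorem isTest_mollify_squeeze (hF : IsProfile F) {L : ℝ} (hL0 : 0 ≤ L) (hL : ∀ x y, |F x - F y| ≤ L * |x - y|)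
    (hu : MemLp u 2 (volume.restrict (halfStrip F))) {R : ℝ} (hR : 0 ≤ R)
    (huR : ∀ ξ ∈ halfStrip F, R ≤ ξ 1 → u ξ = 0) {τ : ℝ} (hτ : 0 < τ) (hτ1 : (3 * L + 3) * τ ≤ 1 / 2)
    {ρ : Plane → ℝ} (hρ : ContDiff ℝ ∞ ρ) (hc : HasCompactSupport ρ) (hs : ∀ y, ρ y ≠ 0 → ‖y‖ < τ / 8) :
    IsTest (aboveGraph F ∩ {ξ | ξ 1 < R + 1})
      fun x => mollify ρ ((halfStrip F).indicator u) (squeeze (3 * L + 2) τ x) := by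
  have hO := isOpen_halfStrip hF.smooth.continuous
  have hE : LocallyIntegrable ((halfStrip F).indicator u) :=
    ((memLp_indicator_iff_restrict hO.measurableSet).2 hu).locallyIntegrable (by norm_num)
  have hτ2 : τ ≤ 1 / 2 := by nlinarith
  obtain ⟨b1, b2, b3, b4⟩ := one_sub_exp_neg_bounds hτ hτ2
  have a3 : Real.exp (-τ) * Real.exp τ = 1 := by rw [← Real.exp_add]; simp
  set φ := fun x => mollify ρ ((halfStrip F).indicator u) (squeeze (3 * L + 2) τ x)
  have key : ∀ x, φ x ≠ 0 → |x 0| ≤ 2 ∧ F (x 0) + τ / 4 ≤ x 1 ∧ x 1 ≤ R + 1 / 2 := by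
    intro x hx
    obtain ⟨t, ht⟩ : ∃ t, (halfStrip F).indicator u t * ρ (squeeze (3 * L + 2) τ x - t) ≠ 0 := by
      by_contra! hcon
      refine hx ?_
      simp only [φ]
      rw [mollify_eq]
      simp [hcon]
    have ht1 : t ∈ halfStrip F := by
      by_contra h; simp [h] at ht
    have ht2 : t 1 < R := by
      by_contra! h; simp [huR t ht1 h, ht1] at ht
    have ht3 := hs _ (right_ne_zero_of_mul ht)
    have c0 := (PiLp.norm_apply_le (squeeze (3 * L + 2) τ x - t) 0).trans_lt ht3
    have c1 := (PiLp.norm_apply_le (squeeze (3 * L + 2) τ x - t) 1).trans_lt ht3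
    simp only [PiLp.sub_apply, squeeze_apply_zero, squeeze_apply_one, Real.norm_eq_abs] at c0 c1
    have d0 := abs_lt.1 c0
    have d1 := abs_lt.1 c1
    have t0 : |t 0| < 1 / 2 := abs_lt.2 ⟨ht1.1, ht1.2.1⟩
    have hx0 : |x 0| ≤ 2 := by
      have e1 : |Real.exp (-τ) * x 0| ≤ 1 := by
        have := abs_sub_abs_le_abs_sub (Real.exp (-τ) * x 0) (t 0)
        linarith
      rw [abs_mul, abs_of_pos (Real.exp_pos _)] at e1
      nlinarith [abs_nonneg (x 0)]
    refine ⟨hx0, ?_, ?_⟩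
    · have e1 : |x 0 - t 0| ≤ 3 * τ := by
        have e2 : x 0 - t 0 = (1 - Real.exp (-τ)) * x 0 + (Real.exp (-τ) * x 0 - t 0) := by ring
        have e3 : |(1 - Real.exp (-τ)) * x 0| ≤ τ * 2 := by
          rw [abs_mul, abs_of_nonneg (by linarith)]
          exact mul_le_mul b2 hx0 (abs_nonneg _) hτ.le
        rw [e2]
        refine (abs_add_le _ _).trans ?_
        linarith
      have e4 := (abs_le.1 ((hL (x 0) (t 0)).trans (mul_le_mul_of_nonneg_left e1 hL0))).2
      have e5 := ht1.2.2
      have e6 : F (x 0) * Real.exp τ ≤ F (x 0) := by nlinarith [hF.neg (x 0)]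
      have e7 : (F (x 0) + τ / 4) * Real.exp τ ≤ Real.exp τ * x 1 := by nlinarith
      rw [mul_comm] at e7
      exact le_of_mul_le_mul_left e7 (Real.exp_pos τ)
    · rcases le_total (x 1) 0 with h | h
      · linarith
      · have : x 1 ≤ Real.exp τ * x 1 := le_mul_of_one_le_left h b3
        nlinarith
  have hcl : IsClosed {x : Plane | F (x 0) + τ / 4 ≤ x 1 ∧ x 1 ≤ R + 1 / 2} := by
    have h0 : Continuous fun ξ : Plane => ξ 0 := by fun_prop
    have h1 : Continuous fun ξ : Plane => ξ 1 := by fun_prop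
    exact (isClosed_le ((hF.smooth.continuous.comp h0).add continuous_const) h1).inter
      (isClosed_le h1 continuous_const)
  obtain ⟨M, -, hM⟩ := hF.exists_lower_bound
  refine ⟨(contDiff_mollify hρ hc hE).comp (contDiff_squeeze _ _), ?_, ?_⟩
  · refine HasCompactSupport.of_support_subset_isCompact
      (((isCompact_Icc (a := (-2 : ℝ)) (b := 2)).prod (isCompact_Icc (a := -M) (b := R + 1 / 2))).image continuous_plane)
      fun x hx => ?_
    obtain ⟨k1, k2, k3⟩ := key x hx
    have := hM (x 0)
    refine ⟨(x 0, x 1), ⟨abs_le.1 k1, by simp only; linarith, k3⟩, ?_⟩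
    ext i; fin_cases i <;> simp
  · refine (closure_minimal (fun x hx => (key x hx).2) hcl).trans fun x hx => ⟨?_, ?_⟩
    · have := hx.1
      show F (x 0) < x 1
      linarith
    · have := hx.2
      show x 1 < R + 1
      linarith

/-- A function with zero trace on the bottom is a valid test function for weak equations tested
with smooth functions supported away from the bottom. -/
theorem VanishesOnBottom.integral_eq_zero_of_tests (hF : IsProfile F) (hv : VanishesOnBottom F u)
    (hu : MemLp u 2 (volume.restrict (halfStrip F)))
    (hpu : ∀ i, MemLp (pd i u) 2 (volume.restrict (halfStrip F))) {R : ℝ} (hR : 0 ≤ R)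
    (huR : ∀ ξ ∈ halfStrip F, R ≤ ξ 1 → u ξ = 0) {H : Fin 2 → Plane → ℝ}
    (hH : ∀ i, MemLp (H i) 2 (volume.restrict (halfStrip F)))
    (h : ∀ φ, IsTest (aboveGraph F ∩ {ξ | ξ 1 < R + 1}) φ →
      (∫ ξ in halfStrip F, H 0 ξ * pd 0 φ ξ) + ∫ ξ in halfStrip F, H 1 ξ * pd 1 φ ξ = 0) :
    (∫ ξ in halfStrip F, H 0 ξ * pd 0 u ξ) + ∫ ξ in halfStrip F, H 1 ξ * pd 1 u ξ = 0 := by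
  have hO := isOpen_halfStrip hF.smooth.continuous
  obtain ⟨L, hL0, hL⟩ := hF.exists_lipschitz
  -- Normalised so that (3L + 3)τ ≤ 1/2, the smallness required by `isTest_mollify_squeeze`.
  set τ : ℕ → ℝ := fun n => 1 / (6 * L + 6) * (1 / ((n : ℝ) + 1)) with hτ
  have hτ0 : ∀ n, 0 < τ n := fun n => by simp only [hτ]; positivity
  have hτ1 : ∀ n, (3 * L + 3) * τ n ≤ 1 / 2 := fun n => by
    have e : (3 * L + 3) * τ n = 1 / 2 * (1 / ((n : ℝ) + 1)) := by
      simp only [hτ]; field_simp; ring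
    rw [e]
    have : 1 / ((n : ℝ) + 1) ≤ 1 := by
      rw [div_le_one (by positivity)]; linarith [(Nat.cast_nonneg n : (0:ℝ) ≤ n)]
    linarith
  have hτl : Tendsto τ atTop (𝓝 0) := by
    have := tendsto_one_div_add_atTop_nhds_zero_nat (𝕜 := ℝ) |>.const_mul (1 / (6 * L + 6))
    simpa [hτ] using this
  have hεl : Tendsto (fun n => τ n / 8) atTop (𝓝 0) := by simpa using hτl.div_const 8
  choose ρ r1 r2 r3 r4 r5 using fun n => exists_mollifier (show 0 < τ n / 8 by linarith [hτ0 n])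
  set G : Fin 2 → Plane → ℝ := fun i => (halfStrip F).indicator (pd i u)
  set J : Fin 2 → Plane → ℝ := fun i => (halfStrip F).indicator (H i)
  have hG : ∀ i, MemLp (G i) 2 := fun i => (memLp_indicator_iff_restrict hO.measurableSet).2 (hpu i)
  have hJ : ∀ i, MemLp (J i) 2 := fun i => (memLp_indicator_iff_restrict hO.measurableSet).2 (hH i)
  have lim := fun i => tendsto_integral_mul_mollified_comp (K := 3 * L + 2) (hG i) (hJ i) hτl hεl
    (fun n => (r1 n).continuous) r2 r3 r4 r5
  have hE : LocallyIntegrable ((halfStrip F).indicator u) :=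
    ((memLp_indicator_iff_restrict hO.measurableSet).2 hu).locallyIntegrable (by norm_num)
  have hexp : ∀ s : ℝ, Tendsto (fun n => Real.exp (s * τ n)) atTop (𝓝 1) := fun s => by
    have := (Real.continuous_exp.tendsto 0).comp (by simpa using hτl.const_mul s : Tendsto (fun n => s * τ n) atTop (𝓝 0))
    simpa [Function.comp_def] using this
  have hfin : ∀ i, ∫ x, J i x * G i x = ∫ ξ in halfStrip F, H i ξ * pd i u ξ := fun i => by
    rw [integral_indicator_mul_eq hF]
    exact setIntegral_congr_fun hO.measurableSet fun ξ hξ => by simp only [G, Set.indicator_of_mem hξ]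
  have hz : ∀ n, Real.exp (-1 * τ n) * (∫ x, J 0 x * ∫ y, ρ n y * G 0 (squeeze (3 * L + 2) (τ n) x - y))
      + Real.exp (1 * τ n) * (∫ x, J 1 x * ∫ y, ρ n y * G 1 (squeeze (3 * L + 2) (τ n) x - y)) = 0 := by
    intro n
    have ht := isTest_mollify_squeeze hF hL0 hL hu hR huR (hτ0 n) (hτ1 n) (r1 n) (r2 n) (r5 n)
    rw [← h _ ht, neg_one_mul, one_mul, ← integral_const_mul, ← integral_const_mul]
    -- The squeeze pulls the strip away from its sides by at least τ/4, more than the mollification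
    -- radius τ/8.
    have hlat : ∀ ξ ∈ halfStrip F, |squeeze (3 * L + 2) (τ n) ξ 0| + τ n / 8 < 1 / 2 := by
      intro ξ hξ
      have hτ2 : τ n ≤ 1 / 2 := by nlinarith [hτ0 n, hτ1 n]
      obtain ⟨b1, -⟩ := one_sub_exp_neg_bounds (hτ0 n) hτ2
      have : |ξ 0| < 1 / 2 := abs_lt.2 ⟨hξ.1, hξ.2.1⟩
      rw [squeeze_apply_zero, abs_mul, abs_of_pos (Real.exp_pos _)]
      nlinarith [Real.exp_pos (-τ n), hτ0 n, abs_nonneg (ξ 0)]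
    have hpt := fun ξ => pd_comp_squeeze (contDiff_mollify (r1 n) (r2 n) hE) (3 * L + 2) (τ n) ξ
    have hm := fun i ξ (hξ : ξ ∈ halfStrip F) =>
      hv.pd_mollify_eq hF hu (r1 n) (r2 n) (r5 n) (hlat ξ hξ) i
    congr 1
    · rw [← integral_indicator hO.measurableSet]
      congr 1; funext ξ
      by_cases hξ : ξ ∈ halfStrip F
      · simp only [J, Set.indicator_of_mem hξ]
        rw [(hpt ξ).1, hm 0 ξ hξ, mollify]
        ring
      · simp [J, hξ]
    · rw [← integral_indicator hO.measurableSet]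
      congr 1; funext ξ
      by_cases hξ : ξ ∈ halfStrip F
      · simp only [J, Set.indicator_of_mem hξ]
        rw [(hpt ξ).2, hm 1 ξ hξ, mollify]
        ring
      · simp [J, hξ]
  -- The chain rule factors e^{-τ} and e^{τ} tend to 1, so the tested identity survives in the
  -- limit.
  have := ((hexp (-1)).mul (lim 0)).add ((hexp 1).mul (lim 1))
  have h0 := tendsto_nhds_unique (this.congr hz) tendsto_const_nhds
  rwa [one_mul, one_mul, hfin, hfin] at h0

end

/-! ### The energy identity and uniqueness -/

/-- A smooth cutoff equal to `1` for `t ≤ R` and to `0` for `t ≥ R + 1`. -/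
noncomputable def topCutoff (R t : ℝ) : ℝ := 1 - Real.smoothTransition (t - R)

theorem contDiff_topCutoff (R : ℝ) : ContDiff ℝ ∞ (topCutoff R) :=
  contDiff_const.sub ((Real.smoothTransition.contDiff (n := ⊤)).comp (contDiff_id.sub contDiff_const))

theorem topCutoff_eq_one {R t : ℝ} (h : t ≤ R) : topCutoff R t = 1 := by
  rw [topCutoff, Real.smoothTransition.zero_of_nonpos (by linarith), sub_zero]

theorem topCutoff_eq_zero {R t : ℝ} (h : R + 1 ≤ t) : topCutoff R t = 0 := by
  rw [topCutoff, Real.smoothTransition.one_of_one_le (by linarith), sub_self]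

theorem topCutoff_nonneg (R t : ℝ) : 0 ≤ topCutoff R t := by
  have := Real.smoothTransition.le_one (t - R)
  rw [topCutoff]; linarith

theorem deriv_topCutoff (R t : ℝ) : deriv (topCutoff R) t = -deriv Real.smoothTransition (t - R) := by
  have h1 : HasDerivAt (fun t => Real.smoothTransition (t - R)) (deriv Real.smoothTransition (t - R)) t :=
    ((Real.smoothTransition.contDiff (n := ⊤)).differentiable (by simp) (t - R)).hasDerivAt.comp_sub_const t R
  have h : HasDerivAt (topCutoff R) (-deriv Real.smoothTransition (t - R)) t := h1.const_sub 1
  exact h.deriv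

theorem deriv_topCutoff_eq_zero {R t : ℝ} (h : t ∉ Set.Icc R (R + 1)) : deriv (topCutoff R) t = 0 := by
  rw [Set.mem_Icc, not_and_or, not_le, not_le] at h
  rcases h with h | h
  · have : topCutoff R =ᶠ[𝓝 t] fun _ => 1 := by
      filter_upwards [gt_mem_nhds h] with s hs using topCutoff_eq_one hs.le
    rw [this.deriv_eq, deriv_const]
  · rw [deriv_topCutoff, deriv_smoothTransition_eq_zero (by linarith), neg_zero]

section

variable {F : ℝ → ℝ}

theorem setIntegral_halfStrip_eq_slice (hF : IsProfile F) {g : Plane → ℝ} {R : ℝ} (hR : 0 < R)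
    (hg : ∀ ξ ∈ halfStrip F, ξ 1 ∉ Set.Icc R (R + 1) → g ξ = 0) (hi : IntegrableOn g (halfStrip F)) :
    ∫ ξ in halfStrip F, g ξ = ∫ t in Set.Icc R (R + 1), sliceInt g t := by
  have hsub : straightStrip ∩ {ξ | ξ 1 ∈ Set.Icc R (R + 1)} ⊆ halfStrip F :=
    Set.inter_subset_left.trans (straightStrip_subset_halfStrip hF)
  rw [← (setIntegral_straightStrip_slice (fun t ht => hR.trans_le ht.1) (hi.mono_set hsub)).2]
  refine setIntegral_eq_of_subset_of_forall_sdiff_eq_zero (isOpen_halfStrip hF.smooth.continuous).measurableSet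
    hsub fun ξ hξ => hg ξ hξ.1 fun h => hξ.2 ⟨⟨hξ.1.1, hξ.1.2.1, hR.trans_le h.1⟩, h⟩

theorem memLp_halfStrip_of_truncation (hF : IsProfile F) {v : Plane → ℝ} {R : ℝ}
    (hv : MemLp v 2 (volume.restrict (truncation F R))) (h : ∀ ξ ∈ halfStrip F, R ≤ ξ 1 → v ξ = 0) :
    MemLp v 2 (volume.restrict (halfStrip F)) := by
  have hO := isOpen_halfStrip hF.smooth.continuous
  have hT := (isOpen_truncation hF R).measurableSet
  have h1 : MemLp ((truncation F R).indicator v) 2 (volume.restrict (halfStrip F)) := by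
    rw [memLp_indicator_iff_restrict hT, Measure.restrict_restrict hT,
      Set.inter_eq_left.2 (show truncation F R ⊆ halfStrip F from Set.inter_subset_left)]
    exact hv
  refine h1.ae_eq ?_
  filter_upwards [ae_restrict_mem hO.measurableSet] with ξ hξ
  by_cases hξR : ξ 1 < R
  · rw [Set.indicator_of_mem (show ξ ∈ truncation F R from ⟨hξ, hξR⟩)]
  · rw [Set.indicator_of_notMem fun h' : ξ ∈ truncation F R => hξR h'.2, h ξ hξ (not_lt.1 hξR)]

theorem isPreconnected_halfStrip (hF : IsProfile F) : IsPreconnected (halfStrip F) := by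
  have h1 : IsPreconnected (Set.Ioo (-(1 / 2) : ℝ) (1 / 2) ×ˢ Set.Ioi (0 : ℝ)) :=
    isPreconnected_Ioo.prod isPreconnected_Ioi
  have hc : Continuous fun p : ℝ × ℝ => (!₂[p.1, F p.1 + p.2] : Plane) :=
    continuous_plane.comp (f := fun p : ℝ × ℝ => (p.1, F p.1 + p.2))
      (continuous_fst.prodMk ((hF.smooth.continuous.comp continuous_fst).add continuous_snd))
  convert h1.image _ hc.continuousOn using 1
  ext ξ
  constructor
  · intro h
    refine ⟨(ξ 0, ξ 1 - F (ξ 0)), ⟨⟨h.1, h.2.1⟩, sub_pos.2 h.2.2⟩, ?_⟩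
    ext i; fin_cases i <;> simp
  · rintro ⟨p, ⟨⟨h1, h2⟩, h3⟩, rfl⟩
    refine ⟨by simpa using h1, by simpa using h2, ?_⟩
    have : 0 < p.2 := h3
    simpa using this

/-- The cut off function `χ(ξ₂) D` together with its square integrability and zero trace. -/
theorem VanishesOnBottom.mul_topCutoff (hF : IsProfile F) {D : Plane → ℝ} (hs : ContDiffOn ℝ ∞ D (halfStrip F))
    (he : HasLocalEnergy F D) (hv : VanishesOnBottom F D) (R : ℝ) :
    VanishesOnBottom F (fun ξ => topCutoff R (ξ 1) * D ξ) ∧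
    MemLp (fun ξ => topCutoff R (ξ 1) * D ξ) 2 (volume.restrict (halfStrip F)) ∧
    (∀ i, MemLp (pd i fun ξ => topCutoff R (ξ 1) * D ξ) 2 (volume.restrict (halfStrip F))) ∧
    ∀ ξ ∈ halfStrip F, pd 0 (fun ξ => topCutoff R (ξ 1) * D ξ) ξ = topCutoff R (ξ 1) * pd 0 D ξ ∧
      pd 1 (fun ξ => topCutoff R (ξ 1) * D ξ) ξ = topCutoff R (ξ 1) * pd 1 D ξ + deriv (topCutoff R) (ξ 1) * D ξ := by
  have hO := isOpen_halfStrip hF.smooth.continuous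
  have hq := contDiff_topCutoff R
  have hχ : ContDiff ℝ ∞ fun ξ : Plane => topCutoff R (ξ 1) := hq.comp (contDiff_coord 1)
  have hχ' : Continuous fun ξ : Plane => deriv (topCutoff R) (ξ 1) :=
    (hq.deriv_real.comp (contDiff_coord 1)).continuous
  have hdq : ∀ ξ : Plane, HasDerivAt (topCutoff R) (deriv (topCutoff R) (ξ 1)) (ξ 1) :=
    fun ξ => (hq.differentiable (by simp) _).hasDerivAt
  have hd : ∀ ξ ∈ halfStrip F, DifferentiableAt ℝ D ξ := fun ξ hξ =>
    (hs.contDiffAt (hO.mem_nhds hξ)).differentiableAt (by simp)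
  have hpd : ∀ ξ ∈ halfStrip F, pd 0 (fun ξ => topCutoff R (ξ 1) * D ξ) ξ = topCutoff R (ξ 1) * pd 0 D ξ ∧
      pd 1 (fun ξ => topCutoff R (ξ 1) * D ξ) ξ = topCutoff R (ξ 1) * pd 1 D ξ + deriv (topCutoff R) (ξ 1) * D ξ := by
    intro ξ hξ
    have p := pd_fun_coord (hdq ξ)
    have m := pd_mul (hχ.differentiable (by simp) ξ) (hd ξ hξ)
    constructor
    · rw [m 0, p.1]; ring
    · rw [m 1, p.2]; ring
  have hbd : ∃ C, ∀ t, |deriv (topCutoff R) t| ≤ C := by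
    obtain ⟨C, -, hC⟩ := exists_deriv_smoothTransition_bound
    exact ⟨C, fun t => by rw [deriv_topCutoff, abs_neg]; exact hC _⟩
  obtain ⟨C, hC⟩ := hbd
  have hχ1 : ∀ t, |topCutoff R t| ≤ 1 := fun t => by
    rw [abs_of_nonneg (topCutoff_nonneg R t), topCutoff]
    linarith [Real.smoothTransition.nonneg (t - R)]
  have hmul : ∀ {g : Plane → ℝ}, MemLp g 2 (volume.restrict (truncation F (R + 1))) →
      MemLp (fun ξ => topCutoff R (ξ 1) * g ξ) 2 (volume.restrict (truncation F (R + 1))) := fun hg => by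
    refine hg.of_le (hχ.continuous.aestronglyMeasurable.mul hg.1) (Eventually.of_forall fun ξ => ?_)
    rw [norm_mul]
    exact mul_le_of_le_one_left (norm_nonneg _) (hχ1 _)
  have hmul' : MemLp (fun ξ => deriv (topCutoff R) (ξ 1) * D ξ) 2 (volume.restrict (truncation F (R + 1))) := by
    refine MemLp.of_le_mul (c := C) (he (R + 1)).1 (hχ'.aestronglyMeasurable.mul (he (R + 1)).1.1)
      (Eventually.of_forall fun ξ => ?_)
    rw [norm_mul]
    exact mul_le_mul_of_nonneg_right (hC _) (norm_nonneg _)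
  have hz : ∀ ξ : Plane, R + 1 < ξ 1 → deriv (topCutoff R) (ξ 1) = 0 := fun ξ h =>
    deriv_topCutoff_eq_zero fun h' => absurd h'.2 (not_le.2 h)
  have hz' : ∀ ξ : Plane, R + 1 ≤ ξ 1 → deriv (topCutoff R) (ξ 1) = 0 := fun ξ h => by
    rcases h.lt_or_eq with h | h
    · exact hz ξ h
    · have := closure_minimal (s := Set.Ioi (R + 1)) (t := {t | deriv (topCutoff R) t = 0})
        (fun t ht => deriv_topCutoff_eq_zero fun h' => absurd h'.2 (not_le.2 ht))
        (isClosed_eq hq.deriv_real.continuous continuous_const)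
      rw [closure_Ioi] at this
      exact this h.le
  refine ⟨?_, memLp_halfStrip_of_truncation hF (hmul (he (R + 1)).1) fun ξ _ h => by
    rw [topCutoff_eq_zero h, zero_mul], ?_, hpd⟩
  · intro ψ h1 h2 h3 v
    have hψ : IsTest strip ψ := ⟨h1, h2, h3⟩
    have ht := hψ.mul_left hχ
    -- The trace condition for `D` is used with the cutoff moved onto the test function; the
    -- derivative of the cutoff then yields the same extra term on both sides.
    have k := hv _ ht.smooth ht.compact ht.supp v
    have hfd : ∀ ξ : Plane, HasFDerivAt (fun ξ : Plane => topCutoff R (ξ 1)) (fderiv ℝ (fun ξ : Plane => topCutoff R (ξ 1)) ξ) ξ :=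
      fun ξ => (hχ.differentiable (by simp) ξ).hasFDerivAt
    set δ : Plane → ℝ := fun ξ => fderiv ℝ (fun ξ : Plane => topCutoff R (ξ 1)) ξ v with hδ
    have hδc : Continuous δ := (hχ.continuous_fderiv (by simp)).clm_apply continuous_const
    have hψv : Continuous fun ξ => fderiv ℝ ψ ξ v := (h1.continuous_fderiv (by simp)).clm_apply continuous_const
    have hψvc : HasCompactSupport fun ξ => fderiv ℝ ψ ξ v := (h2.fderiv ℝ).comp_left (g := fun L : Plane →L[ℝ] ℝ => L v) rfl
    have e1 : ∀ ξ, fderiv ℝ (fun ξ => topCutoff R (ξ 1) * ψ ξ) ξ v = topCutoff R (ξ 1) * fderiv ℝ ψ ξ v + δ ξ * ψ ξ := by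
      intro ξ
      have : HasFDerivAt (fun ξ => topCutoff R (ξ 1) * ψ ξ) _ ξ := (hfd ξ).mul (h1.differentiable (by simp) ξ).hasFDerivAt
      rw [this.fderiv]; simp [hδ]; ring
    have e2 : ∀ ξ ∈ halfStrip F, fderiv ℝ (fun ξ => topCutoff R (ξ 1) * D ξ) ξ v
        = topCutoff R (ξ 1) * fderiv ℝ D ξ v + δ ξ * D ξ := by
      intro ξ hξ
      have : HasFDerivAt (fun ξ => topCutoff R (ξ 1) * D ξ) _ ξ := (hfd ξ).mul (hd ξ hξ).hasFDerivAt
      rw [this.fderiv]; simp [hδ]; ring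
    have i1 : IntegrableOn (fun ξ => D ξ * (topCutoff R (ξ 1) * fderiv ℝ ψ ξ v)) (halfStrip F) :=
      integrableOn_mul_of_truncation hF (fun R => (he R).1) (hχ.continuous.mul hψv) hψvc.mul_left
    have i2 : IntegrableOn (fun ξ => D ξ * (δ ξ * ψ ξ)) (halfStrip F) :=
      integrableOn_mul_of_truncation hF (fun R => (he R).1) (hδc.mul h1.continuous) h2.mul_left
    have hDv : ∀ R, MemLp (fun ξ => fderiv ℝ D ξ v) 2 (volume.restrict (truncation F R)) := fun R => by
      have e : (fun ξ => fderiv ℝ D ξ v) = fun ξ => v 0 * pd 0 D ξ + v 1 * pd 1 D ξ := funext fun ξ => fderiv_eq_pd _ _ _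
      rw [e]
      exact ((he.memLp_pd 0 R).const_mul _).add ((he.memLp_pd 1 R).const_mul _)
    have i3 : IntegrableOn (fun ξ => fderiv ℝ D ξ v * (topCutoff R (ξ 1) * ψ ξ)) (halfStrip F) :=
      integrableOn_mul_of_truncation hF hDv (hχ.continuous.mul h1.continuous) h2.mul_left
    have l : ∫ ξ in halfStrip F, topCutoff R (ξ 1) * D ξ * fderiv ℝ ψ ξ v
        = (∫ ξ in halfStrip F, D ξ * fderiv ℝ (fun ξ => topCutoff R (ξ 1) * ψ ξ) ξ v)
          - ∫ ξ in halfStrip F, D ξ * (δ ξ * ψ ξ) := by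
      simp_rw [e1, mul_add]
      rw [integral_add i1 i2, add_sub_cancel_right]
      refine integral_congr_ae (Eventually.of_forall fun ξ => ?_)
      simp only; ring
    have r : ∫ ξ in halfStrip F, fderiv ℝ (fun ξ => topCutoff R (ξ 1) * D ξ) ξ v * ψ ξ
        = (∫ ξ in halfStrip F, fderiv ℝ D ξ v * (topCutoff R (ξ 1) * ψ ξ))
          + ∫ ξ in halfStrip F, D ξ * (δ ξ * ψ ξ) := by
      rw [← integral_add i3 i2]
      refine setIntegral_congr_fun hO.measurableSet fun ξ hξ => ?_
      simp only [e2 ξ hξ]; ring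
    rw [l, r, k]; ring
  · intro i
    have hcongr : ∀ {g : Plane → ℝ}, Set.EqOn g (pd i fun ξ => topCutoff R (ξ 1) * D ξ) (halfStrip F) →
        MemLp g 2 (volume.restrict (halfStrip F)) →
        MemLp (pd i fun ξ => topCutoff R (ξ 1) * D ξ) 2 (volume.restrict (halfStrip F)) := fun hg hm => by
      refine hm.ae_eq ?_
      filter_upwards [ae_restrict_mem hO.measurableSet] with ξ hξ using hg hξ
    fin_cases i
    · exact hcongr (fun ξ hξ => (hpd ξ hξ).1.symm)
        (memLp_halfStrip_of_truncation hF (hmul (he.memLp_pd 0 (R + 1))) fun ξ _ h => by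
          rw [topCutoff_eq_zero h, zero_mul])
    · exact hcongr (fun ξ hξ => (hpd ξ hξ).2.symm)
        (memLp_halfStrip_of_truncation hF ((hmul (he.memLp_pd 1 (R + 1))).add hmul') fun ξ _ h => by
          simp only
          rw [topCutoff_eq_zero h, zero_mul, hz' ξ h, zero_mul, add_zero])

end

section

variable {F : ℝ → ℝ} {D : Plane → ℝ}

/-- Zero trace allows `D` times the cutoff to be inserted in the weak equation. Besides the cut off
energy, only the term with the derivative of the cutoff remains, and it lives in the band R ≤ ξ₂ ≤ R
+ 1. -/
theorem integral_topCutoff_energy (hF : IsProfile F) (hs : ContDiffOn ℝ ∞ D (halfStrip F))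
    (he : HasLocalEnergy F D) (hv : VanishesOnBottom F D) (hn : WeakNeumannEq F (fun _ => 0) D)
    {R : ℝ} (hR : 0 < R) :
    ∫ ξ in halfStrip F, topCutoff R (ξ 1) * (pd 0 D ξ ^ 2 + pd 1 D ξ ^ 2)
      = -∫ t in Set.Icc R (R + 1), sliceInt (fun ξ => deriv (topCutoff R) (ξ 1) * D ξ * pd 1 D ξ) t := by
  have hO := isOpen_halfStrip hF.smooth.continuous
  obtain ⟨k1, k2, k3, k4⟩ := hv.mul_topCutoff hF hs he R
  have hm : MeasurableSet {ξ : Plane | ξ 1 < R + 1 + 1} :=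
    (isOpen_lt (contDiff_coord 1).continuous continuous_const).measurableSet
  -- Truncation makes ∇D globally square integrable. Height R + 2 suffices: the cut off function
  -- vanishes above R + 1, and its approximating test functions reach at most one unit higher.
  set H : Fin 2 → Plane → ℝ := fun i => {ξ : Plane | ξ 1 < R + 1 + 1}.indicator (pd i D) with hHdef
  have hH : ∀ i, MemLp (H i) 2 (volume.restrict (halfStrip F)) := fun i => by
    rw [hHdef, memLp_indicator_iff_restrict hm, Measure.restrict_restrict hm, Set.inter_comm]
    exact he.memLp_pd i (R + 1 + 1)
  have hHmul : ∀ i (g : Plane → ℝ), (∀ ξ ∈ halfStrip F, R + 1 + 1 ≤ ξ 1 → g ξ = 0) →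
      ∀ ξ ∈ halfStrip F, H i ξ * g ξ = pd i D ξ * g ξ := by
    intro i g hg ξ hξ
    by_cases h : ξ 1 < R + 1 + 1
    · rw [hHdef]; simp only; rw [Set.indicator_of_mem (show ξ ∈ {ξ : Plane | ξ 1 < R + 1 + 1} from h)]
    · rw [hg ξ hξ (not_lt.1 h), mul_zero, mul_zero]
  have key := k1.integral_eq_zero_of_tests hF k2 k3 (R := R + 1) (by linarith)
    (fun ξ _ h => by rw [topCutoff_eq_zero h, zero_mul]) hH fun φ hφ => by
      have hφ' : IsTest (aboveGraph F) φ := hφ.mono Set.inter_subset_left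
      have hz : ∀ i ξ, R + 1 + 1 ≤ ξ 1 → pd i φ ξ = 0 := fun i ξ h =>
        (hφ.pd i).eq_zero fun h' => absurd h'.2 (not_lt.2 h)
      have e : ∀ i, ∫ ξ in halfStrip F, H i ξ * pd i φ ξ = ∫ ξ in halfStrip F, pd i D ξ * pd i φ ξ := fun i =>
        setIntegral_congr_fun hO.measurableSet (hHmul i (pd i φ) fun ξ _ h => hz i ξ h)
      have i2 := fun i => integrableOn_mul_of_truncation hF (he.memLp_pd i) (hφ.pd i).smooth.continuous (hφ.pd i).compact
      rw [e, e, ← integral_add (i2 0) (i2 1)]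
      have := hn φ hφ'.smooth hφ'.compact hφ'.supp
      simpa only [inner_gradient, zero_mul, integral_zero, neg_zero] using this
  have hv0 : ∀ ξ ∈ halfStrip F, R + 1 + 1 ≤ ξ 1 → topCutoff R (ξ 1) = 0 ∧ deriv (topCutoff R) (ξ 1) = 0 :=
    fun ξ _ h => ⟨topCutoff_eq_zero (by linarith), deriv_topCutoff_eq_zero fun h' => by linarith [h'.2]⟩
  have j := fun i => (hH i).integrable_mul (k3 i)
  have e0 : ∀ ξ ∈ halfStrip F, H 0 ξ * pd 0 (fun ξ => topCutoff R (ξ 1) * D ξ) ξ = topCutoff R (ξ 1) * pd 0 D ξ ^ 2 := by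
    intro ξ hξ
    rw [hHmul 0 _ (fun ξ hξ h => by rw [(k4 ξ hξ).1, (hv0 ξ hξ h).1, zero_mul]) ξ hξ, (k4 ξ hξ).1]; ring
  have e1 : ∀ ξ ∈ halfStrip F, H 1 ξ * pd 1 (fun ξ => topCutoff R (ξ 1) * D ξ) ξ
      = topCutoff R (ξ 1) * pd 1 D ξ ^ 2 + deriv (topCutoff R) (ξ 1) * D ξ * pd 1 D ξ := by
    intro ξ hξ
    rw [hHmul 1 _ (fun ξ hξ h => by rw [(k4 ξ hξ).2, (hv0 ξ hξ h).1, (hv0 ξ hξ h).2]; ring) ξ hξ, (k4 ξ hξ).2]; ring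
  have hcut : ContDiff ℝ ∞ fun ξ : Plane => topCutoff R (ξ 1) := (contDiff_topCutoff R).comp (contDiff_coord 1)
  have a0 : IntegrableOn (fun ξ => topCutoff R (ξ 1) * pd 0 D ξ ^ 2) (halfStrip F) :=
    IntegrableOn.congr_fun (j 0) e0 hO.measurableSet
  have hm1 : ∀ {g : Plane → ℝ}, MemLp g 2 (volume.restrict (truncation F (R + 1))) →
      MemLp (fun ξ => topCutoff R (ξ 1) * g ξ) 2 (volume.restrict (truncation F (R + 1))) := fun hg => by
    refine hg.of_le (hcut.continuous.aestronglyMeasurable.mul hg.1) (Eventually.of_forall fun ξ => ?_)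
    rw [norm_mul]
    refine mul_le_of_le_one_left (norm_nonneg _) ?_
    rw [Real.norm_of_nonneg (topCutoff_nonneg _ _), topCutoff]
    linarith [Real.smoothTransition.nonneg (ξ 1 - R)]
  have a1 : IntegrableOn (fun ξ => topCutoff R (ξ 1) * pd 1 D ξ ^ 2) (halfStrip F) := by
    refine integrableOn_halfStrip_of_truncation hF (R := R + 1) ?_ fun ξ h => by rw [topCutoff_eq_zero h, zero_mul]
    have : IntegrableOn (fun ξ => topCutoff R (ξ 1) * pd 1 D ξ * pd 1 D ξ) (truncation F (R + 1)) :=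
      (hm1 (he.memLp_pd 1 (R + 1))).integrable_mul (he.memLp_pd 1 (R + 1))
    refine this.congr_fun (fun ξ _ => ?_) (isOpen_truncation hF _).measurableSet
    simp only; ring
  have a2 : IntegrableOn (fun ξ => deriv (topCutoff R) (ξ 1) * D ξ * pd 1 D ξ) (halfStrip F) := by
    have : IntegrableOn (fun ξ => H 1 ξ * pd 1 (fun ξ => topCutoff R (ξ 1) * D ξ) ξ - topCutoff R (ξ 1) * pd 1 D ξ ^ 2)
        (halfStrip F) := (j 1).sub a1
    exact this.congr_fun (fun ξ hξ => by simp only [e1 ξ hξ]; ring) hO.measurableSet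
  rw [setIntegral_congr_fun hO.measurableSet e0, setIntegral_congr_fun hO.measurableSet e1, integral_add a1 a2,
    ← add_assoc, ← integral_add a0 a1,
    setIntegral_halfStrip_eq_slice hF hR (fun ξ _ h => by rw [deriv_topCutoff_eq_zero h]; ring) a2] at key
  simp_rw [mul_add]
  linarith

/-- In the band of the energy identity `D` stays bounded while ∂₂D is exponentially small, so the
right-hand side tends to zero. -/
theorem tendsto_integral_topCutoff_energy (hF : IsProfile F) (hs : ContDiffOn ℝ ∞ D (halfStrip F))
    (he : HasLocalEnergy F D) (hv : VanishesOnBottom F D) (hn : WeakNeumannEq F (fun _ => 0) D)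
    {a : ℝ} (hD : EqUpToExpSmall F D fun _ => a) :
    Tendsto (fun R => ∫ ξ in halfStrip F, topCutoff R (ξ 1) * (pd 0 D ξ ^ 2 + pd 1 D ξ ^ 2)) atTop (𝓝 0) := by
  have hO := isOpen_halfStrip hF.smooth.continuous
  obtain ⟨ς, hς, h⟩ := hD
  obtain ⟨K0, hK0⟩ := h 1 one_pos 0
  obtain ⟨K1, hK1⟩ := h 1 one_pos 1
  obtain ⟨C, hC0, hC⟩ := exists_deriv_smoothTransition_bound
  set B := C * (|K0| + |a|) * |K1|
  have hlim : Tendsto (fun R : ℝ => B * Real.exp (-ς * R)) atTop (𝓝 0) := by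
    have : Tendsto (fun R : ℝ => Real.exp (-ς * R)) atTop (𝓝 0) := by
      refine Real.tendsto_exp_atBot.comp ?_
      exact tendsto_id.const_mul_atTop_of_neg (neg_lt_zero.2 hς)
    simpa using this.const_mul B
  refine squeeze_zero_norm' ?_ hlim
  filter_upwards [eventually_gt_atTop 1] with R hR
  rw [integral_topCutoff_energy hF hs he hv hn (by linarith), norm_neg]
  have key : ∀ t ∈ Set.Icc R (R + 1),
      ‖sliceInt (fun ξ => deriv (topCutoff R) (ξ 1) * D ξ * pd 1 D ξ) t‖ ≤ B * Real.exp (-ς * R) := by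
    intro t ht
    refine abs_sliceInt_le (by linarith [ht.1]) fun ξ hξ hξt => ?_
    have hξ1 : 1 < ξ 1 := by rw [hξt]; linarith [ht.1]
    have hξP := straightStrip_subset_halfStrip hF hξ
    have c0 := hK0 ξ hξP hξ1
    have c1 := hK1 ξ hξP hξ1
    have hexp : Real.exp (-ς * ξ 1) ≤ Real.exp (-ς * R) := Real.exp_le_exp.2 (by
      rw [hξt]; nlinarith [ht.1])
    have hexp1 : Real.exp (-ς * ξ 1) ≤ 1 := Real.exp_le_one_iff.2 (by nlinarith)
    have hpos := Real.exp_pos (-ς * ξ 1)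
    have hd : DifferentiableAt ℝ D ξ := (hs.contDiffAt (hO.mem_nhds hξP)).differentiableAt (by simp)
    rw [norm_iteratedFDeriv_zero, Real.norm_eq_abs] at c0
    rw [norm_iteratedFDeriv_one, fderiv_sub_const] at c1
    have d0 : |D ξ| ≤ |K0| + |a| := by
      have := abs_add_le (D ξ - a) a
      rw [sub_add_cancel] at this
      have h3 : K0 * Real.exp (-ς * ξ 1) ≤ |K0| := by
        calc K0 * Real.exp (-ς * ξ 1) ≤ |K0| * 1 :=
              mul_le_mul (le_abs_self _) hexp1 hpos.le (abs_nonneg _)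
          _ = |K0| := mul_one _
      linarith
    have d1 : |pd 1 D ξ| ≤ |K1| * Real.exp (-ς * R) := by
      have h3 : |pd 1 D ξ| ≤ ‖fderiv ℝ D ξ‖ := by
        have := (fderiv ℝ D ξ).le_opNorm (EuclideanSpace.single 1 1)
        simpa [pd] using this
      refine h3.trans (c1.trans ?_)
      exact mul_le_mul (le_abs_self _) hexp hpos.le (abs_nonneg _)
    rw [abs_mul, abs_mul, deriv_topCutoff, abs_neg]
    calc _ ≤ C * (|K0| + |a|) * (|K1| * Real.exp (-ς * R)) :=
          mul_le_mul (mul_le_mul (hC _) d0 (abs_nonneg _) hC0) d1 (abs_nonneg _) (by positivity)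
      _ = _ := by ring
  refine (norm_setIntegral_le_of_norm_le_const (by simp) key).trans ?_
  rw [Real.volume_real_Icc_of_le (by linarith)]
  simp

/-- Uniqueness: the only solution tending to a constant at infinity is zero. -/
theorem eq_zero_of_tendsto_const (hF : IsProfile F) (hs : ContDiffOn ℝ ∞ D (halfStrip F))
    (he : HasLocalEnergy F D) (hv : VanishesOnBottom F D) (hn : WeakNeumannEq F (fun _ => 0) D)
    {a : ℝ} (hD : EqUpToExpSmall F D fun _ => a) : ∀ ξ ∈ halfStrip F, D ξ = 0 := by
  have hO := isOpen_halfStrip hF.smooth.continuous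
  have hlim := tendsto_integral_topCutoff_energy hF hs he hv hn hD
  have p := fun i => (ContDiffOn.pd (i := i) hO hs).continuousOn
  have hcont : ContinuousOn (fun ξ => pd 0 D ξ ^ 2 + pd 1 D ξ ^ 2) (halfStrip F) := ((p 0).pow 2).add ((p 1).pow 2)
  have hsq : ∀ R, IntegrableOn (fun ξ => pd 0 D ξ ^ 2 + pd 1 D ξ ^ 2) (truncation F R) := fun R =>
    (he.memLp_pd 0 R).integrable_sq.add (he.memLp_pd 1 R).integrable_sq
  have hnn : ∀ ξ, 0 ≤ pd 0 D ξ ^ 2 + pd 1 D ξ ^ 2 := fun ξ => by positivity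
  -- The energy below a fixed height is bounded by every cut off energy with larger R, and those
  -- tend to zero.
  have hzero : ∀ R0, ∫ ξ in truncation F R0, (pd 0 D ξ ^ 2 + pd 1 D ξ ^ 2) = 0 := by
    intro R0
    refine le_antisymm (ge_of_tendsto hlim ?_) (integral_nonneg hnn)
    filter_upwards [eventually_ge_atTop R0] with R hR
    have hi : IntegrableOn (fun ξ => topCutoff R (ξ 1) * (pd 0 D ξ ^ 2 + pd 1 D ξ ^ 2)) (halfStrip F) := by
      refine integrableOn_halfStrip_of_truncation hF (R := R + 1) ?_ fun ξ h => by rw [topCutoff_eq_zero h, zero_mul]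
      have hcut : Continuous fun ξ : Plane => topCutoff R (ξ 1) :=
        ((contDiff_topCutoff R).comp (contDiff_coord 1)).continuous
      refine Integrable.mono' (hsq (R + 1)) (hcut.aestronglyMeasurable.mul (hsq (R + 1)).aestronglyMeasurable)
        (Eventually.of_forall fun ξ => ?_)
      rw [Real.norm_of_nonneg (mul_nonneg (topCutoff_nonneg _ _) (hnn ξ))]
      refine mul_le_of_le_one_left (hnn ξ) ?_
      rw [topCutoff]
      linarith [Real.smoothTransition.nonneg (ξ 1 - R)]
    calc ∫ ξ in truncation F R0, (pd 0 D ξ ^ 2 + pd 1 D ξ ^ 2)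
        = ∫ ξ in truncation F R0, topCutoff R (ξ 1) * (pd 0 D ξ ^ 2 + pd 1 D ξ ^ 2) := by
          refine setIntegral_congr_fun (isOpen_truncation hF R0).measurableSet fun ξ hξ => ?_
          have : ξ 1 < R0 := hξ.2
          simp only [topCutoff_eq_one (this.le.trans hR), one_mul]
      _ ≤ _ := setIntegral_mono_set hi (Eventually.of_forall fun ξ => mul_nonneg (topCutoff_nonneg _ _) (hnn ξ))
          (show truncation F R0 ⊆ halfStrip F from Set.inter_subset_left).eventuallyLE
  have hgrad : ∀ ξ ∈ halfStrip F, pd 0 D ξ = 0 ∧ pd 1 D ξ = 0 := by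
    intro ξ hξ
    have hae : (fun ξ => pd 0 D ξ ^ 2 + pd 1 D ξ ^ 2) =ᵐ[volume.restrict (truncation F (ξ 1 + 1))] 0 :=
      (integral_eq_zero_iff_of_nonneg hnn (hsq _)).1 (hzero _)
    have := Measure.eqOn_open_of_ae_eq hae (isOpen_truncation hF _)
      (hcont.mono Set.inter_subset_left) continuousOn_const (show ξ ∈ truncation F (ξ 1 + 1) from ⟨hξ, by simp⟩)
    simp only [Pi.zero_apply] at this
    constructor <;> nlinarith [sq_nonneg (pd 0 D ξ), sq_nonneg (pd 1 D ξ)]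
  have hfd : Set.EqOn (fderiv ℝ D) 0 (halfStrip F) := fun ξ hξ => by
    ext v
    rw [fderiv_eq_pd, (hgrad ξ hξ).1, (hgrad ξ hξ).2]; simp
  have hconst : ∀ ξ ∈ halfStrip F, ∀ ζ ∈ halfStrip F, D ξ = D ζ := fun ξ hξ ζ hζ =>
    hO.is_const_of_fderiv_eq_zero (isPreconnected_halfStrip hF) (hs.differentiableOn (by simp)) hfd hξ hζ
  intro ξ0 hξ0
  -- It remains to exclude a nonzero constant. The vertical unit field, truncated above all
  -- supports, annihilates gradients of test functions, hence also the gradient of the cut off `D`.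
  -- This gives the constant times the integral of the cutoff's derivative, which is -1.
  obtain ⟨k1, k2, k3, k4⟩ := hv.mul_topCutoff hF hs he 1
  have hm : MeasurableSet {ξ : Plane | ξ 1 < 3} :=
    (isOpen_lt (contDiff_coord 1).continuous continuous_const).measurableSet
  have hone : MemLp ({ξ : Plane | ξ 1 < 3}.indicator fun _ => (1:ℝ)) 2 (volume.restrict (halfStrip F)) := by
    rw [memLp_indicator_iff_restrict hm, Measure.restrict_restrict hm, Set.inter_comm]
    exact memLp_truncation_of_continuous hF 3 continuous_const 2
  have key := k1.integral_eq_zero_of_tests hF k2 k3 (R := 2) (by norm_num)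
    (fun ξ _ h => by rw [topCutoff_eq_zero (by linarith), zero_mul])
    (H := fun i => if i = 0 then fun _ => 0 else {ξ : Plane | ξ 1 < 3}.indicator fun _ => (1:ℝ))
    (fun i => by
      fin_cases i
      · exact MemLp.zero
      · exact hone) fun φ hφ => by
      have hφ' : IsTest (aboveGraph F) φ := hφ.mono Set.inter_subset_left
      simp only [if_true, zero_mul, integral_zero, zero_add, one_ne_zero, if_false]
      have e : ∫ ξ in halfStrip F, {ξ : Plane | ξ 1 < 3}.indicator (fun _ => (1:ℝ)) ξ * pd 1 φ ξ
          = ∫ ξ in halfStrip F, pd 1 φ ξ := by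
        refine integral_congr_ae (Eventually.of_forall fun ξ => ?_)
        by_cases h : ξ 1 < 3
        · simp [h]
        · have : pd 1 φ ξ = 0 := (hφ.pd 1).eq_zero fun h' => h (by have := h'.2; norm_num at this; exact this)
          simp [this]
      rw [e, setIntegral_halfStrip_eq_strip fun x hx => (hφ'.pd 1).eq_zero hx]
      exact setIntegral_strip_pd_one hφ'
  simp only [if_true, zero_mul, integral_zero, zero_add, one_ne_zero, if_false] at key
  have e1 : ∀ ξ ∈ halfStrip F, {ξ : Plane | ξ 1 < 3}.indicator (fun _ => (1:ℝ)) ξ *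
      pd 1 (fun ξ => topCutoff 1 (ξ 1) * D ξ) ξ = D ξ0 * deriv (topCutoff 1) (ξ 1) := by
    intro ξ hξ
    rw [(k4 ξ hξ).2, (hgrad ξ hξ).2, hconst ξ hξ ξ0 hξ0]
    by_cases h : ξ 1 < 3
    · simp [h]; ring
    · rw [deriv_topCutoff_eq_zero fun h' => h (by linarith [h'.2])]; simp
  rw [setIntegral_congr_fun (isOpen_halfStrip hF.smooth.continuous).measurableSet e1, integral_const_mul] at key
  have hint : IntegrableOn (fun ξ : Plane => deriv (topCutoff 1) (ξ 1)) (halfStrip F) := by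
    refine integrableOn_halfStrip_of_truncation hF (R := 3) ?_ fun ξ h =>
      deriv_topCutoff_eq_zero fun h' => by linarith [h'.2]
    have := isFiniteMeasure_truncation hF 3
    exact (memLp_truncation_of_continuous hF 3
      ((contDiff_topCutoff 1).deriv_real.comp (contDiff_coord 1)).continuous 2).integrable (by norm_num)
  rw [setIntegral_halfStrip_eq_slice hF one_pos (fun ξ _ h => deriv_topCutoff_eq_zero h) hint] at key
  simp_rw [sliceInt_fun_coord (deriv (topCutoff 1))] at key
  rw [integral_Icc_eq_integral_Ioc, ← intervalIntegral.integral_of_le (by norm_num),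
    intervalIntegral.integral_deriv_eq_sub (fun t _ => (contDiff_topCutoff 1).differentiable (by simp) t)
      ((contDiff_topCutoff 1).deriv_real.continuous.intervalIntegrable _ _),
    topCutoff_eq_zero le_rfl, topCutoff_eq_one le_rfl] at key
  linarith

end

/-! ### Solutions with prescribed growth and uniqueness of the cell solution -/

section

variable {F : ℝ → ℝ}

theorem EqUpToExpSmall.congr (hF : IsProfile F) {u v p q : Plane → ℝ} (h : EqUpToExpSmall F u p)
    (he : ∀ ξ ∈ halfStrip F, u ξ - p ξ = v ξ - q ξ) : EqUpToExpSmall F v q := by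
  have hO := isOpen_halfStrip hF.smooth.continuous
  obtain ⟨ς, hς, h⟩ := h
  refine ⟨ς, hς, fun δ hδ k => ?_⟩
  obtain ⟨K, hK⟩ := h δ hδ k
  refine ⟨K, fun ξ hξ hξδ => ?_⟩
  have e : (fun η => v η - q η) =ᶠ[𝓝 ξ] fun η => u η - p η := by
    filter_upwards [hO.mem_nhds hξ] with η hη using (he η hη).symm
  rw [(e.iteratedFDeriv ℝ k).eq_of_nhds]
  exact hK ξ hξ hξδ

theorem IsStripSolution.isNeumannSolution {f u : Plane → ℝ} (h : IsStripSolution F f u)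
    (hf : ∀ R, MemLp f 2 (volume.restrict (truncation F R))) : IsNeumannSolution F f u :=
  ⟨h.smooth, hf, h.energy, h.neumann⟩

theorem IsStripSolution.congr_rhs (hF : IsProfile F) {f g u : Plane → ℝ} (h : IsStripSolution F f u)
    (hfg : Set.EqOn f g (halfStrip F)) : IsStripSolution F g u where
  smooth := h.smooth
  equation ξ hξ := (h.equation ξ hξ).trans (hfg hξ)
  energy := h.energy
  dirichlet := h.dirichlet
  neumann φ h1 h2 h3 := by
    have e : ∫ ξ in halfStrip F, f ξ * φ ξ = ∫ ξ in halfStrip F, g ξ * φ ξ :=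
      setIntegral_congr_fun (isOpen_halfStrip hF.smooth.continuous).measurableSet
        fun ξ hξ => by simp only [hfg hξ]
    rw [h.neumann φ h1 h2 h3, e]

theorem memLp_exp_neg (hF : IsProfile F) {c : ℝ} (hc : 0 < c) :
    MemLp (fun ξ : Plane => Real.exp (-c * ξ 1)) 2 (volume.restrict (halfStrip F)) := by
  have hO := isOpen_halfStrip hF.smooth.continuous
  have hcont : Continuous fun ξ : Plane => Real.exp (-c * ξ 1) := by fun_prop
  obtain ⟨M, -, hM⟩ := hF.exists_lower_bound
  rw [memLp_two_iff_integrable_sq hcont.aestronglyMeasurable]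
  have e : (fun ξ : Plane => Real.exp (-c * ξ 1) ^ 2) = fun ξ => Real.exp (-(2 * c) * ξ 1) := by
    funext ξ; rw [← Real.exp_nat_mul]; congr 1; push_cast; ring
  rw [e]
  set A : Set Plane := {ξ | (-(1 / 2) < ξ 0 ∧ ξ 0 < 1 / 2) ∧ -M < ξ 1}
  have hsub : halfStrip F ⊆ A := fun ξ hξ => ⟨⟨hξ.1, hξ.2.1⟩, (hM _).trans_lt hξ.2.2⟩
  refine IntegrableOn.mono_set (t := A) ?_ hsub
  rw [← measurePreserving_plane.integrableOn_comp_preimage measurableEmbedding_plane]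
  have hpre : (fun p : ℝ × ℝ => (!₂[p.1, p.2] : Plane)) ⁻¹' A = Set.Ioo (-(1 / 2)) (1 / 2) ×ˢ Set.Ioi (-M) := by
    ext p
    simp [A]
  rw [hpre, IntegrableOn, Measure.volume_eq_prod, ← Measure.prod_restrict]
  have h1 : Integrable (fun _ : ℝ => (1:ℝ)) (volume.restrict (Set.Ioo (-(1 / 2) : ℝ) (1 / 2))) := by
    rw [integrable_const_iff]; simp [isFiniteMeasure_restrict]
  have h2 : IntegrableOn (fun t : ℝ => Real.exp (-(2 * c) * t)) (Set.Ioi (-M)) :=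
    integrableOn_exp_mul_Ioi (by linarith) _
  refine (h1.mul_prod h2).congr (Eventually.of_forall fun p => ?_)
  simp

theorem memLp_halfStrip_of_expSmall (hF : IsProfile F) {g : Plane → ℝ} {ς K : ℝ} (hς : 0 < ς)
    (hgc : ContinuousOn g (halfStrip F)) (hg2 : MemLp g 2 (volume.restrict (truncation F 2)))
    (hg : ∀ ξ ∈ halfStrip F, 1 < ξ 1 → |g ξ| ≤ K * Real.exp (-ς * ξ 1)) :
    MemLp g 2 (volume.restrict (halfStrip F)) := by
  have hO := isOpen_halfStrip hF.smooth.continuous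
  have hgm : AEStronglyMeasurable g (volume.restrict (halfStrip F)) :=
    hgc.aestronglyMeasurable hO.measurableSet
  have hm : MeasurableSet {ξ : Plane | ξ 1 < 2} :=
    (isOpen_lt (contDiff_coord 1).continuous continuous_const).measurableSet
  have h1 : MemLp ({ξ : Plane | ξ 1 < 2}.indicator g) 2 (volume.restrict (halfStrip F)) := by
    rw [memLp_indicator_iff_restrict hm, Measure.restrict_restrict hm, Set.inter_comm]
    exact hg2
  have h2 : MemLp (fun ξ => K * Real.exp (-ς * ξ 1)) 2 (volume.restrict (halfStrip F)) :=
    (memLp_exp_neg hF hς).const_mul K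
  refine (h1.norm.add h2.norm).of_le hgm ?_
  filter_upwards [ae_restrict_mem hO.measurableSet] with ξ hξ
  simp only [Pi.add_apply]
  rw [Real.norm_of_nonneg (add_nonneg (norm_nonneg _) (norm_nonneg _))]
  by_cases h : ξ 1 < 2
  · rw [Set.indicator_of_mem (show ξ ∈ {ξ : Plane | ξ 1 < 2} from h)]
    exact le_add_of_nonneg_right (norm_nonneg _)
  · have := hg ξ hξ (by linarith)
    refine le_add_of_nonneg_of_le (norm_nonneg _) ?_
    exact this.trans (le_abs_self _)

/-- Solvability of the strip problem with prescribed polynomial-type growth `p` at infinity. -/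
theorem exists_solution_with_asymptotics (hF : IsProfile F) {f : Plane → ℝ} {p : ℝ → ℝ} (hp : ContDiff ℝ ∞ p)
    (hf : ContDiffOn ℝ ∞ f (halfStrip F)) (hfh : ∀ ξ ∈ halfStrip F, Δ f ξ = 0)
    (hf2 : ∀ R, MemLp f 2 (volume.restrict (truncation F R)))
    (hN : IsNeumannSolution F (fun _ => 0) fun ξ => f ξ - deriv (deriv p) (ξ 1))
    (hexp : EqUpToExpSmall F f fun ξ => deriv (deriv p) (ξ 1))
    (hmean : ∀ t, 0 < t → sliceInt (fun ξ => f ξ - deriv (deriv p) (ξ 1)) t = 0) :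
    ∃ (Y : Plane → ℝ) (a : ℝ), IsStripSolution F f Y ∧ EqUpToExpSmall F Y (fun ξ => p (ξ 1) + a) ∧
      ∀ t, 0 < t → sliceInt (fun ξ => Y ξ - p (ξ 1)) t = a := by
  have hO := isOpen_halfStrip hF.smooth.continuous
  -- The cutoff makes the growth term vanish for t ≤ 0, as `exists_strip_solution` requires, and
  -- leaves it unchanged for t ≥ 1.
  set q : ℝ → ℝ := fun t => Real.smoothTransition t * p t with hq
  have hqs : ContDiff ℝ ∞ q := (Real.smoothTransition.contDiff (n := ⊤)).mul hp
  have hq1 : ∀ t, 1 < t → q =ᶠ[𝓝 t] p := fun t ht => by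
    filter_upwards [lt_mem_nhds ht] with s hs
    simp only [hq]
    rw [Real.smoothTransition.one_of_one_le hs.le, one_mul]
  obtain ⟨ς, hς, hK⟩ := id hexp
  obtain ⟨K, hK⟩ := hK 1 one_pos 0
  -- With η ≤ ς the weight e^{ηξ₂/2} still leaves decay at rate ς/2; η ≤ 1 is what excludes growth
  -- like e^t through `not_expGrowth_of_memLp`.
  set η := min ς 1 with hη
  have hη0 : 0 < η := lt_min hς one_pos
  have hqc : Continuous fun ξ : Plane => deriv (deriv q) (ξ 1) :=
    (hqs.deriv_real.deriv_real.comp (contDiff_coord 1)).continuous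
  have hec : Continuous fun ξ : Plane => Real.exp (η / 2 * ξ 1) := by fun_prop
  have hg : MemLp (fun ξ => (f ξ - deriv (deriv q) (ξ 1)) * Real.exp (η / 2 * ξ 1)) 2
      (volume.restrict (halfStrip F)) := by
    refine memLp_halfStrip_of_expSmall hF (half_pos hς) (K := K)
      ((hf.continuousOn.sub hqc.continuousOn).mul hec.continuousOn) ?_ fun ξ hξ hξ1 => ?_
    · have h1 := (hf2 2).sub (memLp_truncation_of_continuous hF 2 hqc 2)
      refine MemLp.of_le_mul (c := Real.exp η) h1 (h1.1.mul hec.aestronglyMeasurable) ?_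
      filter_upwards [ae_restrict_mem (isOpen_truncation hF 2).measurableSet] with ξ hξ
      have : ξ 1 < 2 := hξ.2
      rw [norm_mul, mul_comm, Real.norm_of_nonneg (Real.exp_pos _).le]
      refine mul_le_mul_of_nonneg_right (Real.exp_le_exp.2 (by nlinarith)) (norm_nonneg _)
    · have := hK ξ hξ hξ1
      rw [norm_iteratedFDeriv_zero, Real.norm_eq_abs] at this
      rw [((hq1 _ hξ1).deriv.deriv).eq_of_nhds, abs_mul, abs_of_pos (Real.exp_pos _)]
      calc _ ≤ K * Real.exp (-ς * ξ 1) * Real.exp (η / 2 * ξ 1) :=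
            mul_le_mul_of_nonneg_right this (Real.exp_pos _).le
        _ = K * Real.exp (-ς * ξ 1 + η / 2 * ξ 1) := by rw [mul_assoc, ← Real.exp_add]
        _ ≤ _ := by
          have hK0 : 0 ≤ K := by
            by_contra! h
            have := (abs_nonneg _).trans this
            nlinarith [Real.exp_pos (-ς * ξ 1)]
          refine mul_le_mul_of_nonneg_left (Real.exp_le_exp.2 ?_) hK0
          have : η ≤ ς := min_le_left _ _
          nlinarith
  obtain ⟨Y, hY, hY1, hY2⟩ := exists_strip_solution hF hη0 hqs
    (fun t ht => by simp only [hq]; rw [Real.smoothTransition.zero_of_nonpos ht, zero_mul]) hf hfh hg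
  have hu := (hY.isNeumannSolution hf2).sub hF (isNeumannSolution_fun_coord hF hp)
  have hps : ContDiff ℝ ∞ fun ξ : Plane => p (ξ 1) := hp.comp (contDiff_coord 1)
  have hgr : ¬ ExpGrowth fun ξ => Y ξ - p (ξ 1) :=
    not_expGrowth_of_memLp hF (T0 := 1) (min_le_right ς 1) hY1 fun ξ _ h => by
      rw [(hq1 _ h).eq_of_nhds]
  obtain ⟨a, b, hab, hasym⟩ := hu.exists_affine_asymptotics hF hN
    (hexp.congr hF fun ξ _ => by ring) hmean hgr
  -- Square integrability of ∂₂Y - q' removes the linear term, so only an additive constant is left.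
  have hb : b = 0 := by
    refine hu.slope_eq_zero hF (T0 := 1) hN hab hY2 fun ξ hξ hξ1 => ?_
    have hξP := straightStrip_subset_halfStrip hF hξ
    have hd : DifferentiableAt ℝ Y ξ := (hY.smooth.contDiffAt (hO.mem_nhds hξP)).differentiableAt (by simp)
    have h1 : HasFDerivAt (fun ξ => Y ξ - p (ξ 1)) _ ξ :=
      hd.hasFDerivAt.sub (hps.differentiable (by simp) ξ).hasFDerivAt
    have h2 := (pd_fun_coord (x := ξ) (hp.differentiable (by simp) _).hasDerivAt).2
    rw [pd, h1.fderiv, sub_apply, ← pd, ← pd, h2, (hq1 _ hξ1).deriv_eq]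
  subst hb
  refine ⟨Y, a, hY, hasym.congr hF fun ξ _ => by ring, fun t ht => by rw [hab t ht, zero_mul, add_zero]⟩

theorem VanishesOnBottom.sub (hF : IsProfile F) {u v : Plane → ℝ} (hu : ContDiffOn ℝ ∞ u (halfStrip F))
    (hv : ContDiffOn ℝ ∞ v (halfStrip F)) (eu : HasLocalEnergy F u) (ev : HasLocalEnergy F v)
    (bu : VanishesOnBottom F u) (bv : VanishesOnBottom F v) : VanishesOnBottom F fun ξ => u ξ - v ξ := by
  intro ψ h1 h2 h3 w
  have hO := isOpen_halfStrip hF.smooth.continuous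
  have hψc : Continuous fun ξ => fderiv ℝ ψ ξ w := (h1.continuous_fderiv (by simp)).clm_apply continuous_const
  have hψs : HasCompactSupport fun ξ => fderiv ℝ ψ ξ w :=
    (h2.fderiv ℝ).comp_left (g := fun L : Plane →L[ℝ] ℝ => L w) rfl
  have hw : ∀ {g : Plane → ℝ}, HasLocalEnergy F g → ∀ R, MemLp (fun ξ => fderiv ℝ g ξ w) 2 (volume.restrict (truncation F R)) :=
    fun {g} hg R => by
      have e : (fun ξ => fderiv ℝ g ξ w) = fun ξ => w 0 * pd 0 g ξ + w 1 * pd 1 g ξ := funext fun ξ => fderiv_eq_pd _ _ _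
      rw [e]
      exact ((hg.memLp_pd 0 R).const_mul _).add ((hg.memLp_pd 1 R).const_mul _)
  have e : ∫ ξ in halfStrip F, fderiv ℝ (fun ξ => u ξ - v ξ) ξ w * ψ ξ
      = ∫ ξ in halfStrip F, (fderiv ℝ u ξ w * ψ ξ - fderiv ℝ v ξ w * ψ ξ) := by
    refine setIntegral_congr_fun hO.measurableSet fun ξ hξ => ?_
    have hd : ∀ {g : Plane → ℝ}, ContDiffOn ℝ ∞ g (halfStrip F) → DifferentiableAt ℝ g ξ :=
      fun hg => (hg.contDiffAt (hO.mem_nhds hξ)).differentiableAt (by simp)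
    have h : HasFDerivAt (fun ξ => u ξ - v ξ) _ ξ := (hd hu).hasFDerivAt.sub (hd hv).hasFDerivAt
    rw [h.fderiv, sub_apply, sub_mul]
  rw [e, integral_sub (integrableOn_mul_of_truncation hF (hw eu) h1.continuous h2)
    (integrableOn_mul_of_truncation hF (hw ev) h1.continuous h2)]
  simp_rw [sub_mul]
  rw [integral_sub (integrableOn_mul_of_truncation hF (fun R => (eu R).1) hψc hψs)
    (integrableOn_mul_of_truncation hF (fun R => (ev R).1) hψc hψs), bu ψ h1 h2 h3 w, bv ψ h1 h2 h3 w]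
  ring

theorem eventually_stripInfinity {P : Plane → Prop} (h : ∀ᶠ ξ in stripInfinity F, P ξ) :
    ∃ T, ∀ ξ ∈ halfStrip F, T < ξ 1 → P ξ := by
  rw [stripInfinity, eventually_inf_principal, eventually_comap] at h
  obtain ⟨T, hT⟩ := eventually_atTop.1 h
  exact ⟨T, fun ξ hξ hξT => hT _ hξT.le ξ rfl hξ⟩

theorem isEquivalent_of_eqUpToExpSmall {X : Plane → ℝ} {C : ℝ} (h : EqUpToExpSmall F X fun ξ => ξ 1 + C) :
    X ~[stripInfinity F] fun ξ => ξ 1 := by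
  obtain ⟨ς, hς, h⟩ := h
  obtain ⟨K, hK⟩ := h 1 one_pos 0
  refine isLittleO_iff.2 fun c hc => ?_
  rw [stripInfinity, eventually_inf_principal, eventually_comap]
  filter_upwards [eventually_ge_atTop ((|C| + |K|) / c), eventually_gt_atTop 1] with t ht ht1 ξ hξt hξ
  subst hξt
  have := hK ξ hξ ht1
  rw [norm_iteratedFDeriv_zero, Real.norm_eq_abs] at this
  rw [Pi.sub_apply, Real.norm_eq_abs, Real.norm_of_nonneg (by linarith)]
  rw [div_le_iff₀ hc] at ht
  have h3 : K * Real.exp (-ς * ξ 1) ≤ |K| := by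
    have h4 : Real.exp (-ς * ξ 1) ≤ 1 := Real.exp_le_one_iff.2 (by nlinarith)
    calc K * Real.exp (-ς * ξ 1) ≤ |K| * 1 :=
          mul_le_mul (le_abs_self _) h4 (Real.exp_pos _).le (abs_nonneg _)
      _ = |K| := mul_one _
  have h5 := abs_add_le (X ξ - (ξ 1 + C)) C
  have h6 : X ξ - (ξ 1 + C) + C = X ξ - ξ 1 := by ring
  rw [h6] at h5
  linarith

/-- Both solutions are equivalent to ξ₂, so their difference is o(ξ₂). This excludes exponential
growth and a nonzero slope, and the difference tends exponentially fast to a constant, where the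
energy argument applies. -/
theorem IsCellSolution.eqOn (hF : IsProfile F) {X X' : Plane → ℝ} (h : IsCellSolution F X)
    (h' : IsCellSolution F X') : Set.EqOn X X' (halfStrip F) := by
  have z : ∀ R, MemLp (fun _ : Plane => (0:ℝ)) 2 (volume.restrict (truncation F R)) := fun _ => MemLp.zero
  have hD := (h.1.isNeumannSolution z).sub hF (h'.1.isNeumannSolution z)
  simp only [sub_zero] at hD
  have h0 : IsNeumannSolution F (fun _ => 0) fun _ => 0 := by
    simpa using isNeumannSolution_affine hF 0 0
  have hlit : ∀ ε, 0 < ε → ∃ T, ∀ ξ ∈ halfStrip F, T < ξ 1 → |X ξ - X' ξ| ≤ ε * |ξ 1| := fun ε hε => by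
    have := (IsLittleO.sub h.2 h'.2).def hε
    obtain ⟨T, hT⟩ := eventually_stripInfinity this
    refine ⟨T, fun ξ hξ hξT => ?_⟩
    have := hT ξ hξ hξT
    simpa using this
  have hgr : ¬ ExpGrowth fun ξ => X ξ - X' ξ := by
    rintro ⟨m, hm, T, hT⟩
    obtain ⟨T1, hT1⟩ := hlit 1 one_pos
    have hsm : ∀ᶠ t in atTop, t ^ 2 ≤ m / 2 * Real.exp t := by
      filter_upwards [(Real.isLittleO_pow_exp_atTop (n := 2)).def (half_pos hm)] with t ht
      rwa [Real.norm_of_nonneg (sq_nonneg _), Real.norm_of_nonneg (Real.exp_pos _).le] at ht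
    obtain ⟨t, ht, htT, htT1, ht0⟩ := (hsm.and ((eventually_gt_atTop T).and
      ((eventually_gt_atTop T1).and (eventually_gt_atTop 0)))).exists
    have h1 := hT t htT
    have h2 := (abs_sliceInt_le (G := fun ξ => (X ξ - X' ξ) ^ 2) (C := t ^ 2) ht0 fun ξ hξ hξt => by
      have := hT1 ξ (straightStrip_subset_halfStrip hF hξ) (hξt ▸ htT1)
      rw [one_mul, hξt] at this
      rw [abs_of_nonneg (sq_nonneg _)]
      exact sq_le_sq.2 this)
    have h3 := le_abs_self (sliceInt (fun ξ => (X ξ - X' ξ) ^ 2) t)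
    have h4 := mul_pos hm (Real.exp_pos t)
    linarith
  obtain ⟨a, b, hab, hasym⟩ := hD.exists_affine_asymptotics hF h0
    ⟨1, one_pos, fun δ _ k => ⟨0, fun ξ _ _ => by simp⟩⟩
    (fun t _ => by simp [sliceInt]) hgr
  have hb : b = 0 := by
    by_contra hb
    obtain ⟨T, hT⟩ := hlit (|b| / 2) (by positivity)
    have hlarge : ∀ᶠ t in atTop, |a| < |b| / 2 * t :=
      (tendsto_id.const_mul_atTop (by positivity : 0 < |b| / 2)).eventually_gt_atTop _
    obtain ⟨t, ht, htT, ht0⟩ := (hlarge.and ((eventually_gt_atTop T).and (eventually_gt_atTop 0))).exists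
    have h1 := abs_sliceInt_le (G := fun ξ => X ξ - X' ξ) (C := |b| / 2 * t) ht0 fun ξ hξ hξt => by
      have := hT ξ (straightStrip_subset_halfStrip hF hξ) (hξt ▸ htT)
      rwa [hξt, abs_of_pos ht0] at this
    rw [hab t ht0] at h1
    have h2 := abs_sub_abs_le_abs_sub (b * t) (-a)
    rw [abs_neg, abs_mul, abs_of_pos ht0, sub_neg_eq_add, add_comm (b * t)] at h2
    linarith
  subst hb
  have ha : EqUpToExpSmall F (fun ξ => X ξ - X' ξ) fun _ => a := hasym.congr hF fun ξ _ => by simp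
  intro ξ hξ
  exact sub_eq_zero.1 (eq_zero_of_tendsto_const hF hD.smooth hD.energy
    (h.1.dirichlet.sub hF h.1.smooth h'.1.smooth h.1.energy h'.1.energy h'.1.dirichlet) hD.neumann
    ha ξ hξ)

end

/-! ### The two constants and the two solutions -/

theorem proposition2 (F : ℝ → ℝ) (hF : IsProfile F) :
    ∃ C C_II : ℝ,
      (∃ X : Plane → ℝ, IsCellSolution F X) ∧
      ∀ X : Plane → ℝ, IsCellSolution F X →
        EqUpToExpSmall F X (fun ξ => ξ 1 + C) ∧
        ∃ Y : Plane → ℝ, IsStripSolution F X Y ∧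
          EqUpToExpSmall F Y (fun ξ => (ξ 1) ^ 3 / 6 + C * (ξ 1) ^ 2 / 2 + C_II) := by
  have z : ∀ R, MemLp (fun _ : Plane => (0:ℝ)) 2 (volume.restrict (truncation F R)) := fun _ => MemLp.zero
  have h0 : IsNeumannSolution F (fun _ => 0) fun _ => 0 := by
    simpa using isNeumannSolution_affine hF 0 0
  have d2 : deriv (deriv fun t : ℝ => t) = fun _ => 0 := by
    have : deriv (fun t : ℝ => t) = fun _ => 1 := by funext t; simp
    rw [this]; simp
  have hp0 : ∀ i, pd i (fun _ : Plane => (0:ℝ)) = fun _ => 0 := fun i => by funext ξ; simp [pd]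
  -- Growth p(t) = t has p'' = 0 and matches the source 0. The exact section means, not only the
  -- asymptotics, are kept for the second problem.
  obtain ⟨X, C, hX, hXC, hXmean⟩ := exists_solution_with_asymptotics hF (f := fun _ => 0) (p := fun t => t)
    contDiff_id contDiffOn_const (fun ξ _ => by rw [laplacian_fun_eq_pd contDiff_const]; simp [hp0]) z
    (by simpa [d2] using h0) (by rw [d2]; exact ⟨1, one_pos, fun δ _ k => ⟨0, fun ξ _ _ => by simp⟩⟩)
    (fun t _ => by simp [sliceInt])
  have hcell : IsCellSolution F X := ⟨hX, isEquivalent_of_eqUpToExpSmall hXC⟩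
  -- Chosen so that p'' = t + C is the asymptotic form of `X`.
  set p : ℝ → ℝ := fun t => t ^ 3 / 6 + C * t ^ 2 / 2 with hp
  have hps : ContDiff ℝ ∞ p := by fun_prop
  have dp : deriv (deriv p) = fun t => t + C := by
    have e1 : deriv p = fun t => t ^ 2 / 2 + C * t := by
      funext t
      have : HasDerivAt p (((3:ℕ) * t ^ 2) / 6 + C * ((2:ℕ) * t ^ 1) / 2) t :=
        ((hasDerivAt_pow 3 t).div_const 6).add (((hasDerivAt_pow 2 t).const_mul C).div_const 2)
      rw [this.deriv]; push_cast; ring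
    funext t
    have : HasDerivAt (deriv p) (((2:ℕ) * t ^ 1) / 2 + C * 1) t := by
      rw [e1]
      exact ((hasDerivAt_pow 2 t).div_const 2).add ((hasDerivAt_id t).const_mul C)
    rw [this.deriv]; push_cast; ring
  have hXN : IsNeumannSolution F (fun _ => 0) fun ξ => X ξ - deriv (deriv p) (ξ 1) := by
    have := (hX.isNeumannSolution z).sub hF (isNeumannSolution_affine hF C 1)
    simpa [dp, add_comm] using this
  -- The zero-mean hypothesis on X - (ξ₂ + C) says exactly that X - ξ₂ has mean C on every section
  -- above height zero.
  obtain ⟨Y, C_II, hY, hYC, -⟩ := exists_solution_with_asymptotics hF hps hX.smooth hX.equation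
    (fun R => (hX.energy R).1) hXN (by rw [dp]; exact hXC) fun t ht => by
      have hc := (hX.isNeumannSolution z).contDiffOn_evenExt hF h0
      have he := (hX.isNeumannSolution z).evenExt_eq hF h0
      have h1 := hXmean t ht
      rw [← sliceInt_congr (G := fun ξ => evenExt X ξ - ξ 1) (fun ξ hξ => by simp only [he hξ]) ht,
        sliceInt_sub hc.continuousOn (by fun_prop) ht, sliceInt_fun_coord fun t => t] at h1
      rw [← sliceInt_congr (G := fun ξ => evenExt X ξ - deriv (deriv p) (ξ 1)) (fun ξ hξ => by simp only [he hξ]) ht,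
        sliceInt_sub hc.continuousOn (by rw [dp]; fun_prop) ht, sliceInt_fun_coord (deriv (deriv p)), dp]
      simp only
      linarith
  refine ⟨C, C_II, ⟨X, hcell⟩, fun X' hX' => ?_⟩
  -- By uniqueness the constants do not depend on the cell solution, and the same `Y` serves all of
  -- them.
  have hXX := hcell.eqOn hF hX'
  exact ⟨hXC.congr hF fun ξ hξ => by rw [hXX hξ], Y, hY.congr_rhs hF hXX, hYC⟩
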